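/- Theorem 1.2. Let $(\mathcal M,g)$ be a compact smooth Riemannian manifold (without boundary) of dimension $n$, let $\phi\in C^2(\mathcal M)$, and let $L=\Delta-\nabla\phi\cdot\nabla$, where $\Delta$ is the Laplace–Beltrami operator. Let $m\ge n$ be a real constant, where $m=n$ is allowed only if $\nabla\phi\equiv 0$ (i.e. $L=\Delta$), and let $$Ric_{m,n}(L)=Ric+\nabla^2\phi-\frac{\nabla\phi\otimes\nabla\phi}{m-n}$$ be the Bakry–Émery Ricci curvature, the last term being omitted if $m=n$. Assume that $Ric_{m,n}(L)\ge -k$ on $\mathcal M$ for a constant $k\ge 0$, that is, $Ric_{m,n}(L)(v,v)\ge -k|v|^2$ for all tangent vectors $v$. Let $0<T\le\infty$, and let $u$ be a positive classical solution (of class $C^2$ in space and $C^1$ in time, with the corresponding derivatives continuous in space-time) of $\partial_t u=Lu$ on $\mathcal M\times(0,T]$ (on $\mathcal M\times(0,\infty)$ if $T=\infty$), with $u\le M$ for a constant $M$. Then on all of $\mathcal M\times(0,T]$ (resp. $\mathcal M\times(0,\infty)$) $$\frac{|\nabla u|^2}{u^2}\le\Big(\frac1t+2k\Big)\ln\frac{M}{u}.$$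 -/

import Mathlib

open Set Bundle
open scoped Manifold ContDiff

noncomputable section

namespace DiffusionGradient

/-! ### Riemannian geometry in local coordinates

`G : E → Matrix` is the matrix of metric coefficients `g_ij` of a chart, where
`E = EuclideanSpace ℝ (Fin n)` is the coordinate space. -/

/-- The partial derivative `∂_i f` at `y`. -/
def pderiv {n : ℕ} (i : Fin n) (f : EuclideanSpace ℝ (Fin n) → ℝ)
    (y : EuclideanSpace ℝ (Fin n)) : ℝ :=
  fderiv ℝ f y (EuclideanSpace.single i 1)

/-- The Christoffel symbol
`Γ^k_ij = 1/2 ∑_l g^{kl} (∂_i g_jl + ∂_j g_il - ∂_l g_ij)` of the Levi-Civita connection. -/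
def christoffel {n : ℕ} (G : EuclideanSpace ℝ (Fin n) → Matrix (Fin n) (Fin n) ℝ)
    (k i j : Fin n) (y : EuclideanSpace ℝ (Fin n)) : ℝ :=
  (1 / 2) * ∑ l, (G y)⁻¹ k l *
    (pderiv i (fun z => G z j l) y + pderiv j (fun z => G z i l) y
      - pderiv l (fun z => G z i j) y)

/-- The components of the Ricci tensor, with the sign for which round spheres are positive:
`R_ij = ∑_k (∂_k Γ^k_ij - ∂_j Γ^k_ik) + ∑_{k,l} (Γ^k_kl Γ^l_ij - Γ^k_jl Γ^l_ik)`. -/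
def ricciCoord {n : ℕ} (G : EuclideanSpace ℝ (Fin n) → Matrix (Fin n) (Fin n) ℝ)
    (i j : Fin n) (y : EuclideanSpace ℝ (Fin n)) : ℝ :=
  ∑ k, (pderiv k (christoffel G k i j) y - pderiv j (christoffel G k i k) y)
    + ∑ k, ∑ l, (christoffel G k k l y * christoffel G l i j y
        - christoffel G k j l y * christoffel G l i k y)

/-- The components `∂_i ∂_j f - ∑_k Γ^k_ij ∂_k f` of the Hessian `∇² f`. -/
def hessCoord {n : ℕ} (G : EuclideanSpace ℝ (Fin n) → Matrix (Fin n) (Fin n) ℝ)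
    (f : EuclideanSpace ℝ (Fin n) → ℝ) (i j : Fin n) (y : EuclideanSpace ℝ (Fin n)) : ℝ :=
  pderiv i (pderiv j f) y - ∑ k, christoffel G k i j y * pderiv k f y

/-! ### Riemannian manifolds -/

section Manifold

variable {n : ℕ} {M : Type*} [TopologicalSpace M] [ChartedSpace (EuclideanSpace ℝ (Fin n)) M]
  [RiemannianBundle (fun x : M => TangentSpace (𝓡 n) x)]

/-- The metric coefficients `g_ij = ⟨∂_i, ∂_j⟩` in the chart `c`, at the point with
coordinates `y`; here `∂_i` is the image of the `i`-th basis vector under the differential of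
the inverse of the chart. -/
def metricCoeff (c : OpenPartialHomeomorph M (EuclideanSpace ℝ (Fin n)))
    (y : EuclideanSpace ℝ (Fin n)) : Matrix (Fin n) (Fin n) ℝ :=
  Matrix.of fun i j =>
    inner ℝ (mfderiv (𝓡 n) (𝓡 n) c.symm y (EuclideanSpace.single i (1 : ℝ)))
      (mfderiv (𝓡 n) (𝓡 n) c.symm y (EuclideanSpace.single j (1 : ℝ)))

/-- The components `v^i` in the chart `c` of a tangent vector `v` at `x`. -/
def component (c : OpenPartialHomeomorph M (EuclideanSpace ℝ (Fin n))) {x : M}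
    (v : TangentSpace (𝓡 n) x) : EuclideanSpace ℝ (Fin n) :=
  mfderiv (𝓡 n) (𝓡 n) c x v

instance (x : M) : CompleteSpace (TangentSpace (𝓡 n) x) :=
  haveI : FiniteDimensional ℝ (TangentSpace (𝓡 n) x) :=
    inferInstanceAs (FiniteDimensional ℝ (EuclideanSpace ℝ (Fin n)))
  FiniteDimensional.complete ℝ _

variable (n) in
/-- The Riemannian gradient `∇ f` at `x`: the tangent vector that represents the differential
of `f` through the metric. -/
def grad (f : M → ℝ) (x : M) : TangentSpace (𝓡 n) x :=
  (InnerProductSpace.toDual ℝ (TangentSpace (𝓡 n) x)).symm (mfderiv (𝓡 n) 𝓘(ℝ, ℝ) f x)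

theorem inner_grad (f : M → ℝ) (x : M) (v : TangentSpace (𝓡 n) x) :
    inner ℝ (grad n f x) v = (mfderiv (𝓡 n) 𝓘(ℝ, ℝ) f x v : ℝ) := by
  unfold grad
  exact InnerProductSpace.toDual_symm_apply

/-- The Ricci tensor `Ric(v, w)` at `x`, computed in a chart `c` around `x`. The value does not
depend on the chart. -/
def ricci (c : OpenPartialHomeomorph M (EuclideanSpace ℝ (Fin n))) {x : M}
    (v w : TangentSpace (𝓡 n) x) : ℝ :=
  ∑ i, ∑ j, ricciCoord (metricCoeff c) i j (c x) * component c v i * component c w j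

/-- The Hessian `∇² f (v, w)` at `x`, computed in a chart `c` around `x`. The value does not
depend on the chart. -/
def hess (c : OpenPartialHomeomorph M (EuclideanSpace ℝ (Fin n))) (f : M → ℝ) {x : M}
    (v w : TangentSpace (𝓡 n) x) : ℝ :=
  ∑ i, ∑ j, hessCoord (metricCoeff c) (f ∘ c.symm) i j (c x)
    * component c v i * component c w j

/-- The Laplace-Beltrami operator `Δ f = ∑ g^{ij} (∇² f)_ij` at `x`, the metric trace of the
Hessian, computed in a chart `c` around `x`. The value does not depend on the chart. -/
def laplaceBeltrami (c : OpenPartialHomeomorph M (EuclideanSpace ℝ (Fin n))) (f : M → ℝ)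
    (x : M) : ℝ :=
  ∑ i, ∑ j, (metricCoeff c (c x))⁻¹ i j * hessCoord (metricCoeff c) (f ∘ c.symm) i j (c x)

/-- The diffusion operator `L f = Δ f - ∇ φ · ∇ f`. -/
def diffusionOp (c : OpenPartialHomeomorph M (EuclideanSpace ℝ (Fin n))) (φ f : M → ℝ)
    (x : M) : ℝ :=
  laplaceBeltrami c f x - inner ℝ (grad n φ x) (grad n f x)

/-- The Bakry-Emery Ricci tensor
`Ric_{m,n}(L) (v, w) = Ric (v, w) + ∇² φ (v, w) - ⟨∇φ, v⟩ ⟨∇φ, w⟩ / (m - n)`. For `m = n`,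
which is admitted only if `∇φ = 0`, the last term is zero. -/
def bakryEmeryRicci (c : OpenPartialHomeomorph M (EuclideanSpace ℝ (Fin n))) (φ : M → ℝ)
    (m : ℝ) {x : M} (v w : TangentSpace (𝓡 n) x) : ℝ :=
  ricci c v w + hess c φ v w - inner ℝ (grad n φ x) v * inner ℝ (grad n φ x) w / (m - n)

variable (n) in
/-- `Ric_{m,n}(L) ≥ κ` on all of `M`, as quadratic forms: `Ric_{m,n}(L)(v, v) ≥ κ |v|²` for all
tangent vectors `v`. -/
def BakryEmeryRicciGE (φ : M → ℝ) (m κ : ℝ) : Prop :=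
  ∀ c ∈ atlas (EuclideanSpace ℝ (Fin n)) M, ∀ x ∈ c.source, ∀ v : TangentSpace (𝓡 n) x,
    κ * ‖v‖ ^ 2 ≤ bakryEmeryRicci c φ m v v

/-- The time interval `(0, T]`, which is `(0, ∞)` for `T = ∞`. -/
def timeInterval (T : EReal) : Set ℝ := {t : ℝ | 0 < t ∧ (t : EReal) ≤ T}

variable (n) in
/-- `u` is a classical solution of `∂_t u = L u` on `M × (0, T]`: it is of class `C^{2,1}`, that
is, `C²` in space and `C¹` in time, with `u`, its first and second coordinate derivatives and
its time derivative jointly continuous in each chart, and it satisfies the equation pointwise.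
The time derivative at the end time `T` (if `T` is finite) is one-sided. -/
structure IsSolution (φ : M → ℝ) (T : EReal) (u : ℝ → M → ℝ) : Prop where
  contMDiff : ∀ t ∈ timeInterval T, ContMDiff (𝓡 n) 𝓘(ℝ, ℝ) 2 (u t)
  continuousOn : ∀ c ∈ atlas (EuclideanSpace ℝ (Fin n)) M,
    ContinuousOn (fun p : ℝ × EuclideanSpace ℝ (Fin n) => u p.1 (c.symm p.2))
      (timeInterval T ×ˢ c.target)
  continuousOn_pderiv : ∀ c ∈ atlas (EuclideanSpace ℝ (Fin n)) M, ∀ i,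
    ContinuousOn (fun p : ℝ × EuclideanSpace ℝ (Fin n) => pderiv i (u p.1 ∘ c.symm) p.2)
      (timeInterval T ×ˢ c.target)
  continuousOn_pderiv_pderiv : ∀ c ∈ atlas (EuclideanSpace ℝ (Fin n)) M, ∀ i j,
    ContinuousOn
      (fun p : ℝ × EuclideanSpace ℝ (Fin n) => pderiv i (pderiv j (u p.1 ∘ c.symm)) p.2)
      (timeInterval T ×ˢ c.target)
  continuousOn_derivWithin : ∀ c ∈ atlas (EuclideanSpace ℝ (Fin n)) M,
    ContinuousOn
      (fun p : ℝ × EuclideanSpace ℝ (Fin n) =>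
        derivWithin (fun s => u s (c.symm p.2)) (timeInterval T) p.1)
      (timeInterval T ×ˢ c.target)
  equation : ∀ t ∈ timeInterval T, ∀ c ∈ atlas (EuclideanSpace ℝ (Fin n)) M, ∀ x ∈ c.source,
    HasDerivWithinAt (fun s => u s x) (diffusionOp c φ (u t) x) (timeInterval T) t

end Manifold

end DiffusionGradient

end

/-! The argument is Hamilton's maximum principle applied to f = log (A / u). Since ∇f = -∇u/u, the
quantity to be bounded is |∇f|², and f ≥ 0 solves ∂_t f = L f - |∇f|². Bochner's formula gives (∂_t
- L)|∇f|² = -2|∇²f|² - 2(Ric + ∇²φ)(∇f, ∇f) - 2⟨∇f, ∇|∇f|²⟩ for smooth f. Put F = θ|∇f|² - f - εt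
with θ(t) = s/(1 + 2ks), s = t - τ, τ > 0. At a maximum point with t > τ the condition ∇F = 0 reads
θ∇|∇f|² = ∇f, so that (∂_t - L)F ≤ (θ' + 2kθ - 1)|∇f|² - ε. As θ' + 2kθ ≤ 1, this is negative,
whereas at a maximum it has to be nonnegative. Hence the maximum over [τ, t₁] × M is taken at t = τ,
where θ = 0 and F ≤ -ετ. Letting ε → 0 and τ → 0 gives the estimate, because 1/θ becomes 1/t + 2k.
Only the lower bound Ric + ∇²φ ≥ -k enters; it follows from the Bakry-Émery bound, the omitted
square being nonnegative for m ≥ n.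

The difficulty is regularity. As u is only C² in space and C¹ in time, |∇f|² need not have second
space derivatives or a time derivative, and (∂_t - L)F makes no direct sense. In
`IsLocalSolution.nonneg_of_isMax` the derivatives ∂_c f inside |∇f|² are replaced by difference
quotients, which are C^{2,1} and satisfy the differenced equation. At a maximum of the modified
function the terms that would become third derivatives of f cancel by that equation, and the
remaining ones converge as the step tends to zero. A quartic penalty in space and a quadratic one in
time force the approximate maxima to converge to the given one.

What remains is an inequality in the 2-jets of g, f and φ at one point. `bochner_identity` is
Bochner's formula in this algebraic form; its inputs are the relation ∇g = 0, also differentiated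
once, and the antisymmetry of the curvature tensor. `IsLocalSolution.not_isMax` combines the two in
a chart, and `timeFactor_mul_le` makes the statement global by compactness. -/

noncomputable section

namespace DiffusionGradient

/-! ### Bochner's formula as an algebraic identity between 2-jets -/

section BochnerAlgebra

open Matrix

variable {ι : Type*} [Fintype ι]

/-- The components `R^k_{iaj}` of the curvature tensor, in terms of the Christoffel symbols
`Γ k i j` and their derivatives `dΓ a k i j = ∂_a Γ^k_ij`. -/
def curvatureComp (Γ : ι → ι → ι → ℝ) (dΓ : ι → ι → ι → ι → ℝ) (k i a j : ι) : ℝ :=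
  dΓ a k i j - dΓ j k i a + ∑ m, (Γ k a m * Γ m i j - Γ k j m * Γ m i a)

/-- With p = G q, lowering the upper index turns p_k R^k_{iaj} into q^l R_{liaj} = -q^l R_{ilaj}.
Contraction with H^{ij} then raises the index i and traces it against j, and the antisymmetry in the
last two indices restores the sign. Bianchi's identity is not needed. -/
theorem sum_curvature_eq_ricci [DecidableEq ι] {G H : Matrix ι ι ℝ} (hG : G.IsSymm)
    (hGH : G * H = 1) {Γ : ι → ι → ι → ℝ} {dΓ : ι → ι → ι → ι → ℝ}
    (hR : ∀ a j i l, ∑ k, G l k * curvatureComp Γ dΓ k i a j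
      + ∑ k, G i k * curvatureComp Γ dΓ k l a j = 0) (q : ι → ℝ) :
    ∑ i, ∑ j, H i j * ∑ k, ∑ a, (∑ l, G k l * q l) * q a * curvatureComp Γ dΓ k i a j
      = ∑ i, ∑ j, (∑ k, curvatureComp Γ dΓ k i k j) * q i * q j := by
  have h1 : ∀ i j, ∑ k, ∑ a, (∑ l, G k l * q l) * q a * curvatureComp Γ dΓ k i a j
      = - ∑ k, G i k * ∑ a, ∑ l, q l * q a * curvatureComp Γ dΓ k l a j := by
    intro i j
    have h2 : ∀ a l, q l * q a * ∑ k, G l k * curvatureComp Γ dΓ k i a j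
        = - (q l * q a * ∑ k, G i k * curvatureComp Γ dΓ k l a j) := by
      intro a l
      linear_combination q l * q a * hR a j i l
    calc _ = ∑ a, ∑ l, q l * q a * ∑ k, G l k * curvatureComp Γ dΓ k i a j := by
          simp only [Finset.mul_sum, Finset.sum_mul]
          rw [Finset.sum_comm]
          refine Finset.sum_congr rfl fun a _ => ?_
          rw [Finset.sum_comm]
          refine Finset.sum_congr rfl fun l _ => Finset.sum_congr rfl fun k _ => ?_
          rw [hG.apply l k]
          ring
      _ = - ∑ a, ∑ l, q l * q a * ∑ k, G i k * curvatureComp Γ dΓ k l a j := by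
          simp only [h2, Finset.sum_neg_distrib]
      _ = _ := by
          congr 1
          simp only [Finset.mul_sum]
          conv_rhs => rw [Finset.sum_comm]
          refine Finset.sum_congr rfl fun a _ => ?_
          conv_rhs => rw [Finset.sum_comm]
          refine Finset.sum_congr rfl fun l _ => Finset.sum_congr rfl fun k _ => ?_
          ring
  have h3 : ∀ j k, ∑ i, H i j * G i k = if k = j then 1 else 0 := by
    intro j k
    have := congrFun (congrFun hGH k) j
    rw [Matrix.mul_apply, Matrix.one_apply] at this
    rw [← this]
    refine Finset.sum_congr rfl fun i _ => ?_
    rw [hG.apply k i, mul_comm]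
  have hanti : ∀ k l a j, curvatureComp Γ dΓ k l a j = - curvatureComp Γ dΓ k l j a := by
    intro k l a j
    simp only [curvatureComp, Finset.sum_sub_distrib]
    ring
  calc _ = ∑ j, ∑ i, H i j * - ∑ k, G i k * ∑ a, ∑ l, q l * q a * curvatureComp Γ dΓ k l a j := by
        rw [Finset.sum_comm]
        simp only [h1]
    _ = ∑ j, ∑ k, (∑ i, H i j * G i k) * - ∑ a, ∑ l, q l * q a * curvatureComp Γ dΓ k l a j := by
        refine Finset.sum_congr rfl fun j _ => ?_
        simp only [Finset.sum_mul]
        rw [Finset.sum_comm]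
        refine Finset.sum_congr rfl fun i _ => ?_
        rw [← Finset.sum_neg_distrib, Finset.mul_sum]
        refine Finset.sum_congr rfl fun k _ => ?_
        ring
    _ = ∑ j, ∑ a, ∑ l, q l * q a * curvatureComp Γ dΓ j l j a := by
        refine Finset.sum_congr rfl fun j _ => ?_
        simp only [h3, ite_mul, one_mul, zero_mul, Finset.sum_ite_eq', Finset.mem_univ, if_true]
        simp only [← Finset.sum_neg_distrib]
        refine Finset.sum_congr rfl fun a _ => Finset.sum_congr rfl fun l _ => ?_
        rw [hanti]
        ring
    _ = _ := by
        simp only [Finset.sum_mul]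
        rw [Finset.sum_comm]
        conv_rhs => rw [Finset.sum_comm]
        refine Finset.sum_congr rfl fun a _ => ?_
        rw [Finset.sum_comm]
        refine Finset.sum_congr rfl fun l _ => Finset.sum_congr rfl fun k _ => ?_
        ring

/-- `H` is the inverse metric, `dH i a b = ∂_i H^{ab}`, and the relation says that the inverse
metric is parallel for the connection `Γ`. -/
def IsParallelInverse (H : Matrix ι ι ℝ) (dH Γ : ι → ι → ι → ℝ) : Prop :=
  ∀ i a b, dH i a b = - ∑ l, (Γ a i l * H l b + Γ b i l * H l a)

/-- This and the next four lemmas are contractions of ∇H = 0 and of its derivative. They trade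
derivatives of the inverse metric for Christoffel symbols, grouped as Γ^a_il (H p)^l and as the
Hessian correction p_k Γ^k_il. -/
theorem sum_dH_mul {H : Matrix ι ι ℝ} (hH : H.IsSymm) {dH Γ : ι → ι → ι → ℝ}
    (hdH : IsParallelInverse H dH Γ) (p : ι → ℝ) (i a : ι) :
    ∑ b, dH i a b * p b
      = - (∑ l, Γ a i l * (H *ᵥ p) l + ∑ l, H a l * ∑ k, p k * Γ k i l) := by
  simp only [hdH i, mulVec, dotProduct, Finset.mul_sum, Finset.sum_mul, neg_mul,
    Finset.sum_neg_distrib, add_mul, Finset.sum_add_distrib]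
  congr 2
  · rw [Finset.sum_comm]
    refine Finset.sum_congr rfl fun l _ => Finset.sum_congr rfl fun k _ => ?_
    ring
  · rw [Finset.sum_comm]
    refine Finset.sum_congr rfl fun l _ => Finset.sum_congr rfl fun k _ => ?_
    rw [hH.apply a l]
    ring

theorem sum_mul_dH {H : Matrix ι ι ℝ} {dH Γ : ι → ι → ι → ℝ}
    (hΓ : ∀ k i j, Γ k i j = Γ k j i) (hdH : IsParallelInverse H dH Γ) (q : ι → ℝ) (i j : ι) :
    ∑ a, q a * dH a i j = - (∑ l, (∑ m, Γ i l m * q m) * H l j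
      + ∑ l, (∑ m, Γ j l m * q m) * H l i) := by
  simp only [hdH _, Finset.mul_sum, Finset.sum_mul, mul_neg, Finset.sum_neg_distrib, mul_add,
    Finset.sum_add_distrib]
  congr 2
  all_goals
    rw [Finset.sum_comm]
    refine Finset.sum_congr rfl fun l _ => Finset.sum_congr rfl fun k _ => ?_
    rw [hΓ _ l k]
    ring

theorem sum_mul_dH_mul {H : Matrix ι ι ℝ} {dH Γ : ι → ι → ι → ℝ}
    (hΓ : ∀ k i j, Γ k i j = Γ k j i) (hdH : IsParallelInverse H dH Γ) (q : ι → ℝ)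
    {Z : Matrix ι ι ℝ} (hZ : Z.IsSymm) :
    ∑ i, ∑ j, (∑ a, q a * dH a i j) * Z i j
      = - 2 * trace (Matrix.of (fun l i => ∑ m, Γ l i m * q m) * H * Z) := by
  simp only [sum_mul_dH hΓ hdH, neg_mul, Finset.sum_neg_distrib, add_mul, Finset.sum_add_distrib]
  have h1 : ∀ Y : Matrix ι ι ℝ, ∑ i, ∑ j, (∑ l, Y i l * H l j) * Z i j = trace (Y * H * Z) := by
    intro Y
    simp only [trace, diag, Matrix.mul_apply]
    refine Finset.sum_congr rfl fun i _ => Finset.sum_congr rfl fun j _ => ?_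
    rw [hZ.apply i j]
  have h2 := h1 (Matrix.of (fun l i => ∑ m, Γ l i m * q m))
  simp only [Matrix.of_apply] at h2
  have h3 : ∑ i, ∑ j, (∑ l, (∑ m, Γ j l m * q m) * H l i) * Z i j
      = trace (Matrix.of (fun l i => ∑ m, Γ l i m * q m) * H * Z) := by
    rw [Finset.sum_comm, ← h2]
    refine Finset.sum_congr rfl fun i _ => Finset.sum_congr rfl fun j _ => ?_
    rw [hZ.apply i j]
  rw [h2, h3]
  ring

theorem sum_dH_mul_mul {H : Matrix ι ι ℝ} (hH : H.IsSymm) {dH Γ : ι → ι → ι → ℝ}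
    (hdH : IsParallelInverse H dH Γ) (p : ι → ℝ) (i : ι) :
    ∑ a, ∑ b, dH i a b * p a * p b
      = - 2 * ∑ l, (∑ k, p k * Γ k i l) * (H *ᵥ p) l := by
  have h1 : ∀ a, ∑ b, dH i a b * p a * p b = p a * ∑ b, dH i a b * p b := by
    intro a
    rw [Finset.mul_sum]
    refine Finset.sum_congr rfl fun b _ => ?_
    ring
  simp only [h1, sum_dH_mul hH hdH, mul_neg, Finset.sum_neg_distrib, mul_add,
    Finset.sum_add_distrib]
  have h2 : ∑ a, p a * ∑ l, Γ a i l * (H *ᵥ p) l = ∑ l, (∑ k, p k * Γ k i l) * (H *ᵥ p) l := by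
    simp only [Finset.mul_sum, Finset.sum_mul]
    rw [Finset.sum_comm]
    refine Finset.sum_congr rfl fun l _ => Finset.sum_congr rfl fun k _ => ?_
    ring
  have h3 : ∑ a, p a * ∑ l, H a l * ∑ k, p k * Γ k i l
      = ∑ l, (∑ k, p k * Γ k i l) * (H *ᵥ p) l := by
    have : ∀ Y : ι → ℝ, ∑ a, p a * ∑ l, H a l * Y l = ∑ l, Y l * (H *ᵥ p) l := by
      intro Y
      simp only [mulVec, dotProduct, Finset.mul_sum]
      rw [Finset.sum_comm]
      refine Finset.sum_congr rfl fun l _ => Finset.sum_congr rfl fun k _ => ?_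
      rw [hH.apply l k]
      ring
    exact this _
  rw [h2, h3]
  ring

theorem sum_ddH_mul_mul {H : Matrix ι ι ℝ} (hH : H.IsSymm) {dH Γ : ι → ι → ι → ℝ}
    {dΓ ddH : ι → ι → ι → ι → ℝ} (hdH : IsParallelInverse H dH Γ)
    (hddH : ∀ i j a b, ddH i j a b = - ∑ l, (dΓ i a j l * H l b + Γ a j l * dH i l b
      + (dΓ i b j l * H l a + Γ b j l * dH i l a))) (p : ι → ℝ) (i j : ι) :
    ∑ a, ∑ b, ddH i j a b * p a * p b
      = - 2 * ∑ a, ∑ l, p a * dΓ i a j l * (H *ᵥ p) l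
        + 2 * ∑ l, (∑ k, p k * Γ k j l) * (∑ m, Γ l i m * (H *ᵥ p) m
          + ∑ m, H l m * ∑ k, p k * Γ k i m) := by
  have h0 : ∑ l, (∑ k, p k * Γ k j l) * (∑ m, Γ l i m * (H *ᵥ p) m
          + ∑ m, H l m * ∑ k, p k * Γ k i m) = - ∑ a, ∑ l, p a * Γ a j l * ∑ b, dH i l b * p b := by
    rw [Finset.sum_comm, ← Finset.sum_neg_distrib]
    refine Finset.sum_congr rfl fun l _ => ?_
    rw [sum_dH_mul hH hdH, ← Finset.sum_mul]
    ring
  have h1 : ∑ a, ∑ b, ddH i j a b * p a * p b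
      = - (∑ a, ∑ b, ∑ l, (dΓ i a j l * H l b + Γ a j l * dH i l b) * p a * p b
        + ∑ a, ∑ b, ∑ l, (dΓ i b j l * H l a + Γ b j l * dH i l a) * p a * p b) := by
    simp only [hddH, Finset.sum_add_distrib, neg_mul, Finset.sum_neg_distrib, add_mul,
      Finset.sum_mul]
  have h2 : ∑ a, ∑ b, ∑ l, (dΓ i b j l * H l a + Γ b j l * dH i l a) * p a * p b
      = ∑ a, ∑ b, ∑ l, (dΓ i a j l * H l b + Γ a j l * dH i l b) * p a * p b := by
    rw [Finset.sum_comm]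
    refine Finset.sum_congr rfl fun a _ => Finset.sum_congr rfl fun b _ =>
      Finset.sum_congr rfl fun l _ => ?_
    ring
  have h3 : ∑ a, ∑ b, ∑ l, (dΓ i a j l * H l b + Γ a j l * dH i l b) * p a * p b
      = ∑ a, ∑ l, p a * dΓ i a j l * (H *ᵥ p) l
        + ∑ a, ∑ l, p a * Γ a j l * ∑ b, dH i l b * p b := by
    rw [← Finset.sum_add_distrib]
    refine Finset.sum_congr rfl fun a _ => ?_
    rw [← Finset.sum_add_distrib, Finset.sum_comm]
    refine Finset.sum_congr rfl fun l _ => ?_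
    simp only [mulVec, dotProduct, Finset.mul_sum]
    rw [← Finset.sum_add_distrib]
    refine Finset.sum_congr rfl fun b _ => ?_
    ring
  rw [h0, h1, h2, h3]
  ring

theorem trace_mul_mul_eq_sum (H Y Z : Matrix ι ι ℝ) :
    trace (H * (Y * Z)) = ∑ i, ∑ j, H i j * ∑ l, Y j l * Z l i := by
  simp only [trace, diag, Matrix.mul_apply]

/-- Only one of the two matrices has to be symmetric: transposition and cyclicity of the trace move
the transpose off `Y`. -/
theorem trace_quadruple {H : Matrix ι ι ℝ} (hH : H.IsSymm) {Z : Matrix ι ι ℝ} (hZ : Z.IsSymm)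
    (Y : Matrix ι ι ℝ) :
    ∑ i, ∑ j, H i j * ∑ a, ∑ b, H a b * Y i a * Z j b = trace (H * Z * (H * Y)) := by
  have hY : ∀ i j, ∑ a, ∑ b, H a b * Y i a * Z j b = (Z * (H * Yᵀ)) j i := by
    intro i j
    simp only [Matrix.mul_apply, Finset.mul_sum, Matrix.transpose_apply]
    rw [Finset.sum_comm]
    refine Finset.sum_congr rfl fun b _ => Finset.sum_congr rfl fun a _ => ?_
    rw [hH.apply b a]
    ring
  have h : trace (H * Z * (H * Y)) = trace (H * (Z * (H * Yᵀ))) := by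
    rw [← trace_transpose (H * (Z * (H * Yᵀ)))]
    simp only [transpose_mul, transpose_transpose, hH.eq, hZ.eq]
    rw [trace_mul_comm (H * Z), ← Matrix.mul_assoc, trace_mul_comm _ Z, trace_mul_comm _ H]
    simp only [Matrix.mul_assoc]
    rw [trace_mul_comm Z]
    simp only [Matrix.mul_assoc]
  rw [h]
  simp only [hY, trace, diag]
  refine Finset.sum_congr rfl fun i _ => (Matrix.mul_apply ..).symm

/-- The pointwise identity behind Bochner's formula
`½ (L |∇f|²) = |∇²f|² + ⟨∇f, ∇ L f⟩ + (Ric + ∇²φ)(∇f, ∇f)`, in terms of the components of the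
2-jets of the metric, of `f` (`p = ∂f`, `B = ∂²f`) and of `φ` (`β = ∂φ`, `D = ∂²φ`), where
`L f = H^{ij} ∂_ij f - X^k ∂_k f`. -/
theorem bochner_identity [DecidableEq ι] {G H : Matrix ι ι ℝ} (hG : G.IsSymm) (hH : H.IsSymm)
    (hGH : G * H = 1) {dH Γ : ι → ι → ι → ℝ} {dΓ ddH : ι → ι → ι → ι → ℝ}
    (hΓ : ∀ k i j, Γ k i j = Γ k j i)
    (hdH : IsParallelInverse H dH Γ)
    (hddH : ∀ i j a b, ddH i j a b = - ∑ l, (dΓ i a j l * H l b + Γ a j l * dH i l b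
      + (dΓ i b j l * H l a + Γ b j l * dH i l a)))
    (hR : ∀ a j i l, ∑ k, G l k * curvatureComp Γ dΓ k i a j
      + ∑ k, G i k * curvatureComp Γ dΓ k l a j = 0)
    {β : ι → ℝ} {D : ι → ι → ℝ} {X : ι → ℝ} {dX : ι → ι → ℝ}
    (hX : ∀ k, X k = ∑ i, ∑ j, H i j * Γ k i j + ∑ j, H k j * β j)
    (hdX : ∀ a k, dX a k = ∑ i, ∑ j, (dH a i j * Γ k i j + H i j * dΓ a k i j)
      + ∑ j, (dH a k j * β j + H k j * D a j))
    (p : ι → ℝ) {B : Matrix ι ι ℝ} (hB : B.IsSymm) :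
    ∑ i, ∑ j, H i j * ∑ a, ∑ b, ddH i j a b * p a * p b
      + 4 * ∑ i, ∑ j, H i j * ∑ a, ∑ b, dH i a b * B j a * p b
      + 2 * ∑ i, ∑ j, H i j * ∑ a, ∑ b, H a b * B i a * B j b
      - ∑ k, X k * ∑ a, ∑ b, dH k a b * p a * p b
      - 2 * ∑ a, (H *ᵥ p) a * (∑ i, ∑ j, dH a i j * B i j - ∑ k, dX a k * p k)
    = 2 * ∑ i, ∑ j, H i j * ∑ a, ∑ b, H a b * (B i a - ∑ k, p k * Γ k i a)
        * (B j b - ∑ k, p k * Γ k j b)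
      + 2 * ∑ i, ∑ j, (∑ k, curvatureComp Γ dΓ k i k j + (D i j - ∑ k, Γ k i j * β k))
        * (H *ᵥ p) i * (H *ᵥ p) j := by
  -- `q` is the gradient vector, `P` is the Christoffel correction of the Hessian, which is thus B -
  -- P, and `Q` has entries Γ^l_im q^m. All terms are reduced to traces of products of H, B, P, Q
  -- and to terms containing dΓ, β or D.
  set q := H *ᵥ p with hq
  set P : Matrix ι ι ℝ := Matrix.of (fun i l => ∑ k, p k * Γ k i l) with hP
  set Q : Matrix ι ι ℝ := Matrix.of (fun l i => ∑ m, Γ l i m * q m) with hQ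
  have hPs : P.IsSymm := by
    ext i j
    simp only [hP, transpose_apply, of_apply, hΓ _ i j]
  have hPa : ∀ i l, ∑ k, p k * Γ k i l = P i l := fun _ _ => rfl
  have hQa : ∀ l i, ∑ m, Γ l i m * q m = Q l i := fun _ _ => rfl
  have T1 : ∑ i, ∑ j, H i j * ∑ a, ∑ b, ddH i j a b * p a * p b
      = - 2 * ∑ i, ∑ j, H i j * ∑ a, ∑ l, p a * dΓ i a j l * q l
        + 2 * trace (H * P * Q) + 2 * trace (H * P * (H * P)) := by
    simp only [sum_ddH_mul_mul hH hdH hddH, ← hq, hPa, hQa]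
    have h1 : ∑ i, ∑ j, H i j * ∑ l, P j l * (Q l i + ∑ m, H l m * P i m)
        = trace (H * P * Q) + trace (H * P * (H * P)) := by
      rw [Matrix.mul_assoc, Matrix.mul_assoc, ← trace_add, ← Matrix.mul_add, ← Matrix.mul_add]
      rw [trace_mul_mul_eq_sum]
      refine Finset.sum_congr rfl fun i _ => Finset.sum_congr rfl fun j _ => ?_
      simp only [Matrix.add_apply, Matrix.mul_apply]
      simp only [hPs.apply]
    rw [add_assoc, ← mul_add, ← h1]
    simp only [mul_add, Finset.sum_add_distrib, Finset.mul_sum]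
    simp only [mul_left_comm]
  have T2 : ∑ i, ∑ j, H i j * ∑ a, ∑ b, dH i a b * B j a * p b
      = - trace (H * B * Q) - trace (H * B * (H * P)) := by
    have h1 : ∀ i j, ∑ a, ∑ b, dH i a b * B j a * p b = - ∑ a, B j a * (Q a i + (H * P) a i) := by
      intro i j
      rw [← Finset.sum_neg_distrib]
      refine Finset.sum_congr rfl fun a _ => ?_
      have h2 : Q a i + (H * P) a i = ∑ l, Γ a i l * q l + ∑ l, H a l * ∑ k, p k * Γ k i l := by
        rw [Matrix.mul_apply]
        simp only [hQa, hPa, hPs.apply]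
      rw [← mul_neg, h2, ← sum_dH_mul hH hdH, Finset.mul_sum]
      refine Finset.sum_congr rfl fun b _ => ?_
      ring
    rw [Matrix.mul_assoc, Matrix.mul_assoc, neg_sub_left, add_comm, ← trace_add, ← Matrix.mul_add,
      ← Matrix.mul_add]
    rw [trace_mul_mul_eq_sum]
    simp only [h1, Matrix.add_apply, mul_neg, Finset.sum_neg_distrib]
  have T4 : ∑ k, X k * ∑ a, ∑ b, dH k a b * p a * p b
      = - 2 * ∑ i, ∑ j, H i j * ∑ k, Γ k i j * (P *ᵥ q) k
        - 2 * ∑ k, (H *ᵥ β) k * (P *ᵥ q) k := by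
    have h1 : ∀ k, ∑ a, ∑ b, dH k a b * p a * p b = - 2 * (P *ᵥ q) k := fun k =>
      sum_dH_mul_mul hH hdH p k
    have h2 : ∑ k, (∑ i, ∑ j, H i j * Γ k i j) * (P *ᵥ q) k
        = ∑ i, ∑ j, H i j * ∑ k, Γ k i j * (P *ᵥ q) k := by
      simp only [Finset.sum_mul, Finset.mul_sum]
      rw [Finset.sum_comm]
      refine Finset.sum_congr rfl fun i _ => ?_
      rw [Finset.sum_comm]
      refine Finset.sum_congr rfl fun j _ => Finset.sum_congr rfl fun k _ => mul_assoc _ _ _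
    rw [← h2]
    have h3 : ∀ k, X k = ∑ i, ∑ j, H i j * Γ k i j + (H *ᵥ β) k := hX
    simp only [h1, h3, add_mul, Finset.sum_add_distrib]
    simp only [mul_left_comm _ (-2 : ℝ), ← Finset.mul_sum]
    ring
  have T5 : ∑ a, q a * ∑ i, ∑ j, dH a i j * B i j = - 2 * trace (Q * H * B) := by
    rw [hQ, ← sum_mul_dH_mul hΓ hdH q hB]
    simp only [Finset.sum_mul, Finset.mul_sum]
    rw [Finset.sum_comm]
    refine Finset.sum_congr rfl fun i _ => ?_
    rw [Finset.sum_comm]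
    refine Finset.sum_congr rfl fun j _ => Finset.sum_congr rfl fun k _ => (mul_assoc _ _ _).symm
  have T6 : ∑ a, q a * ∑ k, dX a k * p k = - 2 * trace (Q * H * P)
      + ∑ i, ∑ j, H i j * ∑ k, ∑ a, p k * q a * dΓ a k i j
      - ∑ k, (H *ᵥ β) k * (P *ᵥ q) k - ∑ i, ∑ j, (∑ k, Γ k i j * β k) * q i * q j
      + ∑ i, ∑ j, D i j * q i * q j := by
    have h1 : ∑ a, q a * ∑ k, (∑ i, ∑ j, dH a i j * Γ k i j) * p k
        = - 2 * trace (Q * H * P) := by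
      rw [hQ, ← sum_mul_dH_mul hΓ hdH q hPs]
      have h : ∀ a, ∑ k, (∑ i, ∑ j, dH a i j * Γ k i j) * p k = ∑ i, ∑ j, dH a i j * P i j := by
        intro a
        simp only [Finset.sum_mul, Finset.mul_sum, ← hPa]
        rw [Finset.sum_comm]
        refine Finset.sum_congr rfl fun i _ => ?_
        rw [Finset.sum_comm]
        refine Finset.sum_congr rfl fun j _ => Finset.sum_congr rfl fun k _ => ?_
        ring
      simp only [h]
      simp only [Finset.sum_mul, Finset.mul_sum]
      rw [Finset.sum_comm]
      refine Finset.sum_congr rfl fun i _ => ?_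
      rw [Finset.sum_comm]
      refine Finset.sum_congr rfl fun j _ => Finset.sum_congr rfl fun k _ => ?_
      ring
    have h2 : ∑ a, q a * ∑ k, (∑ i, ∑ j, H i j * dΓ a k i j) * p k
        = ∑ i, ∑ j, H i j * ∑ k, ∑ a, p k * q a * dΓ a k i j := by
      simp only [Finset.sum_mul, Finset.mul_sum]
      rw [Finset.sum_comm]
      conv_rhs =>
        enter [2, i]
        rw [Finset.sum_comm]
      conv_rhs => rw [Finset.sum_comm]
      refine Finset.sum_congr rfl fun k _ => ?_
      rw [Finset.sum_comm]
      refine Finset.sum_congr rfl fun i _ => ?_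
      rw [Finset.sum_comm]
      refine Finset.sum_congr rfl fun j _ => Finset.sum_congr rfl fun a _ => ?_
      ring
    have h3 : ∑ a, q a * ∑ k, (∑ j, dH a k j * β j) * p k
        = - (∑ k, (H *ᵥ β) k * (P *ᵥ q) k) - ∑ i, ∑ j, (∑ k, Γ k i j * β k) * q i * q j := by
      have h : ∀ a, ∑ k, (∑ j, dH a k j * β j) * p k
          = - (∑ l, P a l * (H *ᵥ β) l) - ∑ l, (∑ k, Γ k a l * β k) * q l := by
        intro a
        simp only [sum_dH_mul hH hdH β a, neg_add', sub_mul, neg_mul, Finset.sum_neg_distrib,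
          Finset.sum_sub_distrib]
        congr 1
        · congr 1
          simp only [← hPa, Finset.sum_mul]
          rw [Finset.sum_comm]
          refine Finset.sum_congr rfl fun l _ => Finset.sum_congr rfl fun k _ => ?_
          ring
        · have : ∀ Y : ι → ℝ, ∑ k, (∑ l, H k l * Y l) * p k = ∑ l, Y l * q l := by
            intro Y
            simp only [hq, mulVec, dotProduct, Finset.sum_mul, Finset.mul_sum]
            rw [Finset.sum_comm]
            refine Finset.sum_congr rfl fun l _ => Finset.sum_congr rfl fun k _ => ?_
            rw [hH.apply l k]
            ring
          rw [this]
          refine Finset.sum_congr rfl fun l _ => ?_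
          congr 1
          refine Finset.sum_congr rfl fun k _ => mul_comm _ _
      simp only [h, mul_sub, mul_neg, Finset.sum_sub_distrib, Finset.sum_neg_distrib]
      congr 1
      · congr 1
        simp only [show ∀ k, (P *ᵥ q) k = ∑ l, P k l * q l from fun _ => rfl, Finset.mul_sum]
        rw [Finset.sum_comm]
        refine Finset.sum_congr rfl fun l _ => Finset.sum_congr rfl fun k _ => ?_
        rw [hPs.apply l k]
        ring
      · refine Finset.sum_congr rfl fun i _ => ?_
        rw [Finset.mul_sum]
        refine Finset.sum_congr rfl fun j _ => ?_
        ring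
    have h4 : ∑ a, q a * ∑ k, (∑ j, H k j * D a j) * p k = ∑ i, ∑ j, D i j * q i * q j := by
      refine Finset.sum_congr rfl fun a _ => ?_
      have h : ∀ j, D a j * q a * q j = q a * ∑ k, H j k * D a j * p k := by
        intro j
        rw [show q j = ∑ k, H j k * p k from rfl]
        simp only [Finset.mul_sum]
        refine Finset.sum_congr rfl fun k _ => ?_
        ring
      simp only [h, ← Finset.mul_sum]
      rw [Finset.sum_comm]
      congr 1
      refine Finset.sum_congr rfl fun k _ => ?_
      rw [Finset.sum_mul]
      refine Finset.sum_congr rfl fun j _ => ?_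
      rw [hH.apply j k]
    have h5 : ∑ a, q a * ∑ k, dX a k * p k
        = ∑ a, q a * ∑ k, (∑ i, ∑ j, dH a i j * Γ k i j) * p k
          + ∑ a, q a * ∑ k, (∑ i, ∑ j, H i j * dΓ a k i j) * p k
          + ∑ a, q a * ∑ k, (∑ j, dH a k j * β j) * p k
          + ∑ a, q a * ∑ k, (∑ j, H k j * D a j) * p k := by
      simp only [hdX, Finset.sum_add_distrib, add_mul, mul_add]
      ring
    rw [h5, h1, h2, h3, h4]
    ring
  have TS : ∑ i, ∑ j, H i j * ∑ a, ∑ b, H a b * (B i a - ∑ k, p k * Γ k i a)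
        * (B j b - ∑ k, p k * Γ k j b)
      = trace (H * B * (H * B)) - 2 * trace (H * B * (H * P)) + trace (H * P * (H * P)) := by
    have h1 := trace_quadruple hH (hB.sub hPs) (B - P)
    simp only [Matrix.sub_apply, ← hPa] at h1
    rw [h1]
    simp only [Matrix.mul_sub, Matrix.sub_mul, trace_sub]
    rw [trace_mul_comm (H * P) (H * B)]
    ring
  have TR : ∑ i, ∑ j, (∑ k, curvatureComp Γ dΓ k i k j) * q i * q j
      = ∑ i, ∑ j, H i j * ∑ k, ∑ a, p k * q a * dΓ a k i j
        - ∑ i, ∑ j, H i j * ∑ a, ∑ l, p a * dΓ i a j l * q l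
        + ∑ i, ∑ j, H i j * ∑ k, Γ k i j * (P *ᵥ q) k - trace (H * P * Q) := by
    have hp : ∀ k, ∑ l, G k l * q l = p k := by
      intro k
      change (G *ᵥ q) k = p k
      rw [hq, mulVec_mulVec, hGH, one_mulVec]
    -- In the form H^{ij} p_k q^a R^k_{iaj} the Ricci term contains the same contractions of dΓ as
    -- the expansions `T1` and `T6`.
    rw [← sum_curvature_eq_ricci hG hGH hR]
    simp only [hp]
    have h1 : ∑ i, ∑ j, H i j * ∑ a, ∑ l, p a * dΓ i a j l * q l
        = ∑ i, ∑ j, H i j * ∑ k, ∑ a, p k * q a * dΓ j k i a := by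
      rw [Finset.sum_comm]
      refine Finset.sum_congr rfl fun i _ => Finset.sum_congr rfl fun j _ => ?_
      rw [hH.apply i j]
      congr 1
      refine Finset.sum_congr rfl fun k _ => Finset.sum_congr rfl fun a _ => ?_
      ring
    have h2 : ∀ i j, ∑ k, Γ k i j * (P *ᵥ q) k
        = ∑ k, ∑ a, p k * q a * ∑ m, Γ k a m * Γ m i j := by
      intro i j
      simp only [show ∀ k, (P *ᵥ q) k = ∑ l, P k l * q l from fun _ => rfl, ← hPa,
        Finset.mul_sum, Finset.sum_mul]
      rw [Finset.sum_comm, Finset.sum_congr rfl fun a _ => Finset.sum_comm, Finset.sum_comm]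
      refine Finset.sum_congr rfl fun k _ => Finset.sum_congr rfl fun a _ =>
        Finset.sum_congr rfl fun m _ => ?_
      rw [hΓ k m a]
      ring
    have h3 : ∀ i j, ∑ l, P j l * Q l i = ∑ k, ∑ a, p k * q a * ∑ m, Γ k j m * Γ m i a := by
      intro i j
      simp only [← hPa, ← hQa, Finset.mul_sum, Finset.sum_mul]
      rw [Finset.sum_comm, Finset.sum_congr rfl fun a _ => Finset.sum_comm, Finset.sum_comm]
      refine Finset.sum_congr rfl fun k _ => Finset.sum_congr rfl fun a _ =>
        Finset.sum_congr rfl fun m _ => ?_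
      ring
    rw [Matrix.mul_assoc, trace_mul_mul_eq_sum, h1]
    simp only [h2, h3, curvatureComp, Finset.sum_sub_distrib, mul_add, mul_sub,
      Finset.sum_add_distrib]
    ring
  have hc1 : trace (Q * H * B) = trace (H * B * Q) := by
    rw [Matrix.mul_assoc, trace_mul_comm]
  have hc2 : trace (Q * H * P) = trace (H * P * Q) := by
    rw [Matrix.mul_assoc, trace_mul_comm]
  have T3 : ∑ i, ∑ j, H i j * ∑ a, ∑ b, H a b * B i a * B j b = trace (H * B * (H * B)) :=
    trace_quadruple hH hB B
  have h5 : ∑ a, q a * (∑ i, ∑ j, dH a i j * B i j - ∑ k, dX a k * p k)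
      = ∑ a, q a * ∑ i, ∑ j, dH a i j * B i j - ∑ a, q a * ∑ k, dX a k * p k := by
    simp only [mul_sub, Finset.sum_sub_distrib]
  have h6 : ∑ i, ∑ j, (∑ k, curvatureComp Γ dΓ k i k j + (D i j - ∑ k, Γ k i j * β k)) * q i * q j
      = ∑ i, ∑ j, (∑ k, curvatureComp Γ dΓ k i k j) * q i * q j + ∑ i, ∑ j, D i j * q i * q j
        - ∑ i, ∑ j, (∑ k, Γ k i j * β k) * q i * q j := by
    simp only [add_mul, sub_mul, Finset.sum_add_distrib, Finset.sum_sub_distrib]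
    ring
  -- The traces of H B Q cancel, and so do the terms (Hβ)·(Pq). The multiple -2 of the trace of H P
  -- Q that is left over belongs to the curvature.
  rw [h5, h6, T1, T2, T3, T4, T5, T6, TS, TR, hc1, hc2]
  ring

end BochnerAlgebra

/-! ### Calculus of partial derivatives -/

section PartialDerivatives

variable {n : ℕ} {f g : EuclideanSpace ℝ (Fin n) → ℝ} {y : EuclideanSpace ℝ (Fin n)}
  {U : Set (EuclideanSpace ℝ (Fin n))}

theorem pderiv_add (i : Fin n) (hf : DifferentiableAt ℝ f y) (hg : DifferentiableAt ℝ g y) :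
    pderiv i (fun z => f z + g z) y = pderiv i f y + pderiv i g y := by
  simp [pderiv, fderiv_fun_add hf hg]

theorem pderiv_sub (i : Fin n) (hf : DifferentiableAt ℝ f y) (hg : DifferentiableAt ℝ g y) :
    pderiv i (fun z => f z - g z) y = pderiv i f y - pderiv i g y := by
  simp [pderiv, fderiv_fun_sub hf hg]

theorem pderiv_neg (i : Fin n) : pderiv i (fun z => - f z) y = - pderiv i f y := by
  simp [pderiv, fderiv_fun_neg]

theorem pderiv_const (i : Fin n) (r : ℝ) : pderiv i (fun _ => r) y = 0 := by
  simp [pderiv]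

theorem pderiv_mul (i : Fin n) (hf : DifferentiableAt ℝ f y) (hg : DifferentiableAt ℝ g y) :
    pderiv i (fun z => f z * g z) y = pderiv i f y * g y + f y * pderiv i g y := by
  simp [pderiv, fderiv_fun_mul hf hg]
  ring

theorem pderiv_sum {ι : Type*} (s : Finset ι) {F : ι → EuclideanSpace ℝ (Fin n) → ℝ} (i : Fin n)
    (hF : ∀ k ∈ s, DifferentiableAt ℝ (F k) y) :
    pderiv i (fun z => ∑ k ∈ s, F k z) y = ∑ k ∈ s, pderiv i (F k) y := by
  simp [pderiv, fderiv_fun_sum hF]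

theorem pderiv_congr (hU : IsOpen U) (h : EqOn f g U) (i : Fin n) :
    EqOn (pderiv i f) (pderiv i g) U := by
  intro z hz
  have : f =ᶠ[nhds z] g := Filter.eventuallyEq_of_mem (hU.mem_nhds hz) h
  simp [pderiv, this.fderiv_eq]

theorem _root_.ContDiffOn.pderiv {m k : WithTop ℕ∞} (hf : ContDiffOn ℝ m f U) (hU : IsOpen U)
    (hk : k + 1 ≤ m) (i : Fin n) : ContDiffOn ℝ k (pderiv i f) U :=
  (hf.fderiv_of_isOpen hU hk).clm_apply contDiffOn_const

theorem differentiableAt_fderiv (hf : ContDiffOn ℝ 2 f U) (hU : IsOpen U) (hy : y ∈ U) :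
    DifferentiableAt ℝ (fderiv ℝ f) y :=
  ((hf.fderiv_of_isOpen hU (m := 1) (by norm_num)).contDiffAt
    (hU.mem_nhds hy)).differentiableAt (by norm_num)

theorem pderiv_pderiv_eq (hf : ContDiffOn ℝ 2 f U) (hU : IsOpen U) (hy : y ∈ U) (i j : Fin n) :
    pderiv i (pderiv j f) y
      = fderiv ℝ (fderiv ℝ f) y (EuclideanSpace.single i 1) (EuclideanSpace.single j 1) := by
  have := fderiv_clm_apply (differentiableAt_fderiv hf hU hy)
    (differentiableAt_const (EuclideanSpace.single j (1 : ℝ)))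
  unfold pderiv
  rw [this]
  simp

theorem pderiv_comm (hf : ContDiffOn ℝ 2 f U) (hU : IsOpen U) (hy : y ∈ U) (i j : Fin n) :
    pderiv i (pderiv j f) y = pderiv j (pderiv i f) y := by
  have h1 : ContDiffAt ℝ 2 f y := hf.contDiffAt (hU.mem_nhds hy)
  rw [pderiv_pderiv_eq hf hU hy, pderiv_pderiv_eq hf hU hy]
  exact h1.isSymmSndFDerivAt (by simp) _ _

end PartialDerivatives

/-! ### Levi-Civita connection and curvature in coordinates -/

section MetricCalculus

variable {n : ℕ} {G : EuclideanSpace ℝ (Fin n) → Matrix (Fin n) (Fin n) ℝ}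
  {U : Set (EuclideanSpace ℝ (Fin n))} {y : EuclideanSpace ℝ (Fin n)}

theorem contDiffOn_det {ι : Type*} [Fintype ι] [DecidableEq ι] {m : WithTop ℕ∞}
    {A : EuclideanSpace ℝ (Fin n) → Matrix ι ι ℝ}
    (hA : ∀ i j, ContDiffOn ℝ m (fun z => A z i j) U) : ContDiffOn ℝ m (fun z => (A z).det) U := by
  simp only [Matrix.det_apply']
  exact ContDiffOn.sum fun σ _ => contDiffOn_const.mul (contDiffOn_prod fun i _ => hA _ _)

theorem contDiffOn_inv {m : WithTop ℕ∞} (hG : ∀ i j, ContDiffOn ℝ m (fun z => G z i j) U)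
    (hdet : ∀ z ∈ U, (G z).det ≠ 0) (i j : Fin n) :
    ContDiffOn ℝ m (fun z => (G z)⁻¹ i j) U := by
  simp only [Matrix.inv_def, Ring.inverse_eq_inv', Matrix.smul_apply, smul_eq_mul,
    Matrix.adjugate_apply]
  refine ((contDiffOn_det hG).inv hdet).mul (contDiffOn_det fun a b => ?_)
  by_cases h : a = j
  · subst h
    simpa using contDiffOn_const
  · simpa [Matrix.updateRow_ne h] using hG a b

theorem christoffel_comm (hsymm : ∀ z, (G z).IsSymm) (k i j : Fin n) :
    christoffel G k i j y = christoffel G k j i y := by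
  unfold christoffel
  congr 1
  refine Finset.sum_congr rfl fun l _ => ?_
  rw [show (fun z => G z i j) = fun z => G z j i from funext fun z => (hsymm z).apply j i]
  ring

theorem contDiffOn_christoffel {m : WithTop ℕ∞} (hU : IsOpen U)
    (hG : ∀ i j, ContDiffOn ℝ (m + 1) (fun z => G z i j) U)
    (hdet : ∀ z ∈ U, (G z).det ≠ 0) (k i j : Fin n) :
    ContDiffOn ℝ m (christoffel G k i j) U := by
  unfold christoffel
  refine contDiffOn_const.mul (ContDiffOn.sum fun l _ => ?_)
  refine ((contDiffOn_inv hG hdet k l).of_le le_self_add).mul ?_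
  exact (((hG j l).pderiv hU le_rfl i).add ((hG i l).pderiv hU le_rfl j)).sub
    ((hG i j).pderiv hU le_rfl l)

theorem sum_metric_mul_christoffel (hdet : (G y).det ≠ 0) (a i j : Fin n) :
    ∑ k, G y a k * christoffel G k i j y
      = (1 / 2) * (pderiv i (fun z => G z j a) y + pderiv j (fun z => G z i a) y
        - pderiv a (fun z => G z i j) y) := by
  have h1 : G y * (G y)⁻¹ = 1 := Matrix.mul_nonsing_inv _ hdet.isUnit
  have h2 : ∀ Y : Fin n → ℝ, ∑ k, G y a k * ∑ l, (G y)⁻¹ k l * Y l = Y a := by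
    intro Y
    have h := congrFun (congrArg (fun A => A.mulVec Y) h1) a
    simp only [← Matrix.mulVec_mulVec, Matrix.one_mulVec] at h
    exact h
  rw [← h2 fun a => pderiv i (fun z => G z j a) y + pderiv j (fun z => G z i a) y
        - pderiv a (fun z => G z i j) y, Finset.mul_sum]
  refine Finset.sum_congr rfl fun k _ => ?_
  rw [christoffel]
  ring

/-- When the two lowered Christoffel symbols are added, four of the six metric derivatives cancel by
symmetry of g. -/
theorem pderiv_metric (hsymm : ∀ z, (G z).IsSymm) (hdet : (G y).det ≠ 0) (i a b : Fin n) :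
    pderiv i (fun z => G z a b) y
      = ∑ k, (G y a k * christoffel G k i b y + G y b k * christoffel G k i a y) := by
  have hs : ∀ a b, (fun z => G z a b) = fun z => G z b a :=
    fun a b => funext fun z => (hsymm z).apply b a
  rw [Finset.sum_add_distrib, sum_metric_mul_christoffel hdet, sum_metric_mul_christoffel hdet,
    hs b a, hs i a, hs i b]
  ring

/-- Differentiating G H = 1 gives H' = -H G' H. With C the matrix of the Γ^c_id, compatibility says
G' = G C + (G C)ᵀ, and the outer factors H cancel against G. -/
theorem isParallelInverse_inv (hU : IsOpen U)
    (hG : ∀ i j, ContDiffOn ℝ 1 (fun z => G z i j) U) (hsymm : ∀ z, (G z).IsSymm)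
    (hdet : ∀ z ∈ U, (G z).det ≠ 0) (hy : y ∈ U) :
    IsParallelInverse (G y)⁻¹ (fun i a b => pderiv i (fun z => (G z)⁻¹ a b) y)
      (fun k i j => christoffel G k i j y) := by
  intro i a b
  set H := (G y)⁻¹ with hH
  have hHG : H * G y = 1 := Matrix.nonsing_inv_mul _ (hdet y hy).isUnit
  have hHs : H.IsSymm := by
    rw [Matrix.IsSymm, hH, Matrix.transpose_nonsing_inv, (hsymm y).eq]
  have dG : ∀ c d, DifferentiableAt ℝ (fun z => G z c d) y := fun c d =>
    ((hG c d).contDiffAt (hU.mem_nhds hy)).differentiableAt (by norm_num)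
  have dH : ∀ c d, DifferentiableAt ℝ (fun z => (G z)⁻¹ c d) y := fun c d =>
    ((contDiffOn_inv hG hdet c d).contDiffAt (hU.mem_nhds hy)).differentiableAt (by norm_num)
  set G' : Matrix (Fin n) (Fin n) ℝ := Matrix.of fun c d => pderiv i (fun z => G z c d) y with hG'
  set H' : Matrix (Fin n) (Fin n) ℝ :=
    Matrix.of fun c d => pderiv i (fun z => (G z)⁻¹ c d) y with hH'
  set C : Matrix (Fin n) (Fin n) ℝ := Matrix.of fun c d => christoffel G c i d y with hC
  have h1 : G' * H + G y * H' = 0 := by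
    ext c d
    have h2 : EqOn (fun z => ∑ e, G z c e * (G z)⁻¹ e d)
        (fun _ => (1 : Matrix (Fin n) (Fin n) ℝ) c d) U := by
      intro z hz
      rw [← Matrix.mul_nonsing_inv (G z) (hdet z hz).isUnit, Matrix.mul_apply]
    have h3 := pderiv_congr hU h2 i hy
    rw [pderiv_const, pderiv_sum _ _ fun e _ => (dG c e).fun_mul (dH e d)] at h3
    rw [Matrix.zero_apply, ← h3, Matrix.add_apply, Matrix.mul_apply, Matrix.mul_apply,
      ← Finset.sum_add_distrib]
    refine Finset.sum_congr rfl fun e _ => ?_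
    rw [pderiv_mul i (dG c e) (dH e d)]
    rfl
  have h4 : G' = G y * C + (G y * C).transpose := by
    ext c d
    simp only [hG', hC, Matrix.of_apply, Matrix.add_apply, Matrix.transpose_apply,
      Matrix.mul_apply, ← Finset.sum_add_distrib]
    exact pderiv_metric hsymm (hdet y hy) i c d
  have h5 : H' = - (C * H + (C * H).transpose) := by
    have h6 : H' = - (H * (G' * H)) := by
      rw [eq_neg_iff_add_eq_zero, ← Matrix.mul_zero H, ← h1, Matrix.mul_add, ← Matrix.mul_assoc H (G y),
        hHG, Matrix.one_mul, add_comm]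
    have hGH : G y * H = 1 := Matrix.mul_nonsing_inv _ (hdet y hy).isUnit
    rw [h6, h4, Matrix.transpose_mul, Matrix.transpose_mul, (hsymm y).eq, hHs.eq]
    congr 1
    rw [Matrix.add_mul, Matrix.mul_add, ← Matrix.mul_assoc, ← Matrix.mul_assoc, hHG,
      Matrix.one_mul, Matrix.mul_assoc, hGH, Matrix.mul_one]
  have h7 := congrFun (congrFun h5 a) b
  simpa only [hH', hC, Matrix.of_apply, Matrix.neg_apply, Matrix.add_apply, Matrix.mul_apply,
    Matrix.transpose_apply, ← Finset.sum_add_distrib] using h7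

theorem pderiv_pderiv_inv (hU : IsOpen U)
    (hG : ∀ i j, ContDiffOn ℝ 2 (fun z => G z i j) U) (hsymm : ∀ z, (G z).IsSymm)
    (hdet : ∀ z ∈ U, (G z).det ≠ 0) (hy : y ∈ U) (i j a b : Fin n) :
    pderiv i (pderiv j fun z => (G z)⁻¹ a b) y
      = - ∑ l, (pderiv i (christoffel G a j l) y * (G y)⁻¹ l b
          + christoffel G a j l y * pderiv i (fun z => (G z)⁻¹ l b) y
        + (pderiv i (christoffel G b j l) y * (G y)⁻¹ l a
          + christoffel G b j l y * pderiv i (fun z => (G z)⁻¹ l a) y)) := by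
  have hG1 : ∀ i j, ContDiffOn ℝ 1 (fun z => G z i j) U := fun i j => (hG i j).of_le (by norm_num)
  have dH : ∀ c d, DifferentiableAt ℝ (fun z => (G z)⁻¹ c d) y := fun c d =>
    ((contDiffOn_inv hG1 hdet c d).contDiffAt (hU.mem_nhds hy)).differentiableAt (by norm_num)
  have dC : ∀ c d e, DifferentiableAt ℝ (christoffel G c d e) y := fun c d e =>
    ((contDiffOn_christoffel (m := 1) hU hG hdet c d e).contDiffAt
      (hU.mem_nhds hy)).differentiableAt (by norm_num)
  have h1 : EqOn (pderiv j fun z => (G z)⁻¹ a b) (fun z => - ∑ l, (christoffel G a j l z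
      * (G z)⁻¹ l b + christoffel G b j l z * (G z)⁻¹ l a)) U := fun z hz =>
    isParallelInverse_inv hU hG1 hsymm hdet hz j a b
  have d1 : ∀ c d l, DifferentiableAt ℝ (fun z => christoffel G c j l z * (G z)⁻¹ l d) y :=
    fun c d l => (dC c j l).mul (dH l d)
  rw [pderiv_congr hU h1 i hy, pderiv_neg, pderiv_sum _ _ fun l _ => (d1 a b l).fun_add (d1 b a l)]
  congr 1
  refine Finset.sum_congr rfl fun l _ => ?_
  rw [pderiv_add i (d1 a b l) (d1 b a l), pderiv_mul i (dC a j l) (dH l b),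
    pderiv_mul i (dC b j l) (dH l a)]

/-- This is [∂_a, ∂_j] g_li = 0. Writing each second derivative through ∂g = G C + (G C)ᵀ, the
products Cᵀ G C cancel after antisymmetrization in a and j; what survives is the lowered curvature
plus its transpose. -/
theorem curvature_antisymm (hU : IsOpen U)
    (hG : ∀ i j, ContDiffOn ℝ 2 (fun z => G z i j) U) (hsymm : ∀ z, (G z).IsSymm)
    (hdet : ∀ z ∈ U, (G z).det ≠ 0) (hy : y ∈ U) (a j i l : Fin n) :
    ∑ k, G y l k * curvatureComp (fun k i j => christoffel G k i j y)
        (fun a k i j => pderiv a (christoffel G k i j) y) k i a j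
      + ∑ k, G y i k * curvatureComp (fun k i j => christoffel G k i j y)
        (fun a k i j => pderiv a (christoffel G k i j) y) k l a j = 0 := by
  have dG : ∀ c d, DifferentiableAt ℝ (fun z => G z c d) y := fun c d =>
    ((hG c d).contDiffAt (hU.mem_nhds hy)).differentiableAt (by norm_num)
  have dC : ∀ c d e, DifferentiableAt ℝ (christoffel G c d e) y := fun c d e =>
    ((contDiffOn_christoffel (m := 1) hU hG hdet c d e).contDiffAt
      (hU.mem_nhds hy)).differentiableAt (by norm_num)
  set C : Fin n → Matrix (Fin n) (Fin n) ℝ :=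
    fun i => Matrix.of fun c d => christoffel G c i d y with hC
  set dCm : Fin n → Fin n → Matrix (Fin n) (Fin n) ℝ :=
    fun a i => Matrix.of fun c d => pderiv a (christoffel G c i d) y with hdC
  have hdG : ∀ a c d, pderiv a (fun z => G z c d) y
      = (G y * C a + (G y * C a).transpose) c d := by
    intro a c d
    simp only [hC, Matrix.of_apply, Matrix.add_apply, Matrix.transpose_apply,
      Matrix.mul_apply, ← Finset.sum_add_distrib]
    exact pderiv_metric hsymm (hdet y hy) a c d
  have h1 : ∀ a j, pderiv a (pderiv j fun z => G z l i) y
      = ((G y * C a + (G y * C a).transpose) * C j + G y * dCm a j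
        + ((G y * C a + (G y * C a).transpose) * C j + G y * dCm a j).transpose) l i := by
    intro a j
    have h2 : EqOn (pderiv j fun z => G z l i) (fun z => ∑ k, (G z l k * christoffel G k j i z
        + G z i k * christoffel G k j l z)) U := fun z hz =>
      pderiv_metric hsymm (hdet z hz) j l i
    have d1 : ∀ b c k, DifferentiableAt ℝ (fun z => G z b k * christoffel G k j c z) y :=
      fun b c k => (dG b k).mul (dC k j c)
    rw [pderiv_congr hU h2 a hy, pderiv_sum _ _ fun k _ => (d1 l i k).fun_add (d1 i l k)]
    rw [Matrix.add_apply, Matrix.transpose_apply, Matrix.add_apply, Matrix.add_apply,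
      Matrix.mul_apply, Matrix.mul_apply, Matrix.mul_apply, Matrix.mul_apply,
      ← Finset.sum_add_distrib, ← Finset.sum_add_distrib, ← Finset.sum_add_distrib]
    refine Finset.sum_congr rfl fun k _ => ?_
    rw [pderiv_add a (d1 l i k) (d1 i l k), pderiv_mul a (dG l k) (dC k j i),
      pderiv_mul a (dG i k) (dC k j l), hdG, hdG]
    rfl
  have h3 := pderiv_comm (hG l i) hU hy a j
  rw [h1, h1, ← sub_eq_zero, ← Matrix.sub_apply] at h3
  have hcs : ∀ k i j, christoffel G k i j y = christoffel G k j i y := fun k i j =>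
    christoffel_comm hsymm k i j
  have hdcs : ∀ a k i j, pderiv a (christoffel G k i j) y = pderiv a (christoffel G k j i) y := by
    intro a k i j
    rw [show christoffel G k i j = christoffel G k j i from
      funext fun z => christoffel_comm hsymm k i j]
  have h4 : ∀ k i, curvatureComp (fun k i j => christoffel G k i j y)
        (fun a k i j => pderiv a (christoffel G k i j) y) k i a j
      = (dCm a j - dCm j a + (C a * C j - C j * C a)) k i := by
    intro k i
    simp only [curvatureComp, hC, hdC, Matrix.add_apply, Matrix.sub_apply, Matrix.mul_apply,
      Matrix.of_apply, Finset.sum_sub_distrib, hcs _ i, hdcs _ _ i]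
  simp only [h4, ← Matrix.mul_apply]
  rw [← Matrix.transpose_apply (G y * _) l i, ← Matrix.add_apply, ← h3]
  refine congrFun (congrFun (?_ : (_ : Matrix (Fin n) (Fin n) ℝ) = _) l) i
  simp only [Matrix.transpose_mul, Matrix.transpose_add, Matrix.transpose_sub, (hsymm y).eq,
    Matrix.transpose_transpose, Matrix.mul_add, Matrix.add_mul, Matrix.mul_sub, Matrix.sub_mul,
    Matrix.mul_assoc]
  abel

end MetricCalculus

/-! ### Derivative tests at a maximum -/

section MaximumTests

open Filter Topology
open scoped MatrixOrder ComplexOrder Matrix.Norms.L2Operator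

/-- If the second derivative were positive, the point would also be a local minimum. The function
would then be locally constant, with second derivative zero. -/
theorem deriv_deriv_nonpos_of_isLocalMax {g g' : ℝ → ℝ} {g'' : ℝ} (hg : ∀ᶠ s in 𝓝 0,
    HasDerivAt g (g' s) s) (hg' : HasDerivAt g' g'' 0) (hmax : IsLocalMax g 0) : g'' ≤ 0 := by
  by_contra! hpos
  have hd : deriv g =ᶠ[𝓝 0] g' := hg.mono fun s hs => hs.deriv
  have h2 : deriv (deriv g) 0 = g'' := by
    rw [hd.deriv_eq]
    exact hg'.deriv
  have hmin : IsLocalMin g 0 := isLocalMin_of_deriv_deriv_pos (by rw [h2]; exact hpos)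
    hmax.deriv_eq_zero hg.self_of_nhds.continuousAt
  have hconst : g =ᶠ[𝓝 0] fun _ => g 0 := by
    filter_upwards [hmin, hmax] with s h1 h2 using le_antisymm h2 h1
  have h3 : deriv g =ᶠ[𝓝 0] fun _ => 0 := by
    filter_upwards [hconst.eventuallyEq_nhds] with s hs
    rw [hs.deriv_eq]
    simp
  rw [h3.deriv_eq] at h2
  simp at h2
  exact hpos.ne h2

/-- Only earlier times are compared, because the maximum may occur at the final time. -/
theorem deriv_left_nonneg {g : ℝ → ℝ} {g' t : ℝ} (hg : HasDerivWithinAt g g' (Iic t) t)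
    (hmax : ∀ᶠ s in 𝓝[<] t, g s ≤ g t) : 0 ≤ g' := by
  have h1 := (hasDerivWithinAt_iff_tendsto_slope' self_notMem_Iio).1
    (hg.mono Iio_subset_Iic_self)
  refine ge_of_tendsto h1 ?_
  filter_upwards [hmax, self_mem_nhdsWithin] with s h3 h4
  rw [slope_def_field]
  exact div_nonneg_of_nonpos (by linarith) (sub_nonpos.2 (le_of_lt h4))

variable {n : ℕ}

theorem fderiv_fderiv_apply_self_nonpos {U : Set (EuclideanSpace ℝ (Fin n))} (hU : IsOpen U)
    {g : EuclideanSpace ℝ (Fin n) → ℝ} (hg : ContDiffOn ℝ 2 g U)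
    {y : EuclideanSpace ℝ (Fin n)} (hy : y ∈ U) (hmax : IsLocalMax g y)
    (b : EuclideanSpace ℝ (Fin n)) : fderiv ℝ (fderiv ℝ g) y b b ≤ 0 := by
  have hl : ∀ s : ℝ, HasDerivAt (fun s : ℝ => y + s • b) b s := fun s => by
    simpa using ((hasDerivAt_id s).smul_const b).const_add y
  have hl0 : y + (0 : ℝ) • b = y := by simp
  have hcont : Tendsto (fun s : ℝ => y + s • b) (𝓝 0) (𝓝 y) := by
    simpa using (hl 0).continuousAt.tendsto
  have h1 : HasDerivAt (fun s : ℝ => fderiv ℝ g (y + s • b)) (fderiv ℝ (fderiv ℝ g) y b) 0 := by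
    have hd : HasFDerivAt (fderiv ℝ g) (fderiv ℝ (fderiv ℝ g) y) (y + (0 : ℝ) • b) := by
      rw [hl0]
      exact (differentiableAt_fderiv hg hU hy).hasFDerivAt
    exact hd.comp_hasDerivAt (0 : ℝ) (hl 0)
  have h2 : HasDerivAt (fun s : ℝ => fderiv ℝ g (y + s • b) b)
      (fderiv ℝ (fderiv ℝ g) y b b) 0 := by
    have := (ContinuousLinearMap.apply ℝ ℝ b).hasFDerivAt.comp_hasDerivAt (0 : ℝ) h1
    exact this
  refine deriv_deriv_nonpos_of_isLocalMax (g := fun s => g (y + s • b))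
    (g' := fun s => fderiv ℝ g (y + s • b) b) ?_ h2 ?_
  · filter_upwards [hcont (hU.mem_nhds hy)] with s hs
    have hd : DifferentiableAt ℝ g (y + s • b) :=
      (hg.contDiffAt (hU.mem_nhds hs)).differentiableAt (by norm_num)
    exact hd.hasFDerivAt.comp_hasDerivAt s (hl s)
  · have h : ∀ᶠ z in 𝓝 y, g z ≤ g (y + (0 : ℝ) • b) := by
      rw [hl0]
      exact hmax
    exact hcont.eventually h

/-- Factoring A = Bᵀ B turns the contraction into a sum of second derivatives of g along the rows of
B, each of which is nonpositive. -/
theorem sum_mul_pderiv_pderiv_nonpos {U : Set (EuclideanSpace ℝ (Fin n))} (hU : IsOpen U)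
    {g : EuclideanSpace ℝ (Fin n) → ℝ} (hg : ContDiffOn ℝ 2 g U)
    {y : EuclideanSpace ℝ (Fin n)} (hy : y ∈ U)
    (hmax : IsLocalMax g y) {A : Matrix (Fin n) (Fin n) ℝ} (hA : A.PosSemidef) :
    ∑ i, ∑ j, A i j * pderiv i (pderiv j g) y ≤ 0 := by
  obtain ⟨B, rfl⟩ : ∃ B : Matrix (Fin n) (Fin n) ℝ, A = B.conjTranspose * B :=
    CStarAlgebra.nonneg_iff_eq_star_mul_self.1 hA.nonneg
  have h1 : ∑ i, ∑ j, (B.conjTranspose * B) i j * pderiv i (pderiv j g) y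
      = ∑ k, fderiv ℝ (fderiv ℝ g) y (∑ i, B k i • EuclideanSpace.single i (1 : ℝ))
        (∑ i, B k i • EuclideanSpace.single i (1 : ℝ)) := by
    simp only [map_sum, map_smul, FunLike.coe_sum, Finset.sum_apply, FunLike.coe_smul,
      Pi.smul_apply, smul_eq_mul, Matrix.mul_apply, Matrix.conjTranspose_apply, star_trivial,
      pderiv_pderiv_eq hg hU hy, Finset.sum_mul, Finset.mul_sum]
    conv_rhs => rw [Finset.sum_comm]
    conv_lhs => rw [Finset.sum_comm]
    refine Finset.sum_congr rfl fun i _ => ?_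
    rw [Finset.sum_comm]
    refine Finset.sum_congr rfl fun k _ => Finset.sum_congr rfl fun j _ => ?_
    ring
  rw [h1]
  exact Finset.sum_nonpos fun k _ => fderiv_fderiv_apply_self_nonpos hU hg hy hmax _

end MaximumTests

/-! ### Difference quotients -/

section DifferenceQuotients

open Filter Topology

variable {n : ℕ} {U : Set (EuclideanSpace ℝ (Fin n))} {y : EuclideanSpace ℝ (Fin n)}

/-- The difference quotient of `g` at `y` in the `c`-th coordinate direction with step `h`. -/
def diffQuot (h : ℝ) (c : Fin n) (g : EuclideanSpace ℝ (Fin n) → ℝ)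
    (y : EuclideanSpace ℝ (Fin n)) : ℝ :=
  (g (y + h • EuclideanSpace.single c 1) - g y) / h

/-- By the mean value theorem the quotient is a value of the partial derivative at an intermediate
point. Joint continuity therefore allows time, base point and step to vary simultaneously. -/
theorem tendsto_diffQuot {ι : Type*} {ℓ : Filter ι} {I : Set ℝ} (hU : IsOpen U)
    {g : ℝ → EuclideanSpace ℝ (Fin n) → ℝ} (hg : ∀ t ∈ I, DifferentiableOn ℝ (g t) U)
    {c : Fin n} (hgc : ContinuousOn (fun p : ℝ × EuclideanSpace ℝ (Fin n) => pderiv c (g p.1) p.2)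
      (I ×ˢ U)) {h : ι → ℝ} (hpos : ∀ᶠ l in ℓ, 0 < h l) (hh : Tendsto h ℓ (𝓝 0)) {s : ι → ℝ}
    {z : ι → EuclideanSpace ℝ (Fin n)} {t : ℝ} (hs : Tendsto s ℓ (𝓝 t)) (hz : Tendsto z ℓ (𝓝 y))
    (hsI : ∀ᶠ l in ℓ, s l ∈ I) (ht : t ∈ I) (hy : y ∈ U) :
    Tendsto (fun l => diffQuot (h l) c (g (s l)) (z l)) ℓ (𝓝 (pderiv c (g t) y)) := by
  intro N hN
  have h1 := hgc (t, y) ⟨ht, hy⟩ hN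
  rw [mem_map, mem_nhdsWithin_iff_exists_mem_nhds_inter] at h1
  obtain ⟨S, hS, hSsub⟩ := h1
  obtain ⟨S₁, hS₁, S₂, hS₂, hprod⟩ := mem_nhds_prod_iff.1 hS
  obtain ⟨δ, hδ, hball⟩ := Metric.mem_nhds_iff.1 (inter_mem hS₂ (hU.mem_nhds hy))
  rw [mem_map]
  filter_upwards [hpos, hsI, hs hS₁, hh (Iio_mem_nhds (half_pos hδ)),
    hz (Metric.ball_mem_nhds y (half_pos hδ))] with l hl0 hlI hlS hlh hlz
  have hseg : ∀ r ∈ Icc 0 (h l), z l + r • EuclideanSpace.single c (1 : ℝ) ∈ Metric.ball y δ := by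
    intro r hr
    have : ‖r • EuclideanSpace.single c (1 : ℝ)‖ ≤ h l := by
      rw [norm_smul, EuclideanSpace.norm_single, Real.norm_of_nonneg hr.1]
      simpa using hr.2
    have h2 : dist (z l) y < δ / 2 := hlz
    have h3 : h l < δ / 2 := hlh
    rw [Metric.mem_ball, dist_eq_norm] at *
    calc _ = ‖(z l - y) + r • EuclideanSpace.single c (1 : ℝ)‖ := by congr 1; abel
      _ ≤ _ := norm_add_le _ _
      _ < δ := by linarith
  have hd : ∀ r ∈ Icc 0 (h l), HasDerivAt
      (fun r : ℝ => g (s l) (z l + r • EuclideanSpace.single c (1 : ℝ)))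
      (pderiv c (g (s l)) (z l + r • EuclideanSpace.single c (1 : ℝ))) r := by
    intro r hr
    have hmem := (hball (hseg r hr)).2
    have h2 : HasDerivAt (fun r : ℝ => z l + r • EuclideanSpace.single c (1 : ℝ))
        (EuclideanSpace.single c (1 : ℝ)) r := by
      simpa using ((hasDerivAt_id r).smul_const (EuclideanSpace.single c (1 : ℝ))).const_add (z l)
    exact ((hg _ hlI).differentiableAt (hU.mem_nhds hmem)).hasFDerivAt.comp_hasDerivAt r h2
  obtain ⟨r, hr, hrd⟩ := exists_hasDerivAt_eq_slope _ _ hl0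
    (fun r hr => (hd r hr).continuousAt.continuousWithinAt)
    (fun r hr => hd r (Ioo_subset_Icc_self hr))
  have h4 : diffQuot (h l) c (g (s l)) (z l)
      = pderiv c (g (s l)) (z l + r • EuclideanSpace.single c (1 : ℝ)) := by
    rw [hrd, diffQuot]
    simp
  have hmem := hball (hseg r (Ioo_subset_Icc_self hr))
  have hp : (s l, z l + r • EuclideanSpace.single c (1 : ℝ)) ∈ S ∩ I ×ˢ U :=
    ⟨hprod ⟨hlS, hmem.1⟩, hlI, hmem.2⟩
  rw [mem_preimage, h4]
  exact hSsub hp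

/-- The set of points that stay in `U` under a step `h` in the `c`-th coordinate direction, for
each `c`. -/
def stepDomain (U : Set (EuclideanSpace ℝ (Fin n))) (h : ℝ) : Set (EuclideanSpace ℝ (Fin n)) :=
  U ∩ ⋂ c : Fin n, (fun z => z + h • EuclideanSpace.single c (1 : ℝ)) ⁻¹' U

theorem isOpen_stepDomain (hU : IsOpen U) (h : ℝ) : IsOpen (stepDomain U h) :=
  hU.inter (isOpen_iInter_of_finite fun _ => hU.preimage (by fun_prop))

theorem add_mem_of_mem_stepDomain {h : ℝ} (hy : y ∈ stepDomain U h) (c : Fin n) :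
    y + h • EuclideanSpace.single c (1 : ℝ) ∈ U := mem_iInter.1 hy.2 c

theorem contDiffOn_diffQuot {m : WithTop ℕ∞} {g : EuclideanSpace ℝ (Fin n) → ℝ}
    (hg : ContDiffOn ℝ m g U) (h : ℝ) (c : Fin n) :
    ContDiffOn ℝ m (diffQuot h c g) (stepDomain U h) := by
  unfold diffQuot
  refine ((hg.comp (contDiff_id.add contDiff_const).contDiffOn
    fun z hz => add_mem_of_mem_stepDomain hz c).sub (hg.mono inter_subset_left)).div_const _

theorem pderiv_diffQuot (hU : IsOpen U) {g : EuclideanSpace ℝ (Fin n) → ℝ}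
    (hg : DifferentiableOn ℝ g U) {h : ℝ} (hy : y ∈ stepDomain U h) (i c : Fin n) :
    pderiv i (diffQuot h c g) y = diffQuot h c (pderiv i g) y := by
  have h1 := (hg.differentiableAt (hU.mem_nhds (add_mem_of_mem_stepDomain hy c))).hasFDerivAt
  have h2 := (hg.differentiableAt (hU.mem_nhds hy.1)).hasFDerivAt
  have h3 := (((h1.comp y ((hasFDerivAt_id y).add_const _)).sub h2).mul_const h⁻¹).fderiv
  have h4 : diffQuot h c g = fun x => ((g ∘ fun x => id x + h • EuclideanSpace.single c (1 : ℝ))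
      - g) x * h⁻¹ := by
    ext z
    simp [diffQuot, div_eq_mul_inv]
  rw [h4]
  unfold pderiv
  rw [h3]
  simp [diffQuot, div_eq_mul_inv]
  ring

theorem pderiv_pderiv_diffQuot (hU : IsOpen U) {g : EuclideanSpace ℝ (Fin n) → ℝ}
    (hg : ContDiffOn ℝ 2 g U) {h : ℝ} (hy : y ∈ stepDomain U h) (i j c : Fin n) :
    pderiv i (pderiv j (diffQuot h c g)) y = diffQuot h c (pderiv i (pderiv j g)) y := by
  rw [pderiv_congr (isOpen_stepDomain hU h)
    (fun z hz => pderiv_diffQuot hU (hg.differentiableOn (by norm_num)) hz j c) i hy]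
  exact pderiv_diffQuot hU ((hg.pderiv hU (k := 1) (by norm_num) j).differentiableOn
    (by norm_num)) hy i c

theorem diffQuot_mul (h : ℝ) (c : Fin n) (f g : EuclideanSpace ℝ (Fin n) → ℝ) :
    diffQuot h c (fun z => f z * g z) y
      = diffQuot h c f y * g (y + h • EuclideanSpace.single c 1) + f y * diffQuot h c g y := by
  simp only [diffQuot]
  ring

theorem diffQuot_sum {ι : Type*} (s : Finset ι) (h : ℝ) (c : Fin n)
    (F : ι → EuclideanSpace ℝ (Fin n) → ℝ) :
    diffQuot h c (fun z => ∑ k ∈ s, F k z) y = ∑ k ∈ s, diffQuot h c (F k) y := by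
  simp only [diffQuot, ← Finset.sum_div, Finset.sum_sub_distrib]

end DifferenceQuotients

/-! ### Second derivatives of a quadratic form with variable coefficients -/

section QuadraticForm

variable {n : ℕ} {U : Set (EuclideanSpace ℝ (Fin n))} {y : EuclideanSpace ℝ (Fin n)}

theorem pderiv_pderiv_mul_mul (hU : IsOpen U) (hy : y ∈ U) {α v w : EuclideanSpace ℝ (Fin n) → ℝ}
    (hα : ContDiffOn ℝ 2 α U) (hv : ContDiffOn ℝ 2 v U) (hw : ContDiffOn ℝ 2 w U) (i j : Fin n) :
    pderiv i (pderiv j fun z => α z * v z * w z) y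
      = pderiv i (pderiv j α) y * v y * w y
        + (pderiv j α y * (pderiv i v y * w y + v y * pderiv i w y)
          + pderiv i α y * (pderiv j v y * w y + v y * pderiv j w y))
        + α y * (pderiv i (pderiv j v) y * w y + pderiv j v y * pderiv i w y
          + pderiv i v y * pderiv j w y + v y * pderiv i (pderiv j w) y) := by
  have d : ∀ {f : EuclideanSpace ℝ (Fin n) → ℝ}, ContDiffOn ℝ 2 f U → ∀ z ∈ U,
      DifferentiableAt ℝ f z := fun hf z hz =>
    (hf.contDiffAt (hU.mem_nhds hz)).differentiableAt (by norm_num)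
  have d' : ∀ {f : EuclideanSpace ℝ (Fin n) → ℝ}, ContDiffOn ℝ 2 f U → ∀ j,
      DifferentiableAt ℝ (pderiv j f) y := fun hf j =>
    ((hf.pderiv hU (k := 1) (by norm_num) j).contDiffAt (hU.mem_nhds hy)).differentiableAt
      (by norm_num)
  have h1 : Set.EqOn (pderiv j fun z => α z * v z * w z)
      (fun z => (pderiv j α z * v z + α z * pderiv j v z) * w z
        + α z * v z * pderiv j w z) U := by
    intro z hz
    rw [pderiv_mul j ((d hα z hz).fun_mul (d hv z hz)) (d hw z hz),
      pderiv_mul j (d hα z hz) (d hv z hz)]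
  have e1 := (d' hα j).fun_mul (d hv y hy)
  have e2 := (d hα y hy).fun_mul (d' hv j)
  have e3 := (d hα y hy).fun_mul (d hv y hy)
  rw [pderiv_congr hU h1 i hy, pderiv_add i ((e1.fun_add e2).fun_mul (d hw y hy))
    (e3.fun_mul (d' hw j)), pderiv_mul i (e1.fun_add e2) (d hw y hy), pderiv_add i e1 e2,
    pderiv_mul i (d' hα j) (d hv y hy), pderiv_mul i (d hα y hy) (d' hv j),
    pderiv_mul i e3 (d' hw j), pderiv_mul i (d hα y hy) (d hv y hy)]
  ring

theorem pderiv_pderiv_sum (hU : IsOpen U) (hy : y ∈ U) {ι : Type*} (s : Finset ι)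
    {F : ι → EuclideanSpace ℝ (Fin n) → ℝ} (hF : ∀ k ∈ s, ContDiffOn ℝ 2 (F k) U) (i j : Fin n) :
    pderiv i (pderiv j fun z => ∑ k ∈ s, F k z) y = ∑ k ∈ s, pderiv i (pderiv j (F k)) y := by
  have h1 : Set.EqOn (pderiv j fun z => ∑ k ∈ s, F k z) (fun z => ∑ k ∈ s, pderiv j (F k) z) U :=
    fun z hz => pderiv_sum s j fun k hk =>
      ((hF k hk).contDiffAt (hU.mem_nhds hz)).differentiableAt (by norm_num)
  rw [pderiv_congr hU h1 i hy]
  exact pderiv_sum s i fun k hk => (((hF k hk).pderiv hU (k := 1) (by norm_num) j).contDiffAt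
    (hU.mem_nhds hy)).differentiableAt (by norm_num)

theorem pderiv_pderiv_add (hU : IsOpen U) (hy : y ∈ U) {f g : EuclideanSpace ℝ (Fin n) → ℝ}
    (hf : ContDiffOn ℝ 2 f U) (hg : ContDiffOn ℝ 2 g U) (i j : Fin n) :
    pderiv i (pderiv j fun z => f z + g z) y
      = pderiv i (pderiv j f) y + pderiv i (pderiv j g) y := by
  simpa using pderiv_pderiv_sum hU hy Finset.univ (F := fun b => bif b then f else g)
    (by simp [hf, hg]) i j

theorem pderiv_pderiv_const_mul (hU : IsOpen U) (hy : y ∈ U) {f : EuclideanSpace ℝ (Fin n) → ℝ}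
    (hf : ContDiffOn ℝ 2 f U) (r : ℝ) (i j : Fin n) :
    pderiv i (pderiv j fun z => r * f z) y = r * pderiv i (pderiv j f) y := by
  have h := pderiv_pderiv_mul_mul hU hy (contDiffOn_const (c := r)) hf
    (contDiffOn_const (c := (1 : ℝ))) i j
  have hc : ∀ (r : ℝ) j, (pderiv j fun _ : EuclideanSpace ℝ (Fin n) => r) = fun _ => 0 :=
    fun r j => funext fun z => pderiv_const j r
  simpa [hc] using h

/-- Leibniz' rule, where the symmetry of A and α merges the mixed terms into the factors 4 and 2.
The second derivatives of w are isolated in the last term: for w ≈ ∇f they stand for third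
derivatives of f and are later cancelled by the time derivative. -/
theorem sum_mul_pderiv_pderiv_quadratic (hU : IsOpen U) (hy : y ∈ U)
    {α : EuclideanSpace ℝ (Fin n) → Matrix (Fin n) (Fin n) ℝ}
    {w : Fin n → EuclideanSpace ℝ (Fin n) → ℝ}
    (hα : ∀ c d, ContDiffOn ℝ 2 (fun z => α z c d) U) (hw : ∀ c, ContDiffOn ℝ 2 (w c) U)
    (hαs : ∀ z, (α z).IsSymm) {A : Matrix (Fin n) (Fin n) ℝ} (hA : A.IsSymm) :
    ∑ i, ∑ j, A i j * pderiv i (pderiv j fun z => ∑ c, ∑ d, α z c d * w c z * w d z) y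
      = ∑ i, ∑ j, A i j * ∑ c, ∑ d, pderiv i (pderiv j fun z => α z c d) y * w c y * w d y
        + 4 * ∑ i, ∑ j, A i j * ∑ c, ∑ d, pderiv i (fun z => α z c d) y * pderiv j (w c) y * w d y
        + 2 * ∑ i, ∑ j, A i j * ∑ c, ∑ d, α y c d * pderiv i (w c) y * pderiv j (w d) y
        + 2 * ∑ c, ∑ d, α y c d * w d y * ∑ i, ∑ j, A i j * pderiv i (pderiv j (w c)) y := by
  have h1 : ∀ i j, pderiv i (pderiv j fun z => ∑ c, ∑ d, α z c d * w c z * w d z) y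
      = ∑ c, ∑ d, pderiv i (pderiv j fun z => α z c d) y * w c y * w d y
        + 2 * ∑ c, ∑ d, pderiv i (fun z => α z c d) y * pderiv j (w c) y * w d y
        + 2 * ∑ c, ∑ d, pderiv j (fun z => α z c d) y * pderiv i (w c) y * w d y
        + 2 * ∑ c, ∑ d, α y c d * pderiv i (w c) y * pderiv j (w d) y
        + 2 * ∑ c, ∑ d, α y c d * w d y * pderiv i (pderiv j (w c)) y := by
    intro i j
    have hsw : ∀ (S : Fin n → Fin n → ℝ), (∀ c d, S c d = S d c) → ∀ x z : Fin n → ℝ,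
        ∑ c, ∑ d, S c d * (z c * x d) = ∑ c, ∑ d, S c d * x c * z d := by
      intro S hS x z
      rw [Finset.sum_comm]
      refine Finset.sum_congr rfl fun c _ => Finset.sum_congr rfl fun d _ => ?_
      rw [hS d c]
      ring
    have hαc : ∀ c d, (fun z => α z c d) = fun z => α z d c := fun c d =>
      funext fun z => (hαs z).apply d c
    have hm : ∀ c d, ContDiffOn ℝ 2 (fun z => α z c d * w c z * w d z) U := fun c d =>
      ((hα c d).mul (hw c)).mul (hw d)
    rw [pderiv_pderiv_sum hU hy _ fun c _ => ContDiffOn.sum fun d _ => hm c d]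
    rw [Finset.sum_congr rfl fun c _ => pderiv_pderiv_sum hU hy _ (fun d _ => hm c d) i j]
    simp only [pderiv_pderiv_mul_mul hU hy (hα _ _) (hw _) (hw _), mul_add,
      Finset.sum_add_distrib]
    have hdα : ∀ i c d, pderiv i (fun z => α z c d) y = pderiv i (fun z => α z d c) y :=
      fun i c d => by rw [hαc c d]
    rw [hsw _ (hdα j) (fun d => pderiv i (w d) y) fun c => w c y,
      hsw _ (hdα i) (fun d => pderiv j (w d) y) fun c => w c y,
      hsw _ (fun c d => (hαs y).apply d c) (fun d => pderiv i (w d) y) fun c => pderiv j (w c) y,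
      hsw _ (fun c d => (hαs y).apply d c) (fun d => pderiv i (pderiv j (w d)) y) fun c => w c y]
    simp only [← mul_assoc, mul_right_comm (α y _ _) (w _ y)]
    ring
  have h2 : ∑ i, ∑ j, A i j * ∑ c, ∑ d, pderiv j (fun z => α z c d) y * pderiv i (w c) y * w d y
      = ∑ i, ∑ j, A i j * ∑ c, ∑ d, pderiv i (fun z => α z c d) y * pderiv j (w c) y * w d y := by
    rw [Finset.sum_comm]
    refine Finset.sum_congr rfl fun i _ => Finset.sum_congr rfl fun j _ => ?_
    rw [hA.apply i j]
  have h3 : ∑ i, ∑ j, A i j * ∑ c, ∑ d, α y c d * w d y * pderiv i (pderiv j (w c)) y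
      = ∑ c, ∑ d, α y c d * w d y * ∑ i, ∑ j, A i j * pderiv i (pderiv j (w c)) y := by
    simp only [Finset.mul_sum]
    calc _ = ∑ i, ∑ c, ∑ j, ∑ d,
          A i j * (α y c d * w d y * pderiv i (pderiv j (w c)) y) :=
          Finset.sum_congr rfl fun i _ => Finset.sum_comm
      _ = ∑ c, ∑ i, ∑ d, ∑ j, A i j * (α y c d * w d y * pderiv i (pderiv j (w c)) y) := by
          rw [Finset.sum_comm]
          exact Finset.sum_congr rfl fun c _ => Finset.sum_congr rfl fun i _ => Finset.sum_comm
      _ = _ := by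
          refine Finset.sum_congr rfl fun c _ => ?_
          rw [Finset.sum_comm]
          refine Finset.sum_congr rfl fun d _ => Finset.sum_congr rfl fun i _ =>
            Finset.sum_congr rfl fun j _ => ?_
          ring
  simp only [h1, mul_add, mul_left_comm _ (2 : ℝ), Finset.sum_add_distrib, ← Finset.mul_sum]
  rw [h2, h3]
  ring

end QuadraticForm

/-! ### The maximum principle for difference quotients -/

section LocalMaximum

open Filter Topology

variable {n : ℕ}

/-- `f` is a solution of class `C^{2,1}` of `∂_t f = a^{ij} ∂_ij f + Θ` on `I × U`; the time
derivative is taken from the left. -/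
structure IsLocalSolution (I : Set ℝ) (U : Set (EuclideanSpace ℝ (Fin n)))
    (a : EuclideanSpace ℝ (Fin n) → Matrix (Fin n) (Fin n) ℝ)
    (Θ f : ℝ → EuclideanSpace ℝ (Fin n) → ℝ) : Prop where
  contDiffOn : ∀ t ∈ I, ContDiffOn ℝ 2 (f t) U
  continuousOn : ContinuousOn (fun p : ℝ × EuclideanSpace ℝ (Fin n) => f p.1 p.2) (I ×ˢ U)
  continuousOn_pderiv : ∀ i, ContinuousOn
    (fun p : ℝ × EuclideanSpace ℝ (Fin n) => pderiv i (f p.1) p.2) (I ×ˢ U)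
  continuousOn_pderiv_pderiv : ∀ i j, ContinuousOn
    (fun p : ℝ × EuclideanSpace ℝ (Fin n) => pderiv i (pderiv j (f p.1)) p.2) (I ×ˢ U)
  source_differentiableOn : ∀ t ∈ I, DifferentiableOn ℝ (Θ t) U
  source_continuousOn : ContinuousOn (fun p : ℝ × EuclideanSpace ℝ (Fin n) => Θ p.1 p.2) (I ×ˢ U)
  source_continuousOn_pderiv : ∀ i, ContinuousOn
    (fun p : ℝ × EuclideanSpace ℝ (Fin n) => pderiv i (Θ p.1) p.2) (I ×ˢ U)
  equation : ∀ t ∈ I, ∀ y ∈ U, HasDerivWithinAt (fun s => f s y)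
    (∑ i, ∑ j, a y i j * pderiv i (pderiv j (f t)) y + Θ t y) (Iic t) t

/-- The quadratic form of a matrix. -/
def quadForm (A : Matrix (Fin n) (Fin n) ℝ) (p : Fin n → ℝ) : ℝ :=
  ∑ c, ∑ d, A c d * p c * p d

/-- The value of `(∂_t - a^{ij} ∂_ij) (a^{cd} v_c v_d)` if `p = v`, `B i c = ∂_i v_c` and
`K c = (∂_t - a^{ij} ∂_ij) v_c`, in terms of the 2-jet `A`, `dA`, `ddA` of `a`. -/
def heatOfQuadForm (A : Matrix (Fin n) (Fin n) ℝ) (dA : Fin n → Fin n → Fin n → ℝ)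
    (ddA : Fin n → Fin n → Fin n → Fin n → ℝ) (p : Fin n → ℝ) (B : Fin n → Fin n → ℝ)
    (K : Fin n → ℝ) : ℝ :=
  2 * ∑ c, ∑ d, A c d * p d * K c
    - (∑ i, ∑ j, A i j * ∑ c, ∑ d, ddA i j c d * p c * p d
      + 4 * ∑ i, ∑ j, A i j * ∑ c, ∑ d, dA i c d * B j c * p d
      + 2 * ∑ i, ∑ j, A i j * ∑ c, ∑ d, A c d * B i c * B j d)

variable {I : Set ℝ} {U : Set (EuclideanSpace ℝ (Fin n))}
  {a : EuclideanSpace ℝ (Fin n) → Matrix (Fin n) (Fin n) ℝ}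
  {Θ f : ℝ → EuclideanSpace ℝ (Fin n) → ℝ}

/-- The equation is subtracted at two points. In the discrete product rule the difference of the
coefficients multiplies ∂²f at the shifted point. No time derivative of ∂_c f is required. -/
theorem IsLocalSolution.hasDerivWithinAt_diffQuot (hf : IsLocalSolution I U a Θ f) {h t : ℝ}
    {y : EuclideanSpace ℝ (Fin n)} (ht : t ∈ I) (hy : y ∈ stepDomain U h) (c : Fin n) :
    HasDerivWithinAt (fun s => diffQuot h c (f s) y)
      (∑ i, ∑ j, (diffQuot h c (fun z => a z i j) y
          * pderiv i (pderiv j (f t)) (y + h • EuclideanSpace.single c 1)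
        + a y i j * diffQuot h c (pderiv i (pderiv j (f t))) y) + diffQuot h c (Θ t) y)
      (Iic t) t := by
  have h1 := ((hf.equation t ht _ (add_mem_of_mem_stepDomain hy c)).sub
    (hf.equation t ht y hy.1)).div_const h
  refine h1.congr_deriv ?_
  simp only [← diffQuot_mul, ← diffQuot_sum]
  simp only [diffQuot]
  ring

/-- The inequality at a maximum point of a function built from difference quotients. -/
theorem IsLocalSolution.nonneg_of_isLocalMax_diffQuot (hU : IsOpen U)
    (hf : IsLocalSolution I U a Θ f) (ha : ∀ i j, ContDiffOn ℝ 2 (fun z => a z i j) U)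
    (has : ∀ z, (a z).IsSymm) {h t : ℝ} {y : EuclideanSpace ℝ (Fin n)} (ht : t ∈ I)
    (hy : y ∈ stepDomain U h) (hpsd : (a y).PosSemidef) {θ σ : ℝ → ℝ} {θ' σ' : ℝ}
    (hθ : HasDerivAt θ θ' t) (hσ : HasDerivAt σ σ' t) {ρ : EuclideanSpace ℝ (Fin n) → ℝ}
    (hρ : ContDiff ℝ 2 ρ)
    (hmax : IsLocalMax (fun z => θ t * quadForm (a z) (fun c => diffQuot h c (f t) z)
      - f t z - ρ z - σ t) y)
    (hmax_left : ∀ᶠ s in 𝓝[<] t, θ s * quadForm (a y) (fun c => diffQuot h c (f s) y)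
      - f s y - ρ y - σ s ≤ θ t * quadForm (a y) (fun c => diffQuot h c (f t) y)
      - f t y - ρ y - σ t) :
    0 ≤ θ' * quadForm (a y) (fun c => diffQuot h c (f t) y)
      + θ t * heatOfQuadForm (a y) (fun i c d => pderiv i (fun z => a z c d) y)
          (fun i j c d => pderiv i (pderiv j fun z => a z c d) y)
          (fun c => diffQuot h c (f t) y) (fun i c => diffQuot h c (pderiv i (f t)) y)
          (fun c => ∑ i, ∑ j, diffQuot h c (fun z => a z i j) y
            * pderiv i (pderiv j (f t)) (y + h • EuclideanSpace.single c 1)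
            + diffQuot h c (Θ t) y)
      - Θ t y - σ' + ∑ i, ∑ j, a y i j * pderiv i (pderiv j ρ) y := by
  set N := stepDomain U h with hN
  have hNo : IsOpen N := isOpen_stepDomain hU h
  have hNU : N ⊆ U := inter_subset_left
  set v : Fin n → EuclideanSpace ℝ (Fin n) → ℝ := fun c => diffQuot h c (f t) with hv
  have hfU := hf.contDiffOn t ht
  have hvN : ∀ c, ContDiffOn ℝ 2 (v c) N := fun c => contDiffOn_diffQuot hfU h c
  have haN : ∀ c d, ContDiffOn ℝ 2 (fun z => a z c d) N := fun c d => (ha c d).mono hNU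
  set q : EuclideanSpace ℝ (Fin n) → ℝ := fun z => ∑ c, ∑ d, a z c d * v c z * v d z with hq
  have hqN : ContDiffOn ℝ 2 q N := ContDiffOn.sum fun c _ => ContDiffOn.sum fun d _ =>
    ((haN c d).mul (hvN c)).mul (hvN d)
  -- the second derivative test in space
  have hΨ : (fun z => θ t * quadForm (a z) (fun c => diffQuot h c (f t) z) - f t z - ρ z - σ t)
      = fun z => (θ t * q z + (-1) * f t z) + ((-1) * ρ z + (- σ t)) := by
    ext z
    simp only [hq, hv, quadForm]
    ring
  rw [hΨ] at hmax
  have c1 : ContDiffOn ℝ 2 (fun z => θ t * q z) N := contDiffOn_const.mul hqN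
  have c2 : ContDiffOn ℝ 2 (fun z => (-1) * f t z) N := contDiffOn_const.mul (hfU.mono hNU)
  have c3 : ContDiffOn ℝ 2 (fun z => (-1) * ρ z) N := contDiffOn_const.mul hρ.contDiffOn
  have c4 : ContDiffOn ℝ 2 (fun _ : EuclideanSpace ℝ (Fin n) => - σ t) N := contDiffOn_const
  have hspace := sum_mul_pderiv_pderiv_nonpos hNo ((c1.add c2).add (c3.add c4)) hy hmax hpsd
  have hexp : ∀ i j, pderiv i (pderiv j fun z => (θ t * q z + (-1) * f t z)
        + ((-1) * ρ z + (- σ t))) y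
      = θ t * pderiv i (pderiv j q) y - pderiv i (pderiv j (f t)) y - pderiv i (pderiv j ρ) y := by
    intro i j
    have hc : (pderiv j fun _ : EuclideanSpace ℝ (Fin n) => - σ t) = fun _ => 0 :=
      funext fun z => pderiv_const j _
    rw [pderiv_pderiv_add hNo hy (c1.add c2) (c3.add c4), pderiv_pderiv_add hNo hy c1 c2,
      pderiv_pderiv_add hNo hy c3 c4, pderiv_pderiv_const_mul hNo hy hqN,
      pderiv_pderiv_const_mul hNo hy (hfU.mono hNU), pderiv_pderiv_const_mul hNo hy hρ.contDiffOn,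
      hc, pderiv_const]
    ring
  have hspace' : θ t * ∑ i, ∑ j, a y i j * pderiv i (pderiv j q) y
      - ∑ i, ∑ j, a y i j * pderiv i (pderiv j (f t)) y
      - ∑ i, ∑ j, a y i j * pderiv i (pderiv j ρ) y ≤ 0 := by
    refine le_of_eq_of_le ?_ hspace
    simp only [hexp, mul_sub, Finset.sum_sub_distrib, mul_left_comm _ (θ t), ← Finset.mul_sum]
  rw [sum_mul_pderiv_pderiv_quadratic hNo hy haN hvN has (has y)] at hspace'
  -- the left derivative in time
  set v' : Fin n → ℝ := fun c => ∑ i, ∑ j, (diffQuot h c (fun z => a z i j) y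
          * pderiv i (pderiv j (f t)) (y + h • EuclideanSpace.single c 1)
        + a y i j * diffQuot h c (pderiv i (pderiv j (f t))) y) + diffQuot h c (Θ t) y with hv'
  have hvt : ∀ c, HasDerivWithinAt (fun s => diffQuot h c (f s) y) (v' c) (Iic t) t :=
    fun c => hf.hasDerivWithinAt_diffQuot ht hy c
  have hqt : HasDerivWithinAt (fun s => quadForm (a y) (fun c => diffQuot h c (f s) y))
      (∑ c, ∑ d, (a y c d * v' c * v d y + a y c d * v c y * v' d)) (Iic t) t := by
    unfold quadForm
    refine HasDerivWithinAt.fun_sum fun c _ => HasDerivWithinAt.fun_sum fun d _ => ?_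
    exact ((hvt c).const_mul (a y c d)).mul (hvt d)
  have htime := deriv_left_nonneg ((((hθ.hasDerivWithinAt.mul hqt).sub
    (hf.equation t ht y hy.1)).sub (hasDerivWithinAt_const t _ (ρ y))).sub hσ.hasDerivWithinAt)
    hmax_left
  have hsym : ∑ c, ∑ d, (a y c d * v' c * v d y + a y c d * v c y * v' d)
      = 2 * ∑ c, ∑ d, a y c d * v d y * v' c := by
    simp only [Finset.sum_add_distrib]
    have : ∑ c, ∑ d, a y c d * v c y * v' d = ∑ c, ∑ d, a y c d * v d y * v' c := by
      rw [Finset.sum_comm]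
      refine Finset.sum_congr rfl fun c _ => Finset.sum_congr rfl fun d _ => ?_
      rw [(has y).apply c d]
    rw [this, two_mul]
    congr 1
    refine Finset.sum_congr rfl fun c _ => Finset.sum_congr rfl fun d _ => ?_
    ring
  rw [hsym] at htime
  -- The term a^{ij} ∂_ij v_c occurs both in the time derivative of v_c and in the spatial test.
  -- After it cancels, only first difference quotients of the coefficients, of the source and of ∂f
  -- remain, and these have limits.
  have hK : ∀ c, (∑ i, ∑ j, diffQuot h c (fun z => a z i j) y
            * pderiv i (pderiv j (f t)) (y + h • EuclideanSpace.single c 1)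
            + diffQuot h c (Θ t) y) = v' c - ∑ i, ∑ j, a y i j * pderiv i (pderiv j (v c)) y := by
    intro c
    simp only [hv', hv, pderiv_pderiv_diffQuot hU hfU hy, Finset.sum_add_distrib]
    ring
  have hB : ∀ i c, diffQuot h c (pderiv i (f t)) y = pderiv i (v c) y := fun i c =>
    (pderiv_diffQuot hU (hfU.differentiableOn (by norm_num)) hy i c).symm
  simp only [heatOfQuadForm, hK, hB, mul_sub, Finset.sum_sub_distrib]
  have hvv : ∀ c, diffQuot h c (f t) y = v c y := fun c => rfl
  simp only [hvv] at htime ⊢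
  linarith

end LocalMaximum

/-! ### The maximum principle in the limit of vanishing step -/

section LocalMaximumLimit

open Filter Topology

variable {n : ℕ}

theorem tendsto_quadForm {ι : Type*} {ℓ : Filter ι} {A : ι → Matrix (Fin n) (Fin n) ℝ}
    {A₀ : Matrix (Fin n) (Fin n) ℝ} {p : ι → Fin n → ℝ} {p₀ : Fin n → ℝ}
    (hA : ∀ i j, Tendsto (fun l => A l i j) ℓ (𝓝 (A₀ i j)))
    (hp : ∀ i, Tendsto (fun l => p l i) ℓ (𝓝 (p₀ i))) :
    Tendsto (fun l => quadForm (A l) (p l)) ℓ (𝓝 (quadForm A₀ p₀)) :=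
  tendsto_finsetSum _ fun c _ => tendsto_finsetSum _ fun d _ => ((hA c d).mul (hp c)).mul (hp d)

theorem tendsto_heatOfQuadForm {ι : Type*} {ℓ : Filter ι} {A : ι → Matrix (Fin n) (Fin n) ℝ}
    {A₀ : Matrix (Fin n) (Fin n) ℝ} {dA : ι → Fin n → Fin n → Fin n → ℝ}
    {dA₀ : Fin n → Fin n → Fin n → ℝ} {ddA : ι → Fin n → Fin n → Fin n → Fin n → ℝ}
    {ddA₀ : Fin n → Fin n → Fin n → Fin n → ℝ} {p : ι → Fin n → ℝ} {p₀ : Fin n → ℝ}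
    {B : ι → Fin n → Fin n → ℝ} {B₀ : Fin n → Fin n → ℝ} {K : ι → Fin n → ℝ} {K₀ : Fin n → ℝ}
    (hA : ∀ i j, Tendsto (fun l => A l i j) ℓ (𝓝 (A₀ i j)))
    (hdA : ∀ i c d, Tendsto (fun l => dA l i c d) ℓ (𝓝 (dA₀ i c d)))
    (hddA : ∀ i j c d, Tendsto (fun l => ddA l i j c d) ℓ (𝓝 (ddA₀ i j c d)))
    (hp : ∀ i, Tendsto (fun l => p l i) ℓ (𝓝 (p₀ i)))
    (hB : ∀ i j, Tendsto (fun l => B l i j) ℓ (𝓝 (B₀ i j)))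
    (hK : ∀ i, Tendsto (fun l => K l i) ℓ (𝓝 (K₀ i))) :
    Tendsto (fun l => heatOfQuadForm (A l) (dA l) (ddA l) (p l) (B l) (K l)) ℓ
      (𝓝 (heatOfQuadForm A₀ dA₀ ddA₀ p₀ B₀ K₀)) := by
  unfold heatOfQuadForm
  refine Tendsto.sub (Tendsto.const_mul _ ?_) (Tendsto.add (Tendsto.add ?_
    (Tendsto.const_mul _ ?_)) (Tendsto.const_mul _ ?_))
  · exact tendsto_finsetSum _ fun c _ => tendsto_finsetSum _ fun d _ =>
      ((hA c d).mul (hp d)).mul (hK c)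
  · exact tendsto_finsetSum _ fun i _ => tendsto_finsetSum _ fun j _ => (hA i j).mul <|
      tendsto_finsetSum _ fun c _ => tendsto_finsetSum _ fun d _ =>
        ((hddA i j c d).mul (hp c)).mul (hp d)
  · exact tendsto_finsetSum _ fun i _ => tendsto_finsetSum _ fun j _ => (hA i j).mul <|
      tendsto_finsetSum _ fun c _ => tendsto_finsetSum _ fun d _ =>
        ((hdA i c d).mul (hB j c)).mul (hp d)
  · exact tendsto_finsetSum _ fun i _ => tendsto_finsetSum _ fun j _ => (hA i j).mul <|
      tendsto_finsetSum _ fun c _ => tendsto_finsetSum _ fun d _ =>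
        ((hA c d).mul (hB i c)).mul (hB j d)

/-- The function `‖z - y₀‖⁴`, whose 2-jet at `y₀` vanishes. -/
def quartic (y₀ z : EuclideanSpace ℝ (Fin n)) : ℝ := (‖z - y₀‖ ^ 2) ^ 2

theorem contDiff_quartic (y₀ : EuclideanSpace ℝ (Fin n)) (m : WithTop ℕ∞) :
    ContDiff ℝ m (quartic y₀) :=
  ((contDiff_id.sub contDiff_const).norm_sq ℝ).pow 2

/-- The function is the square of ‖z - y₀‖², which vanishes at y₀ together with its first
derivatives. The penalty thus leaves no trace in the limit inequality. -/
theorem pderiv_pderiv_quartic (y₀ : EuclideanSpace ℝ (Fin n)) (i j : Fin n) :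
    pderiv i (pderiv j (quartic y₀)) y₀ = 0 := by
  set s : EuclideanSpace ℝ (Fin n) → ℝ := fun z => ‖z - y₀‖ ^ 2 with hs
  have hsd : ContDiff ℝ 2 s := (contDiff_id.sub contDiff_const).norm_sq ℝ
  have h0 : s y₀ = 0 := by simp [hs]
  have h1 : ∀ i, pderiv i s y₀ = 0 := by
    intro i
    have : IsLocalMin s y₀ := Eventually.of_forall fun z => by rw [h0]; positivity
    simp [pderiv, this.fderiv_eq_zero]
  have h2 := pderiv_pderiv_mul_mul isOpen_univ (mem_univ y₀) (contDiffOn_const (c := (1 : ℝ)))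
    hsd.contDiffOn hsd.contDiffOn i j
  have h3 : quartic y₀ = fun z => 1 * s z * s z := by
    ext z
    simp only [quartic, hs]
    ring
  rw [h3, h2]
  simp [h0, h1]

theorem continuous_pderiv_pderiv_quartic (y₀ : EuclideanSpace ℝ (Fin n)) (i j : Fin n) :
    Continuous (pderiv i (pderiv j (quartic y₀))) := by
  rw [← continuousOn_univ]
  exact (((contDiff_quartic y₀ 2).contDiffOn.pderiv isOpen_univ (k := 1) (by norm_num) j).pderiv
    isOpen_univ (k := 0) (by norm_num) i).continuousOn

variable {U : Set (EuclideanSpace ℝ (Fin n))}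
  {a : EuclideanSpace ℝ (Fin n) → Matrix (Fin n) (Fin n) ℝ}
  {Θ f : ℝ → EuclideanSpace ℝ (Fin n) → ℝ}

/-- The maximum principle for `F = θ a^{cd} ∂_c f ∂_d f - f - ε t`, for `f` of class `C^{2,1}` only:
at a maximum point, the inequality `(∂_t - a^{ij} ∂_ij) F ≥ 0` holds with the third derivatives
of `f` eliminated by means of the equation. -/
theorem IsLocalSolution.nonneg_of_isMax (hU : IsOpen U) {t₀ r : ℝ} (hr : 0 < r)
    (hf : IsLocalSolution (Ioc (t₀ - r) t₀) U a Θ f)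
    (ha : ∀ i j, ContDiffOn ℝ 2 (fun z => a z i j) U)
    (has : ∀ z, (a z).IsSymm) (hpsd : ∀ z ∈ U, (a z).PosSemidef)
    {θ θ' : ℝ → ℝ} (hθ : ∀ t ∈ Ioc (t₀ - r) t₀, HasDerivAt θ (θ' t) t)
    (hθ' : ContinuousOn θ' (Ioc (t₀ - r) t₀)) {ε : ℝ}
    {y₀ : EuclideanSpace ℝ (Fin n)} (hy₀ : y₀ ∈ U)
    (hmax : ∀ t ∈ Ioc (t₀ - r) t₀, ∀ z ∈ U,
      θ t * quadForm (a z) (fun c => pderiv c (f t) z) - f t z - ε * t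
      ≤ θ t₀ * quadForm (a y₀) (fun c => pderiv c (f t₀) y₀) - f t₀ y₀ - ε * t₀) :
    0 ≤ θ' t₀ * quadForm (a y₀) (fun c => pderiv c (f t₀) y₀)
      + θ t₀ * heatOfQuadForm (a y₀) (fun i c d => pderiv i (fun z => a z c d) y₀)
          (fun i j c d => pderiv i (pderiv j fun z => a z c d) y₀)
          (fun c => pderiv c (f t₀) y₀) (fun i c => pderiv c (pderiv i (f t₀)) y₀)
          (fun c => ∑ i, ∑ j, pderiv c (fun z => a z i j) y₀ * pderiv i (pderiv j (f t₀)) y₀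
            + pderiv c (Θ t₀) y₀)
      - Θ t₀ y₀ - ε := by
  set I := Ioc (t₀ - r) t₀ with hI
  have ht₀ : t₀ ∈ I := ⟨by linarith, le_rfl⟩
  obtain ⟨δ, hδ, hδU⟩ := Metric.nhds_basis_closedBall.mem_iff.1 (hU.mem_nhds hy₀)
  -- A point of the ball of radius κ moved by a step of at most κ stays in the ball of radius δ,
  -- hence in `U`; and κ < r keeps the times in the half-open interval.
  set κ := min (δ / 2) (r / 2) with hκ
  have hκ0 : 0 < κ := by positivity
  have hκr : κ < r := (min_le_right _ _).trans_lt (by linarith)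
  have hκδ : 2 * κ ≤ δ := by linarith [min_le_left (δ / 2) (r / 2)]
  set K : Set (ℝ × EuclideanSpace ℝ (Fin n)) :=
    Icc (t₀ - κ) t₀ ×ˢ Metric.closedBall y₀ κ with hK
  have hKc : IsCompact K := isCompact_Icc.prod (isCompact_closedBall _ _)
  have hKI : ∀ p ∈ K, p.1 ∈ I := fun p hp => ⟨by linarith [hp.1.1], hp.1.2⟩
  have hp₀ : (t₀, y₀) ∈ K := ⟨⟨by linarith, le_rfl⟩, by simp [hκ0.le]⟩
  have hKstep : ∀ p ∈ K, ∀ h, 0 ≤ h → h ≤ κ → p.2 ∈ stepDomain U h := by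
    intro p hp h h0 hh
    have h1 : dist p.2 y₀ ≤ κ := hp.2
    refine ⟨hδU (Metric.closedBall_subset_closedBall (by linarith) hp.2), mem_iInter.2 fun c =>
      hδU ?_⟩
    rw [Metric.mem_closedBall, dist_eq_norm] at *
    have h2 : ‖h • EuclideanSpace.single c (1 : ℝ)‖ ≤ h := by
      rw [norm_smul, EuclideanSpace.norm_single, Real.norm_of_nonneg h0]
      simp
    calc _ = ‖(p.2 - y₀) + h • EuclideanSpace.single c (1 : ℝ)‖ := by rw [add_sub_right_comm]
      _ ≤ _ := norm_add_le _ _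
      _ ≤ δ := by linarith
  have hKU : ∀ p ∈ K, p.2 ∈ U := fun p hp => (hKstep p hp 0 le_rfl hκ0.le).1
  have hKIU : K ⊆ I ×ˢ U := fun p hp => ⟨hKI p hp, hKU p hp⟩
  -- The square makes the maximum strict in time without changing the derivative ε of σ at t₀.
  set σ : ℝ → ℝ := fun s => ε * s + (s - t₀) ^ 2 with hσ
  have hσd : ∀ t, HasDerivAt σ (ε + 2 * (t - t₀)) t := by
    intro t
    have := ((hasDerivAt_id t).const_mul ε).add (((hasDerivAt_id t).sub_const t₀).pow 2)
    refine this.congr_deriv ?_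
    simp
  set Ψ : ℝ → ℝ × EuclideanSpace ℝ (Fin n) → ℝ := fun h p =>
    θ p.1 * quadForm (a p.2) (fun c => diffQuot h c (f p.1) p.2) - f p.1 p.2
      - quartic y₀ p.2 - σ p.1 with hΨ
  set Ψ₀ : ℝ × EuclideanSpace ℝ (Fin n) → ℝ := fun p =>
    θ p.1 * quadForm (a p.2) (fun c => pderiv c (f p.1) p.2) - f p.1 p.2
      - quartic y₀ p.2 - σ p.1 with hΨ₀
  have hacont : ∀ i j, ContinuousOn (fun p : ℝ × EuclideanSpace ℝ (Fin n) => a p.2 i j)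
      (I ×ˢ U) := fun i j => (ha i j).continuousOn.comp continuousOn_snd fun p hp => hp.2
  have hda : ∀ k i j, ContinuousOn (pderiv k fun z => a z i j) U := fun k i j =>
    ((ha i j).pderiv hU (k := 1) (by norm_num) k).continuousOn
  have hdacont : ∀ k i j, ContinuousOn (fun p : ℝ × EuclideanSpace ℝ (Fin n) =>
      pderiv k (fun z => a z i j) p.2) (I ×ˢ U) := fun k i j =>
    (hda k i j).comp continuousOn_snd fun p hp => hp.2
  have hddacont : ∀ k l i j, ContinuousOn (fun p : ℝ × EuclideanSpace ℝ (Fin n) =>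
      pderiv k (pderiv l fun z => a z i j) p.2) (I ×ˢ U) := fun k l i j =>
    (((ha i j).pderiv hU (k := 1) (by norm_num) l).pderiv hU (k := 0)
      (by norm_num) k).continuousOn.comp continuousOn_snd fun p hp => hp.2
  have hθcont : ContinuousOn (fun p : ℝ × EuclideanSpace ℝ (Fin n) => θ p.1) (I ×ˢ U) :=
    ContinuousOn.comp (t := I) (fun t ht => (hθ t ht).continuousAt.continuousWithinAt)
      continuousOn_fst fun p hp => hp.1
  have hθ'cont : ContinuousOn (fun p : ℝ × EuclideanSpace ℝ (Fin n) => θ' p.1) (I ×ˢ U) :=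
    hθ'.comp continuousOn_fst fun p hp => hp.1
  have hσcont : Continuous σ := by fun_prop
  have hΨcont : ∀ h, 0 ≤ h → h ≤ κ → ContinuousOn (Ψ h) K := by
    intro h h0 hh
    have h1 : ∀ c, ContinuousOn (fun p : ℝ × EuclideanSpace ℝ (Fin n) =>
        diffQuot h c (f p.1) p.2) K := by
      intro c
      refine ((ContinuousOn.comp hf.continuousOn
        (f := fun p => (p.1, p.2 + h • EuclideanSpace.single c (1 : ℝ))) (by fun_prop)
        fun p hp => ⟨hKI p hp, ?_⟩).sub (hf.continuousOn.mono hKIU)).div_const h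
      exact add_mem_of_mem_stepDomain (hKstep p hp h h0 hh) c
    refine ((((hθcont.mono hKIU).mul ?_).sub (hf.continuousOn.mono hKIU)).sub
      ((contDiff_quartic y₀ 0).continuous.comp continuous_snd).continuousOn).sub
      (hσcont.comp continuous_fst).continuousOn
    exact continuousOn_finsetSum _ fun c _ => continuousOn_finsetSum _ fun d _ =>
      (((hacont c d).mono hKIU).mul (h1 c)).mul (h1 d)
  set h : ℕ → ℝ := fun l => κ / (l + 1) with hh
  have hh0 : ∀ l, 0 < h l := fun l => by positivity
  have hhκ : ∀ l, h l ≤ κ := fun l =>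
    div_le_self hκ0.le (by linarith [Nat.cast_nonneg (α := ℝ) l])
  have hhlim : Tendsto h atTop (𝓝 0) := by
    simpa [hh, div_eq_mul_inv] using (tendsto_one_div_add_atTop_nhds_zero_nat (𝕜 := ℝ)).const_mul κ
  choose P hPK hPmax using fun l => hKc.exists_isMaxOn ⟨_, hp₀⟩ (hΨcont (h l) (hh0 l).le (hhκ l))
  obtain ⟨p, hp, φ, hφ, hlim⟩ := hKc.tendsto_subseq hPK
  have hhφ : Tendsto (fun l => h (φ l)) atTop (𝓝 0) := hhlim.comp hφ.tendsto_atTop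
  -- convergence along sequences in `K`
  have conv : ∀ {g : ℝ × EuclideanSpace ℝ (Fin n) → ℝ}, ContinuousOn g (I ×ˢ U) →
      ∀ {q : ℕ → ℝ × EuclideanSpace ℝ (Fin n)} {p}, (∀ l, q l ∈ K) → p ∈ K →
      Tendsto q atTop (𝓝 p) → Tendsto (fun l => g (q l)) atTop (𝓝 (g p)) := by
    intro g hg q p hq hp hqp
    exact (hg p (hKIU hp)).tendsto.comp (tendsto_nhdsWithin_iff.2
      ⟨hqp, Eventually.of_forall fun l => hKIU (hq l)⟩)
  have convDQ : ∀ {g : ℝ → EuclideanSpace ℝ (Fin n) → ℝ} {c : Fin n},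
      (∀ t ∈ I, DifferentiableOn ℝ (g t) U) →
      ContinuousOn (fun p : ℝ × EuclideanSpace ℝ (Fin n) => pderiv c (g p.1) p.2) (I ×ˢ U) →
      ∀ {q : ℕ → ℝ × EuclideanSpace ℝ (Fin n)} {p}, (∀ l, q l ∈ K) → p ∈ K →
      Tendsto q atTop (𝓝 p) → Tendsto (fun l => diffQuot (h (φ l)) c (g (q l).1) (q l).2) atTop
        (𝓝 (pderiv c (g p.1) p.2)) := by
    intro g c hg hgc q p hq hp hqp
    exact tendsto_diffQuot hU hg hgc (Eventually.of_forall fun l => hh0 _) hhφ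
      ((continuous_fst.tendsto p).comp hqp) ((continuous_snd.tendsto p).comp hqp)
      (Eventually.of_forall fun l => hKI _ (hq l)) (hKI p hp) (hKU p hp)
  have hfdiff : ∀ t ∈ I, DifferentiableOn ℝ (f t) U := fun t ht =>
    (hf.contDiffOn t ht).differentiableOn (by norm_num)
  have convΨ : ∀ {q : ℕ → ℝ × EuclideanSpace ℝ (Fin n)} {p}, (∀ l, q l ∈ K) → p ∈ K →
      Tendsto q atTop (𝓝 p) → Tendsto (fun l => Ψ (h (φ l)) (q l)) atTop (𝓝 (Ψ₀ p)) := by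
    intro q p hq hp hqp
    refine ((((conv hθcont hq hp hqp).mul (tendsto_quadForm
      (fun i j => conv (hacont i j) hq hp hqp)
      fun c => convDQ hfdiff (hf.continuousOn_pderiv c) hq hp hqp)).sub
      (conv hf.continuousOn hq hp hqp)).sub
      (((contDiff_quartic y₀ 0).continuous.tendsto _).comp
        ((continuous_snd.tendsto p).comp hqp))).sub
      ((hσcont.tendsto _).comp ((continuous_fst.tendsto p).comp hqp))
  have hPφ : ∀ l, P (φ l) ∈ K := fun l => hPK _
  -- The penalties vanish at (t₀, y₀). Comparison with `hmax` then makes both penalties vanish at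
  -- the limit p of the approximate maxima, so p = (t₀, y₀).
  have hle : Ψ₀ (t₀, y₀) ≤ Ψ₀ p := le_of_tendsto_of_tendsto'
    (convΨ (fun _ => hp₀) hp₀ tendsto_const_nhds) (convΨ hPφ hp hlim) fun l => hPmax _ hp₀
  have hpeq : p = (t₀, y₀) := by
    have h1 := hmax p.1 (hKI p hp) p.2 (hKU p hp)
    simp only [hΨ₀, hσ, quartic, sub_self, norm_zero] at hle
    have h2 : (‖p.2 - y₀‖ ^ 2) ^ 2 + (p.1 - t₀) ^ 2 ≤ 0 := by linarith
    have h3 : ‖p.2 - y₀‖ = 0 := by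
      have : (‖p.2 - y₀‖ ^ 2) ^ 2 = 0 := le_antisymm
        (by linarith [sq_nonneg (p.1 - t₀)]) (by positivity)
      simpa using this
    have h4 : p.1 - t₀ = 0 := by
      have : (p.1 - t₀) ^ 2 = 0 := le_antisymm
        (by linarith [sq_nonneg (‖p.2 - y₀‖ ^ 2)]) (by positivity)
      simpa using this
    exact Prod.ext (sub_eq_zero.1 h4) (sub_eq_zero.1 (norm_eq_zero.1 h3))
  rw [hpeq] at hlim
  -- the inequality at the approximating maximum points
  have hnear : ∀ᶠ l in atTop, (P (φ l)).1 ∈ Ioi (t₀ - κ) ∧ (P (φ l)).2 ∈ Metric.ball y₀ κ :=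
    (((continuous_fst.tendsto _).comp hlim).eventually
      (Ioi_mem_nhds (show t₀ - κ < t₀ by linarith))).and
      (((continuous_snd.tendsto _).comp hlim).eventually (Metric.ball_mem_nhds y₀ hκ0))
  -- Close to (t₀, y₀) the approximate maximum lies in the interior of the ball and strictly after
  -- t₀ - κ, so both tests apply. Its time may equal t₀, since the time test looks to the left only.
  have hineq := hnear.mono fun l hl => hf.nonneg_of_isLocalMax_diffQuot hU ha has
    (h := h (φ l)) (t := (P (φ l)).1) (y := (P (φ l)).2) (hKI _ (hPφ l))
    (hKstep _ (hPφ l) _ (hh0 _).le (hhκ _)) (hpsd _ (hKU _ (hPφ l))) (hθ _ (hKI _ (hPφ l)))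
    (hσd _) (contDiff_quartic y₀ 2)
    (by
      filter_upwards [Metric.isOpen_ball.mem_nhds hl.2] with z hz
      exact hPmax (φ l) (show ((P (φ l)).1, z) ∈ K from
        ⟨(hPφ l).1, Metric.ball_subset_closedBall hz⟩))
    (by
      have h1 : Ioo (t₀ - κ) (P (φ l)).1 ∈ 𝓝[<] (P (φ l)).1 := Ioo_mem_nhdsLT hl.1
      filter_upwards [h1] with s hs
      exact hPmax (φ l) (show (s, (P (φ l)).2) ∈ K from
        ⟨⟨hs.1.le, hs.2.le.trans (hPφ l).1.2⟩, (hPφ l).2⟩))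
  -- the limit
  have convS : ∀ {g : ℝ × EuclideanSpace ℝ (Fin n) → ℝ}, ContinuousOn g (I ×ˢ U) → ∀ c,
      Tendsto (fun l => g ((P (φ l)).1,
        (P (φ l)).2 + h (φ l) • EuclideanSpace.single c (1 : ℝ))) atTop (𝓝 (g (t₀, y₀))) := by
    intro g hg c
    refine (hg (t₀, y₀) ⟨ht₀, hy₀⟩).tendsto.comp (tendsto_nhdsWithin_iff.2 ⟨?_,
      Eventually.of_forall fun l => ⟨hKI (P (φ l)) (hPφ l), add_mem_of_mem_stepDomain
        (hKstep _ (hPφ l) _ (hh0 _).le (hhκ _)) c⟩⟩)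
    have h1 := ((continuous_snd.tendsto _).comp hlim).add
      (hhφ.smul_const (EuclideanSpace.single c (1 : ℝ)))
    simp only [zero_smul, add_zero] at h1
    exact ((continuous_fst.tendsto _).comp hlim).prodMk_nhds h1
  have hadiff : ∀ i j, ∀ t ∈ I, DifferentiableOn ℝ (fun z => a z i j) U := fun i j _ _ =>
    (ha i j).differentiableOn (by norm_num)
  have hfidiff : ∀ i, ∀ t ∈ I, DifferentiableOn ℝ (pderiv i (f t)) U := fun i t ht =>
    ((hf.contDiffOn t ht).pderiv hU (k := 1) (by norm_num) i).differentiableOn (by norm_num)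
  have hv : ∀ c, Tendsto (fun l => diffQuot (h (φ l)) c (f (P (φ l)).1) (P (φ l)).2) atTop
      (𝓝 (pderiv c (f t₀) y₀)) := fun c =>
    convDQ hfdiff (hf.continuousOn_pderiv c) hPφ hp₀ hlim
  have hA : ∀ i j, Tendsto (fun l => a (P (φ l)).2 i j) atTop (𝓝 (a y₀ i j)) := fun i j =>
    conv (hacont i j) hPφ hp₀ hlim
  have hlimit := ((((conv hθ'cont hPφ hp₀ hlim).mul (tendsto_quadForm hA hv)).add
    ((conv hθcont hPφ hp₀ hlim).mul (tendsto_heatOfQuadForm hA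
      (fun i c d => conv (hdacont i c d) hPφ hp₀ hlim)
      (fun i j c d => conv (hddacont i j c d) hPφ hp₀ hlim) hv
      (fun i c => convDQ (g := fun t => pderiv i (f t)) (c := c) (hfidiff i)
        (hf.continuousOn_pderiv_pderiv c i) hPφ hp₀ hlim)
      (fun c => (tendsto_finsetSum Finset.univ fun i _ => tendsto_finsetSum Finset.univ fun j _ =>
        (convDQ (g := fun _ z => a z i j) (hadiff i j) (hdacont c i j) hPφ hp₀ hlim).mul
          (convS (hf.continuousOn_pderiv_pderiv i j) c)).add
        (convDQ hf.source_differentiableOn (hf.source_continuousOn_pderiv c) hPφ hp₀ hlim))))).sub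
    (conv hf.source_continuousOn hPφ hp₀ hlim)).sub
    ((((continuous_const.add (continuous_const.mul (continuous_id.sub continuous_const))).comp
      continuous_fst).tendsto (t₀, y₀)).comp hlim : Tendsto (fun l => ε + 2 * ((P (φ l)).1 - t₀))
        atTop (𝓝 (ε + 2 * (t₀ - t₀))))
  have hlimit2 := hlimit.add (tendsto_finsetSum Finset.univ fun i _ =>
    tendsto_finsetSum Finset.univ fun j _ => (hA i j).mul
      (((continuous_pderiv_pderiv_quartic y₀ i j).tendsto y₀).comp
        ((continuous_snd.tendsto _).comp hlim)))
  have hfinal := ge_of_tendsto hlimit2 hineq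
  simpa [pderiv_pderiv_quartic] using hfinal

end LocalMaximumLimit

/-! ### The equation satisfied by the logarithm -/

section LogarithmicEquation

variable {n : ℕ}

theorem pderiv_quadForm {y : EuclideanSpace ℝ (Fin n)}
    {α : EuclideanSpace ℝ (Fin n) → Matrix (Fin n) (Fin n) ℝ}
    {w : Fin n → EuclideanSpace ℝ (Fin n) → ℝ}
    (hα : ∀ c d, DifferentiableAt ℝ (fun z => α z c d) y) (hw : ∀ c, DifferentiableAt ℝ (w c) y)
    (hαs : (α y).IsSymm) (i : Fin n) :
    pderiv i (fun z => quadForm (α z) fun c => w c z) y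
      = ∑ c, ∑ d, pderiv i (fun z => α z c d) y * w c y * w d y
        + 2 * ∑ c, ∑ d, α y c d * pderiv i (w c) y * w d y := by
  have e1 : ∀ c d, DifferentiableAt ℝ (fun z => α z c d * w c z) y := fun c d =>
    (hα c d).fun_mul (hw c)
  have e2 : ∀ c d, DifferentiableAt ℝ (fun z => α z c d * w c z * w d z) y := fun c d =>
    (e1 c d).fun_mul (hw d)
  have h1 : ∑ c, ∑ d, α y c d * w c y * pderiv i (w d) y
      = ∑ c, ∑ d, α y c d * pderiv i (w c) y * w d y := by
    rw [Finset.sum_comm]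
    refine Finset.sum_congr rfl fun c _ => Finset.sum_congr rfl fun d _ => ?_
    rw [hαs.apply c d]
    ring
  unfold quadForm
  rw [pderiv_sum _ i fun c _ => DifferentiableAt.fun_sum fun d _ => e2 c d,
    Finset.sum_congr rfl fun c _ => pderiv_sum _ i fun d _ => e2 c d]
  simp only [pderiv_mul i (e1 _ _) (hw _), pderiv_mul i (hα _ _) (hw _), add_mul,
    Finset.sum_add_distrib, h1]
  ring

/-- The first-order part `X^k = H^{ij} Γ^k_ij + H^{kj} ∂_j φ` of `- L`, where `H` is the inverse
metric. -/
def drift (G : EuclideanSpace ℝ (Fin n) → Matrix (Fin n) (Fin n) ℝ)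
    (φ : EuclideanSpace ℝ (Fin n) → ℝ) (k : Fin n) (z : EuclideanSpace ℝ (Fin n)) : ℝ :=
  ∑ i, ∑ j, (G z)⁻¹ i j * christoffel G k i j z + ∑ j, (G z)⁻¹ k j * pderiv j φ z

/-- The lower-order terms of the equation `∂_t f = L f - |∇f|²`. -/
def logSource (G : EuclideanSpace ℝ (Fin n) → Matrix (Fin n) (Fin n) ℝ)
    (φ f : EuclideanSpace ℝ (Fin n) → ℝ) (z : EuclideanSpace ℝ (Fin n)) : ℝ :=
  - ∑ k, drift G φ k z * pderiv k f z - quadForm (G z)⁻¹ fun c => pderiv c f z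

variable {I : Set ℝ} {U : Set (EuclideanSpace ℝ (Fin n))}
  {G : EuclideanSpace ℝ (Fin n) → Matrix (Fin n) (Fin n) ℝ}
  {φ : EuclideanSpace ℝ (Fin n) → ℝ}

theorem contDiffOn_drift (hU : IsOpen U) (hG : ∀ i j, ContDiffOn ℝ 2 (fun z => G z i j) U)
    (hdet : ∀ z ∈ U, (G z).det ≠ 0) (hφ : ContDiffOn ℝ 2 φ U) (k : Fin n) :
    ContDiffOn ℝ 1 (drift G φ k) U := by
  have hH : ∀ i j, ContDiffOn ℝ 1 (fun z => (G z)⁻¹ i j) U := fun i j =>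
    contDiffOn_inv (fun i j => (hG i j).of_le (by norm_num)) hdet i j
  exact (ContDiffOn.sum fun i _ => ContDiffOn.sum fun j _ => (hH i j).mul
    (contDiffOn_christoffel (m := 1) hU hG hdet k i j)).add
    (ContDiffOn.sum fun j _ => (hH k j).mul (hφ.pderiv hU (by norm_num) j))

theorem isSymm_inv_of_isSymm {A : Matrix (Fin n) (Fin n) ℝ} (hA : A.IsSymm) : (A⁻¹).IsSymm := by
  rw [Matrix.IsSymm, Matrix.transpose_nonsing_inv, hA.eq]

theorem pderiv_drift (hU : IsOpen U) (hG : ∀ i j, ContDiffOn ℝ 2 (fun z => G z i j) U)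
    (hdet : ∀ z ∈ U, (G z).det ≠ 0) (hφ : ContDiffOn ℝ 2 φ U) {y : EuclideanSpace ℝ (Fin n)}
    (hy : y ∈ U) (a k : Fin n) :
    pderiv a (drift G φ k) y
      = ∑ i, ∑ j, (pderiv a (fun z => (G z)⁻¹ i j) y * christoffel G k i j y
          + (G y)⁻¹ i j * pderiv a (christoffel G k i j) y)
        + ∑ j, (pderiv a (fun z => (G z)⁻¹ k j) y * pderiv j φ y
          + (G y)⁻¹ k j * pderiv a (pderiv j φ) y) := by
  have d : ∀ {g : EuclideanSpace ℝ (Fin n) → ℝ}, ContDiffOn ℝ 1 g U → DifferentiableAt ℝ g y :=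
    fun hg => (hg.contDiffAt (hU.mem_nhds hy)).differentiableAt (by norm_num)
  have hH : ∀ i j, DifferentiableAt ℝ (fun z => (G z)⁻¹ i j) y := fun i j =>
    d (contDiffOn_inv (fun i j => (hG i j).of_le (by norm_num)) hdet i j)
  have hC : ∀ i j, DifferentiableAt ℝ (christoffel G k i j) y := fun i j =>
    d (contDiffOn_christoffel (m := 1) hU hG hdet k i j)
  have hp : ∀ j, DifferentiableAt ℝ (pderiv j φ) y := fun j => d (hφ.pderiv hU (by norm_num) j)
  have e1 : ∀ i j, DifferentiableAt ℝ (fun z => (G z)⁻¹ i j * christoffel G k i j z) y :=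
    fun i j => (hH i j).fun_mul (hC i j)
  have e2 : ∀ j, DifferentiableAt ℝ (fun z => (G z)⁻¹ k j * pderiv j φ z) y :=
    fun j => (hH k j).fun_mul (hp j)
  have e3 : ∀ i, DifferentiableAt ℝ (fun z => ∑ j, (G z)⁻¹ i j * christoffel G k i j z) y :=
    fun i => DifferentiableAt.fun_sum fun j _ => e1 i j
  have h0 : drift G φ k = fun z => ∑ i, ∑ j, (G z)⁻¹ i j * christoffel G k i j z
      + ∑ j, (G z)⁻¹ k j * pderiv j φ z := rfl
  rw [h0, pderiv_add a (DifferentiableAt.fun_sum fun i _ => e3 i)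
    (DifferentiableAt.fun_sum fun j _ => e2 j), pderiv_sum _ a fun i _ => e3 i,
    pderiv_sum _ a fun j _ => e2 j, Finset.sum_congr rfl fun i _ => pderiv_sum _ a fun j _ => e1 i j]
  simp only [pderiv_mul a (hH _ _) (hC _ _), pderiv_mul a (hH _ _) (hp _)]

theorem differentiableAt_logSource (hU : IsOpen U)
    (hG : ∀ i j, ContDiffOn ℝ 2 (fun z => G z i j) U)
    (hdet : ∀ z ∈ U, (G z).det ≠ 0) (hφ : ContDiffOn ℝ 2 φ U)
    {f : EuclideanSpace ℝ (Fin n) → ℝ} (hf : ContDiffOn ℝ 2 f U) {y : EuclideanSpace ℝ (Fin n)}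
    (hy : y ∈ U) :
    DifferentiableAt ℝ (fun z => - ∑ k, drift G φ k z * pderiv k f z) y
      ∧ DifferentiableAt ℝ (fun z => quadForm (G z)⁻¹ fun c => pderiv c f z) y := by
  have d : ∀ {g : EuclideanSpace ℝ (Fin n) → ℝ}, ContDiffOn ℝ 1 g U → DifferentiableAt ℝ g y :=
    fun hg => (hg.contDiffAt (hU.mem_nhds hy)).differentiableAt (by norm_num)
  have hH : ∀ i j, DifferentiableAt ℝ (fun z => (G z)⁻¹ i j) y := fun i j =>
    d (contDiffOn_inv (fun i j => (hG i j).of_le (by norm_num)) hdet i j)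
  have hp : ∀ j, DifferentiableAt ℝ (pderiv j f) y := fun j => d (hf.pderiv hU (by norm_num) j)
  exact ⟨(DifferentiableAt.fun_sum fun k _ =>
      (d (contDiffOn_drift hU hG hdet hφ k)).fun_mul (hp k)).fun_neg,
    DifferentiableAt.fun_sum fun c _ => DifferentiableAt.fun_sum fun d _ =>
      ((hH c d).fun_mul (hp c)).fun_mul (hp d)⟩

theorem pderiv_logSource (hU : IsOpen U) (hG : ∀ i j, ContDiffOn ℝ 2 (fun z => G z i j) U)
    (hdet : ∀ z ∈ U, (G z).det ≠ 0) (hφ : ContDiffOn ℝ 2 φ U)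
    {f : EuclideanSpace ℝ (Fin n) → ℝ} (hf : ContDiffOn ℝ 2 f U) {y : EuclideanSpace ℝ (Fin n)}
    (hy : y ∈ U) (i : Fin n) :
    pderiv i (logSource G φ f) y
      = - ∑ k, (pderiv i (drift G φ k) y * pderiv k f y
          + drift G φ k y * pderiv i (pderiv k f) y)
        - pderiv i (fun z => quadForm (G z)⁻¹ fun c => pderiv c f z) y := by
  have d : ∀ {g : EuclideanSpace ℝ (Fin n) → ℝ}, ContDiffOn ℝ 1 g U → DifferentiableAt ℝ g y :=
    fun hg => (hg.contDiffAt (hU.mem_nhds hy)).differentiableAt (by norm_num)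
  have hX : ∀ k, DifferentiableAt ℝ (drift G φ k) y := fun k => d (contDiffOn_drift hU hG hdet hφ k)
  have hp : ∀ j, DifferentiableAt ℝ (pderiv j f) y := fun j => d (hf.pderiv hU (by norm_num) j)
  obtain ⟨e2, e3⟩ := differentiableAt_logSource hU hG hdet hφ hf hy
  have h0 : logSource G φ f = fun z => - ∑ k, drift G φ k z * pderiv k f z
      - quadForm (G z)⁻¹ fun c => pderiv c f z := rfl
  rw [h0, pderiv_sub i e2 e3, pderiv_neg, pderiv_sum _ i fun k _ => (hX k).fun_mul (hp k)]
  simp only [pderiv_mul i (hX _) (hp _)]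

theorem pderiv_quadForm_inv (hU : IsOpen U) (hG : ∀ i j, ContDiffOn ℝ 2 (fun z => G z i j) U)
    (hsymm : ∀ z, (G z).IsSymm) (hdet : ∀ z ∈ U, (G z).det ≠ 0)
    {f : EuclideanSpace ℝ (Fin n) → ℝ} (hf : ContDiffOn ℝ 2 f U) {y : EuclideanSpace ℝ (Fin n)}
    (hy : y ∈ U) (i : Fin n) :
    pderiv i (fun z => quadForm (G z)⁻¹ fun c => pderiv c f z) y
      = ∑ c, ∑ d, pderiv i (fun z => (G z)⁻¹ c d) y * pderiv c f y * pderiv d f y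
          + 2 * ∑ c, ∑ d, (G y)⁻¹ c d * pderiv i (pderiv c f) y * pderiv d f y :=
  pderiv_quadForm
    (fun c d => ((contDiffOn_inv hG hdet c d).contDiffAt (hU.mem_nhds hy)).differentiableAt
      (by norm_num))
    (fun c => ((hf.pderiv hU (k := 1) (by norm_num) c).contDiffAt
      (hU.mem_nhds hy)).differentiableAt (by norm_num))
    (isSymm_inv_of_isSymm (hsymm y)) i

theorem pderiv_log_div {A : ℝ} (hA : 0 < A) {v : EuclideanSpace ℝ (Fin n) → ℝ}
    {y : EuclideanSpace ℝ (Fin n)} (hv : DifferentiableAt ℝ v y) (hpos : 0 < v y)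
    (i : Fin n) : pderiv i (fun z => Real.log (A / v z)) y = - (pderiv i v y / v y) := by
  have h1 : (fun z => Real.log (A / v z)) =ᶠ[nhds y] fun z => Real.log A - Real.log (v z) := by
    filter_upwards [hv.continuousAt.eventually (lt_mem_nhds hpos)] with z hz
    rw [Real.log_div hA.ne' hz.ne']
  have h2 : HasFDerivAt (fun z => Real.log (v z)) ((v y)⁻¹ • fderiv ℝ v y) y :=
    hv.hasFDerivAt.log hpos.ne'
  unfold pderiv
  rw [h1.fderiv_eq, (h2.const_sub (Real.log A)).fderiv]
  simp [div_eq_inv_mul]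

theorem contDiffOn_log_div {A : ℝ} {m : WithTop ℕ∞} (hA : 0 < A)
    {v : EuclideanSpace ℝ (Fin n) → ℝ} (hv : ContDiffOn ℝ m v U) (hpos : ∀ z ∈ U, 0 < v z) :
    ContDiffOn ℝ m (fun z => Real.log (A / v z)) U :=
  (contDiffOn_const.div hv fun z hz => (hpos z hz).ne').log fun z hz =>
    (div_pos hA (hpos z hz)).ne'

theorem pderiv_pderiv_log_div (hU : IsOpen U) {A : ℝ} (hA : 0 < A)
    {v : EuclideanSpace ℝ (Fin n) → ℝ} (hv : ContDiffOn ℝ 2 v U) (hpos : ∀ z ∈ U, 0 < v z)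
    {y : EuclideanSpace ℝ (Fin n)} (hy : y ∈ U) (i j : Fin n) :
    pderiv i (pderiv j fun z => Real.log (A / v z)) y
      = - (pderiv i (pderiv j v) y / v y) + pderiv i v y * pderiv j v y / v y ^ 2 := by
  have d : ∀ z ∈ U, DifferentiableAt ℝ v z := fun z hz =>
    (hv.contDiffAt (hU.mem_nhds hz)).differentiableAt (by norm_num)
  have dj : DifferentiableAt ℝ (pderiv j v) y :=
    ((hv.pderiv hU (k := 1) (by norm_num) j).contDiffAt (hU.mem_nhds hy)).differentiableAt
      (by norm_num)
  have h1 : EqOn (pderiv j fun z => Real.log (A / v z)) (fun z => - (pderiv j v z * (v z)⁻¹)) U :=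
    fun z hz => by rw [pderiv_log_div hA (d z hz) (hpos z hz), div_eq_mul_inv]
  have hne := (hpos y hy).ne'
  have h2 : pderiv i (fun z => (v z)⁻¹) y = - (pderiv i v y / v y ^ 2) := by
    have := ((hasDerivAt_inv hne).comp_hasFDerivAt y (d y hy).hasFDerivAt).fderiv
    unfold pderiv
    have h3 : (fun z => (v z)⁻¹) = Inv.inv ∘ v := rfl
    rw [h3, this]
    simp [div_eq_inv_mul]
  rw [pderiv_congr hU h1 i hy, pderiv_neg, pderiv_mul i dj ((d y hy).fun_inv hne), h2]
  field_simp
  ring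

/-- If `v > 0` solves `∂_t v = L v` in local coordinates, then `f = log (A / v)` solves
`∂_t f = L f - |∇f|²`. -/
theorem isLocalSolution_log (hU : IsOpen U) (hG : ∀ i j, ContDiffOn ℝ 2 (fun z => G z i j) U)
    (hsymm : ∀ z, (G z).IsSymm) (hdet : ∀ z ∈ U, (G z).det ≠ 0) (hφ : ContDiffOn ℝ 2 φ U)
    {v : ℝ → EuclideanSpace ℝ (Fin n) → ℝ} {A : ℝ} (hA : 0 < A)
    (hpos : ∀ t ∈ I, ∀ z ∈ U, 0 < v t z)
    (hv : ∀ t ∈ I, ContDiffOn ℝ 2 (v t) U)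
    (hv0 : ContinuousOn (fun p : ℝ × EuclideanSpace ℝ (Fin n) => v p.1 p.2) (I ×ˢ U))
    (hv1 : ∀ i, ContinuousOn
      (fun p : ℝ × EuclideanSpace ℝ (Fin n) => pderiv i (v p.1) p.2) (I ×ˢ U))
    (hv2 : ∀ i j, ContinuousOn
      (fun p : ℝ × EuclideanSpace ℝ (Fin n) => pderiv i (pderiv j (v p.1)) p.2) (I ×ˢ U))
    (heq : ∀ t ∈ I, ∀ y ∈ U, HasDerivWithinAt (fun s => v s y)
      ((∑ i, ∑ j, (G y)⁻¹ i j * hessCoord G (v t) i j y)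
        - ∑ i, ∑ j, (G y)⁻¹ i j * pderiv i φ y * pderiv j (v t) y) (Iic t) t) :
    IsLocalSolution I U (fun z => (G z)⁻¹) (fun t => logSource G φ fun z => Real.log (A / v t z))
      (fun t z => Real.log (A / v t z)) := by
  have hH : ∀ i j, ContDiffOn ℝ 2 (fun z => (G z)⁻¹ i j) U := contDiffOn_inv hG hdet
  have hvne : ∀ p ∈ I ×ˢ U, v p.1 p.2 ≠ 0 := fun p hp => (hpos _ hp.1 _ hp.2).ne'
  have hd : ∀ t ∈ I, ∀ z ∈ U, DifferentiableAt ℝ (v t) z := fun t ht z hz =>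
    ((hv t ht).contDiffAt (hU.mem_nhds hz)).differentiableAt (by norm_num)
  have hf2 : ∀ t ∈ I, ContDiffOn ℝ 2 (fun z => Real.log (A / v t z)) U := fun t ht =>
    contDiffOn_log_div hA (hv t ht) (hpos t ht)
  have hf1c : ∀ i, ContinuousOn (fun p : ℝ × EuclideanSpace ℝ (Fin n) =>
      pderiv i (fun z => Real.log (A / v p.1 z)) p.2) (I ×ˢ U) := fun i =>
    ((hv1 i).div hv0 hvne).neg.congr fun p hp =>
      pderiv_log_div hA (hd _ hp.1 _ hp.2) (hpos _ hp.1 _ hp.2) i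
  have hf2c : ∀ i j, ContinuousOn (fun p : ℝ × EuclideanSpace ℝ (Fin n) =>
      pderiv i (pderiv j fun z => Real.log (A / v p.1 z)) p.2) (I ×ˢ U) := fun i j =>
    (((hv2 i j).div hv0 hvne).neg.add (((hv1 i).mul (hv1 j)).div (hv0.pow 2)
      fun p hp => pow_ne_zero 2 (hvne p hp))).congr fun p hp =>
      pderiv_pderiv_log_div hU hA (hv _ hp.1) (hpos _ hp.1) hp.2 i j
  have lift : ∀ {g : EuclideanSpace ℝ (Fin n) → ℝ}, ContinuousOn g U →
      ContinuousOn (fun p : ℝ × EuclideanSpace ℝ (Fin n) => g p.2) (I ×ˢ U) := fun hg =>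
    hg.comp continuousOn_snd fun p hp => hp.2
  have hXc : ∀ k, ContinuousOn (drift G φ k) U := fun k =>
    (contDiffOn_drift hU hG hdet hφ k).continuousOn
  have hdXc : ∀ i k, ContinuousOn (pderiv i (drift G φ k)) U := fun i k =>
    ((contDiffOn_drift hU hG hdet hφ k).pderiv hU (k := 0) (by norm_num) i).continuousOn
  have hHc : ∀ i j, ContinuousOn (fun z => (G z)⁻¹ i j) U := fun i j => (hH i j).continuousOn
  have hdHc : ∀ k i j, ContinuousOn (pderiv k fun z => (G z)⁻¹ i j) U := fun k i j =>
    ((hH i j).pderiv hU (k := 1) (by norm_num) k).continuousOn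
  refine ⟨hf2, ?_, hf1c, hf2c, ?_, ?_, ?_, ?_⟩
  · exact (continuousOn_const.div hv0 hvne).log fun p hp =>
      (div_pos hA (hpos _ hp.1 _ hp.2)).ne'
  · intro t ht y hy
    obtain ⟨e2, e3⟩ := differentiableAt_logSource hU hG hdet hφ (hf2 t ht) hy
    exact (e2.fun_sub e3).differentiableWithinAt
  · exact (continuousOn_finsetSum _ fun k _ => (lift (hXc k)).mul (hf1c k)).neg.sub
      (continuousOn_finsetSum _ fun c _ => continuousOn_finsetSum _ fun d _ =>
        ((lift (hHc c d)).mul (hf1c c)).mul (hf1c d))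
  · intro i
    refine ContinuousOn.congr ?_ fun p hp =>
      (pderiv_logSource hU hG hdet hφ (hf2 _ hp.1) hp.2 i).trans
        (by rw [pderiv_quadForm_inv hU hG hsymm hdet (hf2 _ hp.1) hp.2])
    exact (continuousOn_finsetSum _ fun k _ => ((lift (hdXc i k)).mul (hf1c k)).add
      ((lift (hXc k)).mul (hf2c i k))).neg.sub
      ((continuousOn_finsetSum _ fun c _ => continuousOn_finsetSum _ fun d _ =>
        ((lift (hdHc i c d)).mul (hf1c c)).mul (hf1c d)).add
      (continuousOn_const.mul (continuousOn_finsetSum _ fun c _ => continuousOn_finsetSum _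
        fun d _ => ((lift (hHc c d)).mul (hf2c i c)).mul (hf1c d))))
  · intro t ht y hy
    have hvy := hpos t ht y hy
    have h1 := ((hasDerivWithinAt_const t (Iic t) A).fun_div (heq t ht y hy) hvy.ne').log
      (div_pos hA hvy).ne'
    refine h1.congr_deriv ?_
    -- With g = log (A / v) one has ∂v = -v ∂g and ∂²v = v (∂g ∂g - ∂²g). Every term of the equation
    -- then carries a factor v, which is divided out, and the product ∂g ∂g yields -|∇g|².
    have hp : ∀ i, pderiv i (v t) y = - v t y * pderiv i (fun z => Real.log (A / v t z)) y := by
      intro i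
      rw [pderiv_log_div hA (hd t ht y hy) hvy]
      field_simp
    have hpp : ∀ i j, pderiv i (pderiv j (v t)) y = v t y *
        (pderiv i (fun z => Real.log (A / v t z)) y * pderiv j (fun z => Real.log (A / v t z)) y
        - pderiv i (pderiv j fun z => Real.log (A / v t z)) y) := by
      intro i j
      rw [pderiv_pderiv_log_div hU hA (hv t ht) (hpos t ht) hy, pderiv_log_div hA (hd t ht y hy) hvy,
        pderiv_log_div hA (hd t ht y hy) hvy]
      field_simp
      ring
    set g : EuclideanSpace ℝ (Fin n) → ℝ := fun z => Real.log (A / v t z) with hg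
    have e1 : ∑ i, ∑ j, (G y)⁻¹ i j * hessCoord G (v t) i j y
        = v t y * (quadForm (G y)⁻¹ (fun c => pderiv c g y)
          - ∑ i, ∑ j, (G y)⁻¹ i j * pderiv i (pderiv j g) y
          + ∑ k, (∑ i, ∑ j, (G y)⁻¹ i j * christoffel G k i j y) * pderiv k g y) := by
      have e3 : ∑ k, (∑ i, ∑ j, (G y)⁻¹ i j * christoffel G k i j y) * pderiv k g y
          = ∑ i, ∑ j, (G y)⁻¹ i j * ∑ k, christoffel G k i j y * pderiv k g y := by
        simp only [Finset.sum_mul, Finset.mul_sum]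
        rw [Finset.sum_comm]
        refine Finset.sum_congr rfl fun i _ => ?_
        rw [Finset.sum_comm]
        refine Finset.sum_congr rfl fun j _ => Finset.sum_congr rfl fun k _ => mul_assoc _ _ _
      rw [e3]
      simp only [quadForm, ← Finset.sum_sub_distrib, ← Finset.sum_add_distrib]
      rw [Finset.mul_sum]
      refine Finset.sum_congr rfl fun i _ => ?_
      rw [Finset.mul_sum]
      refine Finset.sum_congr rfl fun j _ => ?_
      have e4 : ∑ k, christoffel G k i j y * pderiv k (v t) y
          = - v t y * ∑ k, christoffel G k i j y * pderiv k g y := by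
        rw [Finset.mul_sum]
        refine Finset.sum_congr rfl fun k _ => ?_
        rw [hp]
        ring
      rw [hessCoord, hpp, e4]
      ring
    have e2 : ∑ i, ∑ j, (G y)⁻¹ i j * pderiv i φ y * pderiv j (v t) y
        = - v t y * ∑ k, (∑ j, (G y)⁻¹ k j * pderiv j φ y) * pderiv k g y := by
      rw [Finset.sum_comm, Finset.mul_sum]
      refine Finset.sum_congr rfl fun i _ => ?_
      rw [Finset.sum_mul, Finset.mul_sum]
      refine Finset.sum_congr rfl fun j _ => ?_
      rw [hp, (isSymm_inv_of_isSymm (hsymm y)).apply i j]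
      ring
    have e5 : ∑ k, drift G φ k y * pderiv k g y
        = ∑ k, (∑ i, ∑ j, (G y)⁻¹ i j * christoffel G k i j y) * pderiv k g y
          + ∑ k, (∑ j, (G y)⁻¹ k j * pderiv j φ y) * pderiv k g y := by
      rw [← Finset.sum_add_distrib]
      refine Finset.sum_congr rfl fun k _ => ?_
      rw [drift, add_mul]
    rw [logSource, e5, e1, e2]
    field_simp
    ring

end LogarithmicEquation

/-! ### Exclusion of an interior maximum -/

section InteriorMaximum

open Filter Topology
open scoped MatrixOrder ComplexOrder Matrix.Norms.L2Operator

variable {n : ℕ}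

theorem quadForm_eq_dotProduct (A : Matrix (Fin n) (Fin n) ℝ) (p : Fin n → ℝ) :
    quadForm A p = dotProduct p (A.mulVec p) := by
  simp only [quadForm, dotProduct, Matrix.mulVec, Finset.mul_sum]
  refine Finset.sum_congr rfl fun c _ => Finset.sum_congr rfl fun d _ => ?_
  ring

theorem quadForm_nonneg {A : Matrix (Fin n) (Fin n) ℝ} (hA : A.PosSemidef) (p : Fin n → ℝ) :
    0 ≤ quadForm A p := by
  rw [quadForm_eq_dotProduct]
  exact hA.dotProduct_mulVec_nonneg p

/-- This is the sign of |∇²f|². Factoring the outer copy of A as Cᵀ C leaves a sum of values of the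
quadratic form of A. -/
theorem sum_mul_sum_nonneg {A : Matrix (Fin n) (Fin n) ℝ} (hA : A.PosSemidef)
    (S : Fin n → Fin n → ℝ) :
    0 ≤ ∑ i, ∑ j, A i j * ∑ a, ∑ b, A a b * S i a * S j b := by
  obtain ⟨C, hC⟩ : ∃ C : Matrix (Fin n) (Fin n) ℝ, A = C.conjTranspose * C :=
    CStarAlgebra.nonneg_iff_eq_star_mul_self.1 hA.nonneg
  have h1 : ∀ i j, A i j = ∑ k, C k i * C k j := by
    intro i j
    rw [hC, Matrix.mul_apply]
    rfl
  have h2 : ∀ M : Fin n → Fin n → ℝ, ∑ i, ∑ j, A i j * M i j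
      = ∑ k, ∑ i, ∑ j, C k i * C k j * M i j := by
    intro M
    simp only [h1, Finset.sum_mul]
    rw [Finset.sum_congr rfl fun i _ => Finset.sum_comm, Finset.sum_comm]
  have h3 : ∀ k, ∑ i, ∑ j, C k i * C k j * ∑ a, ∑ b, A a b * S i a * S j b
      = quadForm A fun a => ∑ i, C k i * S i a := by
    intro k
    simp only [quadForm, Finset.mul_sum, Finset.sum_mul]
    calc _ = ∑ i, ∑ a, ∑ j, ∑ b, C k i * C k j * (A a b * S i a * S j b) :=
          Finset.sum_congr rfl fun i _ => Finset.sum_comm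
      _ = ∑ a, ∑ i, ∑ b, ∑ j, C k i * C k j * (A a b * S i a * S j b) := by
          rw [Finset.sum_comm]
          exact Finset.sum_congr rfl fun a _ => Finset.sum_congr rfl fun i _ => Finset.sum_comm
      _ = ∑ a, ∑ b, ∑ j, ∑ i, C k i * C k j * (A a b * S i a * S j b) := by
          refine Finset.sum_congr rfl fun a _ => ?_
          rw [Finset.sum_comm]
          exact Finset.sum_congr rfl fun b _ => Finset.sum_comm
      _ = _ := by
          refine Finset.sum_congr rfl fun a _ => Finset.sum_congr rfl fun b _ =>
            Finset.sum_congr rfl fun j _ => Finset.sum_congr rfl fun i _ => ?_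
          ring
  rw [h2]
  exact Finset.sum_nonneg fun k _ => by
    rw [h3]
    exact quadForm_nonneg hA _

theorem sum_curvatureComp_eq_ricciCoord
    (G : EuclideanSpace ℝ (Fin n) → Matrix (Fin n) (Fin n) ℝ) (i j : Fin n)
    (y : EuclideanSpace ℝ (Fin n)) :
    ∑ k, curvatureComp (fun k i j => christoffel G k i j y)
        (fun a k i j => pderiv a (christoffel G k i j) y) k i k j = ricciCoord G i j y := by
  simp only [curvatureComp, ricciCoord, Finset.sum_add_distrib]

/-- Hamilton's function `θ |∇f|² - f - ε t`, where `f = log (A / u)`, has no interior maximum. -/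
theorem IsLocalSolution.not_isMax {t₀ r : ℝ} (hr : 0 < r) {U : Set (EuclideanSpace ℝ (Fin n))}
    (hU : IsOpen U) {G : EuclideanSpace ℝ (Fin n) → Matrix (Fin n) (Fin n) ℝ}
    {φ : EuclideanSpace ℝ (Fin n) → ℝ} {f : ℝ → EuclideanSpace ℝ (Fin n) → ℝ}
    (hG : ∀ i j, ContDiffOn ℝ 2 (fun z => G z i j) U) (hsymm : ∀ z, (G z).IsSymm)
    (hpd : ∀ z ∈ U, (G z).PosDef) (hφ : ContDiffOn ℝ 2 φ U)
    (hf : IsLocalSolution (Ioc (t₀ - r) t₀) U (fun z => (G z)⁻¹)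
      (fun t => logSource G φ (f t)) f)
    {θ θ' : ℝ → ℝ} (hθ : ∀ t ∈ Ioc (t₀ - r) t₀, HasDerivAt θ (θ' t) t)
    (hθ' : ContinuousOn θ' (Ioc (t₀ - r) t₀)) (hθ0 : 0 ≤ θ t₀) {k ε : ℝ}
    (hθk : θ' t₀ + 2 * k * θ t₀ ≤ 1) (hε : 0 < ε)
    {y₀ : EuclideanSpace ℝ (Fin n)} (hy₀ : y₀ ∈ U)
    (hRic : ∀ p q : Fin n → ℝ, (∀ i, q i = ∑ j, (G y₀)⁻¹ i j * p j) →
      (∀ c, p c = pderiv c (f t₀) y₀) → -k * quadForm (G y₀)⁻¹ p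
      ≤ ∑ i, ∑ j, (ricciCoord G i j y₀ + hessCoord G φ i j y₀) * q i * q j)
    (hmax : ∀ t ∈ Ioc (t₀ - r) t₀, ∀ z ∈ U,
      θ t * quadForm (G z)⁻¹ (fun c => pderiv c (f t) z) - f t z - ε * t
      ≤ θ t₀ * quadForm (G y₀)⁻¹ (fun c => pderiv c (f t₀) y₀) - f t₀ y₀ - ε * t₀) :
    False := by
  have hdet : ∀ z ∈ U, (G z).det ≠ 0 := fun z hz => (hpd z hz).det_pos.ne'
  have hH : ∀ i j, ContDiffOn ℝ 2 (fun z => (G z)⁻¹ i j) U := contDiffOn_inv hG hdet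
  have hHs : ∀ z, ((G z)⁻¹).IsSymm := fun z => isSymm_inv_of_isSymm (hsymm z)
  have hpsd : ∀ z ∈ U, ((G z)⁻¹).PosSemidef := fun z hz => (hpd z hz).inv.posSemidef
  have ht₀ : t₀ ∈ Ioc (t₀ - r) t₀ := ⟨by linarith, le_rfl⟩
  have hf₀ := hf.contDiffOn t₀ ht₀
  have hG1 : ∀ i j, ContDiffOn ℝ 1 (fun z => G z i j) U := fun i j => (hG i j).of_le (by norm_num)
  have hheat := hf.nonneg_of_isMax hU hr hH hHs hpsd hθ hθ' hy₀ hmax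
  have hf₁ : ∀ j, DifferentiableAt ℝ (pderiv j (f t₀)) y₀ := fun j =>
    ((hf₀.pderiv hU (k := 1) (by norm_num) j).contDiffAt (hU.mem_nhds hy₀)).differentiableAt
      (by norm_num)
  -- the first-order condition
  have hfirst : ∀ c, θ t₀ * pderiv c (fun z => quadForm (G z)⁻¹ fun c => pderiv c (f t₀) z) y₀
      = pderiv c (f t₀) y₀ := by
    intro c
    have d1 := (differentiableAt_logSource hU hG hdet hφ hf₀ hy₀).2
    have d2 : DifferentiableAt ℝ (f t₀) y₀ :=
      (hf₀.contDiffAt (hU.mem_nhds hy₀)).differentiableAt (by norm_num)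
    have hloc : IsLocalMax (fun z => θ t₀ * (quadForm (G z)⁻¹ fun c => pderiv c (f t₀) z)
        - f t₀ z) y₀ := by
      filter_upwards [hU.mem_nhds hy₀] with z hz
      linarith [hmax t₀ ht₀ z hz]
    have d3 := ((differentiableAt_const (θ t₀)).fun_mul d1)
    have h1 := pderiv_sub c d3 d2
    rw [pderiv_mul c (differentiableAt_const _) d1, pderiv_const] at h1
    have h2 : pderiv c (fun z => θ t₀ * (quadForm (G z)⁻¹ fun c => pderiv c (f t₀) z)
        - f t₀ z) y₀ = 0 := by
      rw [pderiv, hloc.fderiv_eq_zero]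
      rfl
    linarith
  set p : Fin n → ℝ := fun c => pderiv c (f t₀) y₀ with hp
  set B : Matrix (Fin n) (Fin n) ℝ :=
    Matrix.of fun i j => pderiv i (pderiv j (f t₀)) y₀ with hB
  have hBs : B.IsSymm := by
    ext i j
    exact pderiv_comm hf₀ hU hy₀ j i
  set H := (G y₀)⁻¹ with hHdef
  set q := H.mulVec p with hq
  set X : Fin n → ℝ := fun k => drift G φ k y₀ with hX
  set dW : Fin n → ℝ := fun c => pderiv c (fun z => quadForm (G z)⁻¹ fun c => pderiv c (f t₀) z) y₀
    with hdW
  -- The drift is given by the trace of Γ plus ∇φ, so L f = H^{ij} ∂_ij f - X^k ∂_k f and the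
  -- algebraic identity applies to the actual 2-jets at y₀.
  have hboch := bochner_identity (hsymm y₀) (hHs y₀)
    (Matrix.mul_nonsing_inv _ (hdet y₀ hy₀).isUnit)
    (Γ := fun k i j => christoffel G k i j y₀)
    (dΓ := fun a k i j => pderiv a (christoffel G k i j) y₀)
    (fun k i j => christoffel_comm hsymm k i j)
    (isParallelInverse_inv hU hG1 hsymm hdet hy₀)
    (fun i j a b => pderiv_pderiv_inv hU hG hsymm hdet hy₀ i j a b)
    (fun a j i l => curvature_antisymm hU hG hsymm hdet hy₀ a j i l)
    (X := X) (dX := fun a k => pderiv a (drift G φ k) y₀)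
    (β := fun j => pderiv j φ y₀) (D := fun i j => pderiv i (pderiv j φ) y₀)
    (fun k => rfl) (fun a k => pderiv_drift hU hG hdet hφ hy₀ a k) p hBs
  have hricci : ∑ i, ∑ j, (∑ k, curvatureComp (fun k i j => christoffel G k i j y₀)
        (fun a k i j => pderiv a (christoffel G k i j) y₀) k i k j
        + (pderiv i (pderiv j φ) y₀ - ∑ k, christoffel G k i j y₀ * pderiv k φ y₀)) * q i * q j
      = ∑ i, ∑ j, (ricciCoord G i j y₀ + hessCoord G φ i j y₀) * q i * q j := by
    simp only [sum_curvatureComp_eq_ricciCoord]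
    rfl
  have hR := hRic p q (fun i => rfl) (fun c => rfl)
  have hS := sum_mul_sum_nonneg (hpsd y₀ hy₀)
    fun i a => B i a - ∑ k, p k * christoffel G k i a y₀
  have hdWe : ∀ c, dW c = ∑ a, ∑ b, pderiv c (fun z => (G z)⁻¹ a b) y₀ * p a * p b
          + 2 * ∑ a, ∑ b, H a b * B c a * p b := fun c =>
    pderiv_quadForm_inv hU hG hsymm hdet hf₀ hy₀ c
  have hsrc : ∀ c, pderiv c (logSource G φ (f t₀)) y₀
      = - ∑ k, (pderiv c (drift G φ k) y₀ * p k + X k * B c k) - dW c := fun c =>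
    pderiv_logSource hU hG hdet hφ hf₀ hy₀ c
  have hBc : (fun i c => pderiv c (pderiv i (f t₀)) y₀) = fun i c => B i c :=
    funext fun i => funext fun c => pderiv_comm hf₀ hU hy₀ c i
  have hBd : ∀ i c, pderiv i (pderiv c (f t₀)) y₀ = B i c := fun i c => rfl
  have hqs : ∀ K : Fin n → ℝ, ∑ c, ∑ d, H c d * p d * K c = ∑ c, q c * K c := fun K =>
    Finset.sum_congr rfl fun c _ => (Finset.sum_mul _ _ _).symm
  have hW : quadForm H p = ∑ c, q c * p c := by
    rw [← hqs]
    refine Finset.sum_congr rfl fun c _ => Finset.sum_congr rfl fun d _ => ?_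
    ring
  -- the terms with the drift
  have hXdW : ∑ k, X k * dW k
      = ∑ k, X k * ∑ a, ∑ b, pderiv k (fun z => (G z)⁻¹ a b) y₀ * p a * p b
        + 2 * ∑ c, q c * ∑ k, X k * B c k := by
    have h1 : ∀ k, ∑ a, ∑ b, H a b * B k a * p b = ∑ c, q c * B k c := by
      intro k
      rw [← hqs]
      refine Finset.sum_congr rfl fun c _ => Finset.sum_congr rfl fun d _ => ?_
      ring
    simp only [hdWe, h1, mul_add, Finset.sum_add_distrib, Finset.mul_sum]
    congr 1
    rw [Finset.sum_comm]
    refine Finset.sum_congr rfl fun c _ => Finset.sum_congr rfl fun k _ => ?_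
    rw [hBs.apply k c]
    ring
  -- With W = |∇f|², the first-order condition θ dW = df removes the drift applied to θW - f, and in
  -- `hθq` it turns θ⟨∇f, ∇W⟩ into W.
  have hθX : θ t₀ * ∑ k, X k * dW k = ∑ k, X k * p k := by
    rw [Finset.mul_sum]
    refine Finset.sum_congr rfl fun k _ => ?_
    rw [mul_left_comm, hfirst k]
  have hθq : θ t₀ * ∑ c, q c * dW c = quadForm H p := by
    rw [hW, Finset.mul_sum]
    refine Finset.sum_congr rfl fun k _ => ?_
    rw [mul_left_comm, hfirst k]
  have hsrc0 : logSource G φ (f t₀) y₀ = - ∑ k, X k * p k - quadForm H p := rfl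
  have hK : ∑ c, q c * (∑ i, ∑ j, pderiv c (fun z => (G z)⁻¹ i j) y₀ * B i j
        + pderiv c (logSource G φ (f t₀)) y₀)
      = ∑ c, q c * (∑ i, ∑ j, pderiv c (fun z => (G z)⁻¹ i j) y₀ * B i j
          - ∑ k, pderiv c (drift G φ k) y₀ * p k)
        - ∑ c, q c * ∑ k, X k * B c k - ∑ c, q c * dW c := by
    rw [← Finset.sum_sub_distrib, ← Finset.sum_sub_distrib]
    refine Finset.sum_congr rfl fun c _ => ?_
    rw [hsrc c, Finset.sum_add_distrib]
    ring
  rw [hricci] at hboch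
  rw [hBc] at hheat
  simp only [heatOfQuadForm, hBd, hqs] at hheat
  rw [hK, hsrc0] at hheat
  set S2 := ∑ i, ∑ j, H i j * ∑ a, ∑ b, H a b * (B i a - ∑ k, p k * christoffel G k i a y₀)
        * (B j b - ∑ k, p k * christoffel G k j b y₀) with hS2
  set R2 := ∑ i, ∑ j, (ricciCoord G i j y₀ + hessCoord G φ i j y₀) * q i * q j with hR2
  have hWnn : 0 ≤ quadForm H p := quadForm_nonneg (hpsd y₀ hy₀) p
  -- The coefficient is θ' + 1 - 2: the 1 comes from subtracting f, whose equation has the source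
  -- -|∇f|², and the -2 from -2θ⟨∇f, ∇W⟩.
  have hkey : 0 ≤ (θ' t₀ - 1) * quadForm H p - 2 * θ t₀ * S2 - 2 * θ t₀ * R2 - ε := by
    refine hheat.trans_eq ?_
    linear_combination (-θ t₀) * hboch + θ t₀ * hXdW - hθX - 2 * hθq
  have h1 : 0 ≤ θ t₀ * S2 := mul_nonneg hθ0 hS
  have h2 : θ t₀ * (-k * quadForm H p) ≤ θ t₀ * R2 := mul_le_mul_of_nonneg_left hR hθ0
  have h3 : (θ' t₀ + 2 * k * θ t₀) * quadForm H p ≤ 1 * quadForm H p :=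
    mul_le_mul_of_nonneg_right hθk hWnn
  linarith

end InteriorMaximum

/-! ### The Riemannian metric and gradients in a chart -/

section ChartFacts

variable {n : ℕ} {M : Type*} [TopologicalSpace M] [ChartedSpace (EuclideanSpace ℝ (Fin n)) M]
  {c : OpenPartialHomeomorph M (EuclideanSpace ℝ (Fin n))}

/-- The coordinate vector field `∂_i` of the chart `c`, at the point with coordinates `y`. -/
def coordVec (c : OpenPartialHomeomorph M (EuclideanSpace ℝ (Fin n))) (i : Fin n)
    (y : EuclideanSpace ℝ (Fin n)) : TangentSpace (𝓡 n) (c.symm y) :=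
  mfderiv (𝓡 n) (𝓡 n) c.symm y (EuclideanSpace.single i (1 : ℝ))

theorem mfderiv_coordVec [IsManifold (𝓡 n) ∞ M] (hc : c ∈ atlas (EuclideanSpace ℝ (Fin n)) M)
    {f : M → ℝ} {y : EuclideanSpace ℝ (Fin n)} (hy : y ∈ c.target)
    (hf : MDifferentiableAt (𝓡 n) 𝓘(ℝ, ℝ) f (c.symm y)) (i : Fin n) :
    (mfderiv (𝓡 n) 𝓘(ℝ, ℝ) f (c.symm y) (coordVec c i y) : ℝ) = pderiv i (f ∘ c.symm) y := by
  have : IsManifold (𝓡 n) 1 M := IsManifold.of_le (n := ∞) (by simp)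
  have h := mfderiv_comp y hf (mdifferentiableAt_atlas_symm (I := 𝓡 n) hc hy)
  unfold pderiv coordVec
  rw [← mfderiv_eq_fderiv, h]
  rfl

theorem component_coordVec [IsManifold (𝓡 n) ∞ M]
    (hc : c ∈ atlas (EuclideanSpace ℝ (Fin n)) M)
    {y : EuclideanSpace ℝ (Fin n)} (hy : y ∈ c.target) (i : Fin n) :
    component c (coordVec c i y) = EuclideanSpace.single i (1 : ℝ) := by
  have : IsManifold (𝓡 n) 1 M := IsManifold.of_le (n := ∞) (by simp)
  have h := (mdifferentiable_of_mem_atlas (I := 𝓡 n) hc).comp_symm_deriv hy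
  exact congrArg (fun L => L (EuclideanSpace.single i (1 : ℝ))) h

theorem sum_component_smul_coordVec [IsManifold (𝓡 n) ∞ M]
    (hc : c ∈ atlas (EuclideanSpace ℝ (Fin n)) M)
    {y : EuclideanSpace ℝ (Fin n)} (hy : y ∈ c.target) (v : TangentSpace (𝓡 n) (c.symm y)) :
    ∑ i, component c v i • coordVec c i y = v := by
  have : IsManifold (𝓡 n) 1 M := IsManifold.of_le (n := ∞) (by simp)
  have h := (mdifferentiable_of_mem_atlas (I := 𝓡 n) hc).symm_comp_deriv (c.map_target hy)
  have h2 := congrArg (fun L => L v) h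
  have h3 : mfderiv (𝓡 n) (𝓡 n) c.symm y (component c v) = v := by
    rw [c.right_inv hy] at h2
    exact h2
  have h4 : component c v = ∑ i, component c v i • EuclideanSpace.single i (1 : ℝ) := by
    ext j
    simp [Finset.sum_apply, Pi.single_apply]
  conv_rhs => rw [← h3, h4]
  refine Eq.symm ((map_sum (mfderiv (𝓡 n) (𝓡 n) c.symm y)
    (fun i => (component c v i • EuclideanSpace.single i (1 : ℝ) : EuclideanSpace ℝ (Fin n)))
    Finset.univ).trans ?_)
  exact Finset.sum_congr rfl fun i _ => map_smul (mfderiv (𝓡 n) (𝓡 n) c.symm y) _ _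

variable [RiemannianBundle (fun x : M => TangentSpace (𝓡 n) x)]

theorem metricCoeff_apply (i j : Fin n) (y : EuclideanSpace ℝ (Fin n)) :
    metricCoeff c y i j = inner ℝ (coordVec c i y) (coordVec c j y) := rfl

theorem inner_eq_sum_metricCoeff [IsManifold (𝓡 n) ∞ M]
    (hc : c ∈ atlas (EuclideanSpace ℝ (Fin n)) M)
    {y : EuclideanSpace ℝ (Fin n)} (hy : y ∈ c.target) (v w : TangentSpace (𝓡 n) (c.symm y)) :
    inner ℝ v w = ∑ i, ∑ j, metricCoeff c y i j * component c v i * component c w j := by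
  conv_lhs => rw [← sum_component_smul_coordVec hc hy v, ← sum_component_smul_coordVec hc hy w]
  rw [sum_inner]
  refine Finset.sum_congr rfl fun i _ => ?_
  rw [inner_sum]
  refine Finset.sum_congr rfl fun j _ => ?_
  rw [inner_smul_left, inner_smul_right, metricCoeff_apply]
  simp
  ring

theorem metricCoeff_comm (i j : Fin n) (y : EuclideanSpace ℝ (Fin n)) :
    metricCoeff c y i j = metricCoeff c y j i := by
  rw [metricCoeff_apply, metricCoeff_apply, real_inner_comm]

/-- A vector Σ ξ_i ∂_i has components ξ_i, so it is nonzero for ξ ≠ 0, and its squared length is the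
value of the form at ξ. -/
theorem metricCoeff_posDef [IsManifold (𝓡 n) ∞ M]
    (hc : c ∈ atlas (EuclideanSpace ℝ (Fin n)) M)
    {y : EuclideanSpace ℝ (Fin n)} (hy : y ∈ c.target) : (metricCoeff c y).PosDef := by
  refine Matrix.PosDef.of_dotProduct_mulVec_pos ?_ fun ξ hξ => ?_
  · ext i j
    simp [metricCoeff_comm i j]
  · set v : TangentSpace (𝓡 n) (c.symm y) := ∑ i, ξ i • coordVec c i y with hv
    have hcomp : ∀ i, component c v i = ξ i := by
      intro i
      have : component c v = ∑ j, ξ j • component c (coordVec c j y) := by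
        unfold component
        rw [hv, map_sum]
        exact Finset.sum_congr rfl fun j _ => map_smul _ _ _
      rw [this]
      simp_rw [component_coordVec hc hy]
      simp [Pi.single_apply]
    have hv0 : v ≠ 0 := by
      intro h0
      apply hξ
      ext i
      rw [← hcomp i, h0]
      unfold component
      rw [map_zero]
      rfl
    have h1 : 0 < inner ℝ v v := real_inner_self_pos.2 hv0
    rw [inner_eq_sum_metricCoeff hc hy] at h1
    refine h1.trans_eq ?_
    simp only [dotProduct, Matrix.mulVec, hcomp, Finset.mul_sum, Pi.star_apply, star_trivial]
    refine Finset.sum_congr rfl fun i _ => Finset.sum_congr rfl fun j _ => ?_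
    ring

/-- The coordinate fields are images of constant fields under the tangent map of the smooth inverse
chart; the smooth bundle metric then has smooth values on them. -/
theorem contDiffOn_metricCoeff [IsManifold (𝓡 n) ∞ M]
    [IsContMDiffRiemannianBundle (𝓡 n) ∞ (EuclideanSpace ℝ (Fin n))
      (fun x : M => TangentSpace (𝓡 n) x)]
    (hc : c ∈ atlas (EuclideanSpace ℝ (Fin n)) M) (i j : Fin n) :
    ContDiffOn ℝ ∞ (fun y => metricCoeff c y i j) c.target := by
  have key : ∀ i : Fin n, ContMDiffOn (𝓡 n) ((𝓡 n).prod (𝓡 n)) ∞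
      (fun y => (⟨c.symm y, coordVec c i y⟩ : TangentBundle (𝓡 n) M)) c.target := by
    intro i
    have h1 : ContMDiffOn (𝓡 n) (𝓡 n) ∞ c.symm c.target := contMDiffOn_symm_of_mem_maximalAtlas
      (IsManifold.subset_maximalAtlas hc)
    have h2 := h1.contMDiffOn_tangentMapWithin (m := ∞) (by simp) c.open_target.uniqueMDiffOn
    have h3 : ContMDiff (𝓡 n) (𝓡 n).tangent ∞ (fun y => (⟨y, EuclideanSpace.single i (1 : ℝ)⟩ :
        TangentBundle (𝓡 n) (EuclideanSpace ℝ (Fin n)))) := by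
      exact contMDiff_vectorSpace_iff_contDiff.2 contDiff_const
    have h4 := h2.comp (h3.contMDiffOn (s := c.target)) (fun y hy => hy)
    refine h4.congr fun y hy => ?_
    simp only [Function.comp_apply, tangentMapWithin]
    rw [mfderivWithin_of_isOpen c.open_target hy]
    rfl
  rw [← contMDiffOn_iff_contDiffOn]
  exact (key i).inner_bundle (key j)

theorem inner_grad_eq_sum [IsManifold (𝓡 n) ∞ M]
    (hc : c ∈ atlas (EuclideanSpace ℝ (Fin n)) M)
    {f : M → ℝ} {y : EuclideanSpace ℝ (Fin n)} (hy : y ∈ c.target)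
    (hf : MDifferentiableAt (𝓡 n) 𝓘(ℝ, ℝ) f (c.symm y)) (w : TangentSpace (𝓡 n) (c.symm y)) :
    inner ℝ (grad n f (c.symm y)) w = ∑ i, pderiv i (f ∘ c.symm) y * component c w i := by
  conv_lhs => rw [← sum_component_smul_coordVec hc hy w]
  rw [inner_sum]
  refine Finset.sum_congr rfl fun i _ => ?_
  rw [inner_smul_right, inner_grad, mfderiv_coordVec hc hy hf, mul_comm]

/-- Pairing the gradient with ∂_j shows that G maps its components to the partial derivatives; then
G is inverted. -/
theorem component_grad [IsManifold (𝓡 n) ∞ M]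
    (hc : c ∈ atlas (EuclideanSpace ℝ (Fin n)) M)
    {f : M → ℝ} {y : EuclideanSpace ℝ (Fin n)} (hy : y ∈ c.target)
    (hf : MDifferentiableAt (𝓡 n) 𝓘(ℝ, ℝ) f (c.symm y)) (i : Fin n) :
    component c (grad n f (c.symm y)) i
      = ∑ j, (metricCoeff c y)⁻¹ i j * pderiv j (f ∘ c.symm) y := by
  have h1 : (metricCoeff c y).mulVec (fun a => component c (grad n f (c.symm y)) a)
      = fun j => pderiv j (f ∘ c.symm) y := by
    ext j
    rw [← mfderiv_coordVec hc hy hf, ← inner_grad, inner_eq_sum_metricCoeff hc hy,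
      component_coordVec hc hy]
    simp [Matrix.mulVec, dotProduct, metricCoeff_comm j]
  have h2 : IsUnit (metricCoeff c y).det := (metricCoeff_posDef hc hy).det_pos.ne'.isUnit
  have h3 := congrArg (fun v => (metricCoeff c y)⁻¹.mulVec v i) h1
  simp only [Matrix.mulVec_mulVec, Matrix.nonsing_inv_mul _ h2, Matrix.one_mulVec] at h3
  exact h3

theorem inner_grad_grad [IsManifold (𝓡 n) ∞ M]
    (hc : c ∈ atlas (EuclideanSpace ℝ (Fin n)) M)
    {f h : M → ℝ} {y : EuclideanSpace ℝ (Fin n)} (hy : y ∈ c.target)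
    (hf : MDifferentiableAt (𝓡 n) 𝓘(ℝ, ℝ) f (c.symm y))
    (hh : MDifferentiableAt (𝓡 n) 𝓘(ℝ, ℝ) h (c.symm y)) :
    inner ℝ (grad n f (c.symm y)) (grad n h (c.symm y))
      = ∑ i, ∑ j, (metricCoeff c y)⁻¹ i j * pderiv i (f ∘ c.symm) y
          * pderiv j (h ∘ c.symm) y := by
  rw [inner_grad_eq_sum hc hy hf]
  refine Finset.sum_congr rfl fun i _ => ?_
  rw [component_grad hc hy hh, Finset.mul_sum]
  refine Finset.sum_congr rfl fun j _ => ?_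
  ring

theorem diffusionOp_eq [IsManifold (𝓡 n) ∞ M]
    (hc : c ∈ atlas (EuclideanSpace ℝ (Fin n)) M)
    {φ f : M → ℝ} {y : EuclideanSpace ℝ (Fin n)} (hy : y ∈ c.target)
    (hφ : MDifferentiableAt (𝓡 n) 𝓘(ℝ, ℝ) φ (c.symm y))
    (hf : MDifferentiableAt (𝓡 n) 𝓘(ℝ, ℝ) f (c.symm y)) :
    diffusionOp c φ f (c.symm y)
      = (∑ i, ∑ j, (metricCoeff c y)⁻¹ i j * hessCoord (metricCoeff c) (f ∘ c.symm) i j y)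
        - ∑ i, ∑ j, (metricCoeff c y)⁻¹ i j * pderiv i (φ ∘ c.symm) y
          * pderiv j (f ∘ c.symm) y := by
  rw [diffusionOp, laplaceBeltrami, inner_grad_grad hc hy hφ hf, c.right_inv hy]

end ChartFacts

/-! ### The maximum over the compact manifold -/

section GlobalMaximum

open Filter Topology

variable {n : ℕ} {M : Type*} [TopologicalSpace M] [ChartedSpace (EuclideanSpace ℝ (Fin n)) M]
  {c : OpenPartialHomeomorph M (EuclideanSpace ℝ (Fin n))}

theorem Ioc_subset_timeInterval {T : EReal} {t : ℝ} (ht : t ∈ timeInterval T) :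
    Ioc 0 t ⊆ timeInterval T := fun _ hs =>
  ⟨hs.1, (EReal.coe_le_coe_iff.2 hs.2).trans ht.2⟩

theorem contDiffOn_comp_chart_symm [IsManifold (𝓡 n) ∞ M]
    (hc : c ∈ atlas (EuclideanSpace ℝ (Fin n)) M) {f : M → ℝ}
    (hf : ContMDiff (𝓡 n) 𝓘(ℝ, ℝ) 2 f) : ContDiffOn ℝ 2 (f ∘ c.symm) c.target := by
  have h1 : ContMDiffOn (𝓡 n) (𝓡 n) 2 c.symm c.target :=
    (contMDiffOn_symm_of_mem_maximalAtlas (I := 𝓡 n) (n := ∞)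
      (IsManifold.subset_maximalAtlas hc)).of_le (WithTop.coe_le_coe.2 le_top)
  exact (hf.comp_contMDiffOn h1).contDiffOn

theorem continuousOn_of_chart {I : Set ℝ} {F : ℝ × M → ℝ}
    (hF : ∀ c ∈ atlas (EuclideanSpace ℝ (Fin n)) M, ContinuousOn
      (fun p : ℝ × EuclideanSpace ℝ (Fin n) => F (p.1, c.symm p.2)) (I ×ˢ c.target)) :
    ContinuousOn F (I ×ˢ univ) := by
  rintro ⟨t, x⟩ ⟨ht, -⟩
  set c := chartAt (EuclideanSpace ℝ (Fin n)) x with hc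
  have hx : x ∈ c.source := mem_chart_source _ x
  have h1 : ContinuousOn (fun p : ℝ × M => (p.1, c p.2)) (I ×ˢ c.source) :=
    continuousOn_fst.prodMk (c.continuousOn.comp continuousOn_snd fun p hp => hp.2)
  have h2 := (hF c (chart_mem_atlas _ x)).comp h1 fun p hp => ⟨hp.1, c.map_source hp.2⟩
  have h3 : ContinuousOn F (I ×ˢ c.source) := h2.congr fun p hp => by
    simp [c.left_inv hp.2]
  refine (h3 (t, x) ⟨ht, hx⟩).mono_of_mem_nhdsWithin ?_
  rw [nhdsWithin_prod_eq, nhdsWithin_univ]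
  exact prod_mem_prod self_mem_nhdsWithin (c.open_source.mem_nhds hx)

variable [RiemannianBundle (fun x : M => TangentSpace (𝓡 n) x)]

/-- The derivative of log (A / v) is -dv / v: the constant A drops out and the sign disappears in
the quadratic form. -/
theorem norm_grad_sq_div_sq [IsManifold (𝓡 n) ∞ M]
    (hc : c ∈ atlas (EuclideanSpace ℝ (Fin n)) M) {v : M → ℝ}
    (hv : ContMDiff (𝓡 n) 𝓘(ℝ, ℝ) 2 v) (hpos : ∀ x, 0 < v x) {A : ℝ} (hA : 0 < A)
    {y : EuclideanSpace ℝ (Fin n)} (hy : y ∈ c.target) :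
    ‖grad n v (c.symm y)‖ ^ 2 / (v (c.symm y)) ^ 2
      = quadForm (metricCoeff c y)⁻¹
          fun i => pderiv i (fun z => Real.log (A / v (c.symm z))) y := by
  have hvd : MDifferentiableAt (𝓡 n) 𝓘(ℝ, ℝ) v (c.symm y) :=
    hv.mdifferentiable (by norm_num) _
  have hd : DifferentiableAt ℝ (v ∘ c.symm) y :=
    ((contDiffOn_comp_chart_symm hc hv).contDiffAt
      (c.open_target.mem_nhds hy)).differentiableAt (by norm_num)
  have hp : ∀ i, pderiv i (fun z => Real.log (A / v (c.symm z))) y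
      = - (pderiv i (v ∘ c.symm) y / v (c.symm y)) := fun i =>
    pderiv_log_div hA hd (hpos _) i
  rw [← real_inner_self_eq_norm_sq, inner_grad_grad hc hy hvd hvd, quadForm]
  simp only [hp, Finset.sum_div]
  refine Finset.sum_congr rfl fun i _ => Finset.sum_congr rfl fun j _ => ?_
  have := (hpos (c.symm y)).ne'
  field_simp

/-- The term subtracted in the Bakry-Émery tensor is a square divided by m - n ≥ 0, so dropping it
preserves the lower bound. For m = n it is zero, division by zero having the value zero. -/
theorem ricci_add_hess_ge [IsManifold (𝓡 n) ∞ M]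
    (hc : c ∈ atlas (EuclideanSpace ℝ (Fin n)) M) {φ : M → ℝ} {m κ : ℝ} (hm : (n : ℝ) ≤ m)
    (hRic : BakryEmeryRicciGE n φ m κ) {y : EuclideanSpace ℝ (Fin n)} (hy : y ∈ c.target)
    (w : TangentSpace (𝓡 n) (c.symm y)) :
    κ * ‖w‖ ^ 2 ≤ ∑ i, ∑ j, (ricciCoord (metricCoeff c) i j y
      + hessCoord (metricCoeff c) (φ ∘ c.symm) i j y) * component c w i * component c w j := by
  have h1 := hRic c hc _ (c.map_target hy) w
  have h2 : 0 ≤ inner ℝ (grad n φ (c.symm y)) w * inner ℝ (grad n φ (c.symm y)) w / (m - n) :=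
    div_nonneg (mul_self_nonneg _) (sub_nonneg.2 hm)
  simp only [bakryEmeryRicci, ricci, hess, c.right_inv hy] at h1
  simp only [add_mul, Finset.sum_add_distrib]
  linarith

/-- The time factor `s / (1 + 2 k s)` of Hamilton's function. -/
theorem hasDerivAt_timeFactor {k τ t : ℝ} (hk : 0 ≤ k) (ht : τ < t) :
    HasDerivAt (fun s => (s - τ) / (1 + 2 * k * (s - τ))) (1 / (1 + 2 * k * (t - τ)) ^ 2) t := by
  have hd : 1 + 2 * k * (t - τ) ≠ 0 := by
    have := mul_nonneg hk (sub_pos.2 ht).le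
    nlinarith
  have h1 := ((hasDerivAt_id t).sub_const τ).fun_div
    ((((hasDerivAt_id t).sub_const τ).const_mul (2 * k)).const_add 1) hd
  refine h1.congr_deriv ?_
  simp only [id]
  congr 1
  ring

/-- With d = 1 + 2ks ≥ 1 the left side equals 1 - 1/d + 1/d². -/
theorem timeFactor_deriv_add_le {k s : ℝ} (hk : 0 ≤ k) (hs : 0 ≤ s) :
    1 / (1 + 2 * k * s) ^ 2 + 2 * k * (s / (1 + 2 * k * s)) ≤ 1 := by
  have h0 := mul_nonneg hk hs
  have hd : 0 < 1 + 2 * k * s := by linarith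
  have h1 : 1 / (1 + 2 * k * s) ^ 2 + 2 * k * (s / (1 + 2 * k * s))
      = (1 + 2 * k * s * (1 + 2 * k * s)) / (1 + 2 * k * s) ^ 2 := by
    field_simp
  rw [h1, div_le_one (by positivity)]
  nlinarith

theorem IsSolution.isLocalSolution [IsManifold (𝓡 n) ∞ M]
    [IsContMDiffRiemannianBundle (𝓡 n) ∞ (EuclideanSpace ℝ (Fin n))
      (fun x : M => TangentSpace (𝓡 n) x)]
    {φ : M → ℝ} (hφ : ContMDiff (𝓡 n) 𝓘(ℝ, ℝ) 2 φ) {T : EReal} {u : ℝ → M → ℝ}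
    (hu : IsSolution n φ T u) (hpos : ∀ t ∈ timeInterval T, ∀ x, 0 < u t x) {A : ℝ} (hA : 0 < A)
    (hc : c ∈ atlas (EuclideanSpace ℝ (Fin n)) M) {I : Set ℝ} (hI : I ⊆ timeInterval T) :
    IsLocalSolution I c.target (fun z => (metricCoeff c z)⁻¹)
      (fun t => logSource (metricCoeff c) (φ ∘ c.symm) fun z => Real.log (A / u t (c.symm z)))
      (fun t z => Real.log (A / u t (c.symm z))) := by
  have hmono : I ×ˢ c.target ⊆ timeInterval T ×ˢ c.target := prod_mono_left hI
  refine isLocalSolution_log (v := fun t z => u t (c.symm z)) c.open_target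
    (fun i j => (contDiffOn_metricCoeff hc i j).of_le (WithTop.coe_le_coe.2 le_top))
    (fun z => Matrix.IsSymm.ext fun i j => metricCoeff_comm j i z)
    (fun z hz => (metricCoeff_posDef hc hz).det_pos.ne') (contDiffOn_comp_chart_symm hc hφ) hA
    (fun t ht z _ => hpos t (hI ht) _)
    (fun t ht => contDiffOn_comp_chart_symm hc (hu.contMDiff t (hI ht)))
    ((hu.continuousOn c hc).mono hmono) (fun i => (hu.continuousOn_pderiv c hc i).mono hmono)
    (fun i j => (hu.continuousOn_pderiv_pderiv c hc i j).mono hmono) fun t ht y hy => ?_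
  have h1 := hu.equation t (hI ht) c hc _ (c.map_target hy)
  rw [diffusionOp_eq hc hy (hφ.mdifferentiable (by norm_num) _)
    ((hu.contMDiff t (hI ht)).mdifferentiable (by norm_num) _)] at h1
  -- All times in (0, t] belong to the interval, so the derivative within it restricts to a
  -- derivative from the left, at a finite final time as well.
  refine h1.mono_of_mem_nhdsWithin ?_
  refine mem_of_superset (inter_mem_nhdsWithin (Iic t) (Ioi_mem_nhds (hI ht).1)) fun s hs => ?_
  exact Ioc_subset_timeInterval (hI ht) ⟨hs.2, hs.1⟩

/-- The gradient estimate on `[τ, t₁]`, up to an error `ε`. -/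
theorem timeFactor_mul_le [CompactSpace M] [IsManifold (𝓡 n) ∞ M]
    [IsContMDiffRiemannianBundle (𝓡 n) ∞ (EuclideanSpace ℝ (Fin n))
      (fun x : M => TangentSpace (𝓡 n) x)]
    {φ : M → ℝ} (hφ : ContMDiff (𝓡 n) 𝓘(ℝ, ℝ) 2 φ) {m : ℝ} (hm : (n : ℝ) ≤ m)
    {k : ℝ} (hk : 0 ≤ k) (hRic : BakryEmeryRicciGE n φ m (-k))
    {T : EReal} {u : ℝ → M → ℝ} (hu : IsSolution n φ T u)
    (hpos : ∀ t ∈ timeInterval T, ∀ x, 0 < u t x)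
    {A : ℝ} (hA : ∀ t ∈ timeInterval T, ∀ x, u t x ≤ A)
    {t₁ : ℝ} (ht₁ : t₁ ∈ timeInterval T) (x₁ : M) {τ ε : ℝ} (hτ : 0 < τ) (hτt : τ < t₁)
    (hε : 0 < ε) :
    (t₁ - τ) / (1 + 2 * k * (t₁ - τ)) * (‖grad n (u t₁) x₁‖ ^ 2 / (u t₁ x₁) ^ 2)
      ≤ Real.log (A / u t₁ x₁) + ε * (t₁ - τ) := by
  have hA0 : 0 < A := (hpos t₁ ht₁ x₁).trans_le (hA t₁ ht₁ x₁)
  have hsub : Icc τ t₁ ⊆ timeInterval T := fun s hs =>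
    Ioc_subset_timeInterval ht₁ ⟨hτ.trans_le hs.1, hs.2⟩
  set θ : ℝ → ℝ := fun s => (s - τ) / (1 + 2 * k * (s - τ)) with hθ
  set W : ℝ × M → ℝ := fun p => ‖grad n (u p.1) p.2‖ ^ 2 / (u p.1 p.2) ^ 2 with hW
  set f : ℝ × M → ℝ := fun p => Real.log (A / u p.1 p.2) with hf
  have hlocal := fun (c : OpenPartialHomeomorph M (EuclideanSpace ℝ (Fin n)))
    (hc : c ∈ atlas (EuclideanSpace ℝ (Fin n)) M) =>
      hu.isLocalSolution hφ hpos hA0 hc (I := timeInterval T) Subset.rfl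
  have hWchart : ∀ c ∈ atlas (EuclideanSpace ℝ (Fin n)) M, ∀ t ∈ timeInterval T, ∀ y ∈ c.target,
      W (t, c.symm y) = quadForm (metricCoeff c y)⁻¹
        fun i => pderiv i (fun z => Real.log (A / u t (c.symm z))) y := fun c hc t ht y hy =>
    norm_grad_sq_div_sq hc (hu.contMDiff t ht) (hpos t ht) hA0 hy
  have hmetric : ∀ c ∈ atlas (EuclideanSpace ℝ (Fin n)) M, ∀ i j,
      ContDiffOn ℝ 2 (fun z => metricCoeff c z i j) c.target := fun c hc i j =>
    (contDiffOn_metricCoeff hc i j).of_le (WithTop.coe_le_coe.2 le_top)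
  have hfc : ContinuousOn f (timeInterval T ×ˢ univ) :=
    continuousOn_of_chart (n := n) fun c hc => (hlocal c hc).continuousOn
  have hWc : ContinuousOn W (timeInterval T ×ˢ univ) := by
    refine continuousOn_of_chart (n := n) fun c hc => ?_
    refine ContinuousOn.congr ?_ fun p hp => hWchart c hc p.1 hp.1 p.2 hp.2
    have hH : ∀ i j, ContinuousOn (fun p : ℝ × EuclideanSpace ℝ (Fin n) =>
        (metricCoeff c p.2)⁻¹ i j) (timeInterval T ×ˢ c.target) := fun i j =>
      (contDiffOn_inv (hmetric c hc) (fun z hz => (metricCoeff_posDef hc hz).det_pos.ne')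
        i j).continuousOn.comp continuousOn_snd fun p hp => hp.2
    exact continuousOn_finsetSum _ fun i _ => continuousOn_finsetSum _ fun j _ =>
      ((hH i j).mul ((hlocal c hc).continuousOn_pderiv i)).mul
        ((hlocal c hc).continuousOn_pderiv j)
  have hden : ∀ s, τ ≤ s → 1 + 2 * k * (s - τ) ≠ 0 := fun s hs => by
    have := mul_nonneg hk (sub_nonneg.2 hs)
    nlinarith
  have hθc : ContinuousOn θ (Icc τ t₁) := by
    refine ContinuousOn.div (by fun_prop) (by fun_prop) fun s hs => hden s hs.1
  have hKsub : Icc τ t₁ ×ˢ (univ : Set M) ⊆ timeInterval T ×ˢ univ := prod_mono_left hsub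
  have hFc : ContinuousOn (fun p : ℝ × M => θ p.1 * W p - f p - ε * p.1) (Icc τ t₁ ×ˢ univ) :=
    (((hθc.comp continuousOn_fst fun p hp => hp.1).mul (hWc.mono hKsub)).sub
      (hfc.mono hKsub)).sub (by fun_prop)
  obtain ⟨⟨t₀, x₀⟩, ⟨ht₀, -⟩, hmax⟩ := (isCompact_Icc.prod isCompact_univ).exists_isMaxOn
    ⟨(t₁, x₁), ⟨hτt.le, le_rfl⟩, mem_univ _⟩ hFc
  -- This is where the upper bound u ≤ A enters.
  have hf0 : 0 ≤ f (t₀, x₀) :=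
    Real.log_nonneg ((one_le_div (hpos _ (hsub ht₀) x₀)).2 (hA _ (hsub ht₀) x₀))
  rcases ht₀.1.eq_or_lt with h | h
  -- For t₀ = τ the time factor vanishes, so the maximum is at most -ετ, and evaluation at (t₁, x₁)
  -- gives the claim.
  · have h1 := hmax (show (t₁, x₁) ∈ Icc τ t₁ ×ˢ univ from ⟨⟨hτt.le, le_rfl⟩, mem_univ _⟩)
    simp only [mem_ofPred_eq] at h1
    have h2 : θ t₀ = 0 := by simp [hθ, h]
    rw [h2] at h1
    have h3 : θ t₁ * W (t₁, x₁) ≤ f (t₁, x₁) + ε * (t₁ - τ) := by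
      have h4 : ε * t₀ = ε * τ := congrArg (ε * ·) h.symm
      linarith
    exact h3
  · exfalso
    set c := chartAt (EuclideanSpace ℝ (Fin n)) x₀ with hcdef
    have hc : c ∈ atlas (EuclideanSpace ℝ (Fin n)) M := chart_mem_atlas _ x₀
    obtain ⟨y₀, hy₀, hx₀⟩ : ∃ y₀ ∈ c.target, c.symm y₀ = x₀ :=
      ⟨c x₀, c.map_source (mem_chart_source _ x₀), c.left_inv (mem_chart_source _ x₀)⟩
    have hI : Ioc (t₀ - (t₀ - τ)) t₀ ⊆ timeInterval T := fun s hs =>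
      hsub ⟨by linarith [hs.1], hs.2.trans ht₀.2⟩
    have hIt : ∀ s ∈ Ioc (t₀ - (t₀ - τ)) t₀, τ < s := fun s hs => by linarith [hs.1]
    -- For t₀ > τ the maximum property is localized to a chart, with r = t₀ - τ, so that exactly the
    -- times in (τ, t₀] are compared.
    refine (hu.isLocalSolution hφ hpos hA0 hc hI).not_isMax (sub_pos.2 h) c.open_target
      (hmetric c hc)
      (fun z => Matrix.IsSymm.ext fun i j => metricCoeff_comm j i z)
      (fun z hz => metricCoeff_posDef hc hz) (contDiffOn_comp_chart_symm hc hφ)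
      (θ := θ) (θ' := fun t => 1 / (1 + 2 * k * (t - τ)) ^ 2) (k := k)
      (fun t ht => hasDerivAt_timeFactor hk (hIt t ht)) ?_ ?_ ?_ hε hy₀ ?_ ?_
    · exact ContinuousOn.div (by fun_prop) (by fun_prop) fun s hs =>
        pow_ne_zero 2 (hden s (hIt s hs).le)
    · have := mul_nonneg hk (sub_pos.2 h).le
      exact div_nonneg (sub_pos.2 h).le (by linarith)
    · have := timeFactor_deriv_add_le hk (sub_pos.2 h).le
      simp only [hθ]
      linarith
    · intro p q hq hp
      have hv := hu.contMDiff t₀ (hsub ht₀)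
      have hvpos := hpos t₀ (hsub ht₀)
      have hvd : MDifferentiableAt (𝓡 n) 𝓘(ℝ, ℝ) (u t₀) (c.symm y₀) :=
        hv.mdifferentiable (by norm_num) _
      have hd : DifferentiableAt ℝ (u t₀ ∘ c.symm) y₀ :=
        ((contDiffOn_comp_chart_symm hc hv).contDiffAt
          (c.open_target.mem_nhds hy₀)).differentiableAt (by norm_num)
      have hp' : p = fun i => pderiv i (fun z => Real.log (A / u t₀ (c.symm z))) y₀ := funext hp
      have hne := (hvpos (c.symm y₀)).ne'
      have hq' : ∀ i, q i = - (component c (grad n (u t₀) (c.symm y₀)) i / u t₀ (c.symm y₀)) := by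
        intro i
        rw [hq, component_grad hc hy₀ hvd, Finset.sum_div, ← Finset.sum_neg_distrib]
        refine Finset.sum_congr rfl fun j _ => ?_
        rw [hp, pderiv_log_div hA0 (v := fun z => u t₀ (c.symm z)) hd (hvpos _)]
        simp only [Function.comp_def]
        ring
      -- The curvature bound is used for the vector ∇u and divided by u²; since q = -∇u/u, the two
      -- signs cancel.
      have h1 := ricci_add_hess_ge hc hm hRic hy₀ (grad n (u t₀) (c.symm y₀))
      have h2 := div_le_div_of_nonneg_right h1 (sq_nonneg (u t₀ (c.symm y₀)))
      rw [hp', ← norm_grad_sq_div_sq hc hv hvpos hA0 hy₀, ← mul_div_assoc]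
      refine h2.trans_eq ?_
      rw [Finset.sum_div]
      refine Finset.sum_congr rfl fun i _ => ?_
      rw [Finset.sum_div]
      refine Finset.sum_congr rfl fun j _ => ?_
      rw [hq', hq']
      field_simp
    · intro t ht z hz
      have h1 := hmax (show (t, c.symm z) ∈ Icc τ t₁ ×ˢ univ from
        ⟨⟨(hIt t ht).le, ht.2.trans ht₀.2⟩, mem_univ _⟩)
      simp only [mem_ofPred_eq] at h1
      rw [← hx₀, hWchart c hc t (hI ht) z hz, hWchart c hc t₀ (hsub ht₀) y₀ hy₀] at h1
      exact h1

end GlobalMaximum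

end DiffusionGradient

end

/-! ### Removal of the error term and of the initial time -/

theorem theorem1p2 {n : ℕ} {M : Type*} [TopologicalSpace M] [T2Space M] [CompactSpace M]
    [ChartedSpace (EuclideanSpace ℝ (Fin n)) M] [IsManifold (𝓡 n) ∞ M]
    [RiemannianBundle (fun x : M => TangentSpace (𝓡 n) x)]
    [IsContMDiffRiemannianBundle (𝓡 n) ∞ (EuclideanSpace ℝ (Fin n))
      (fun x : M => TangentSpace (𝓡 n) x)]
    (φ : M → ℝ) (hφ : ContMDiff (𝓡 n) 𝓘(ℝ, ℝ) 2 φ)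
    (m : ℝ) (hm : (n : ℝ) < m ∨ (m = n ∧ ∀ x : M, DiffusionGradient.grad n φ x = 0))
    (k : ℝ) (hk : 0 ≤ k) (hRic : DiffusionGradient.BakryEmeryRicciGE n φ m (-k))
    (T : EReal) (hT : 0 < T) (u : ℝ → M → ℝ) (hu : DiffusionGradient.IsSolution n φ T u)
    (hpos : ∀ t ∈ DiffusionGradient.timeInterval T, ∀ x, 0 < u t x)
    (A : ℝ) (hA : ∀ t ∈ DiffusionGradient.timeInterval T, ∀ x, u t x ≤ A) :
    ∀ t ∈ DiffusionGradient.timeInterval T, ∀ x,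
      ‖DiffusionGradient.grad n (u t) x‖ ^ 2 / (u t x) ^ 2
        ≤ (1 / t + 2 * k) * Real.log (A / u t x) := by
  intro t ht x
  have hm' : (n : ℝ) ≤ m := hm.elim le_of_lt fun h => h.1.ge
  have ht0 : 0 < t := ht.1
  set W := ‖DiffusionGradient.grad n (u t) x‖ ^ 2 / (u t x) ^ 2 with hW
  have h1 : ∀ τ ∈ Ioo 0 t, (t - τ) / (1 + 2 * k * (t - τ)) * W ≤ Real.log (A / u t x) := by
    intro τ hτ
    refine le_of_forall_pos_le_add fun ε hε => ?_
    have hpos' : 0 < t - τ := sub_pos.2 hτ.2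
    -- The rate ε/(t - τ) makes the accumulated error exactly ε.
    have := DiffusionGradient.timeFactor_mul_le hφ hm' hk hRic hu hpos hA ht x hτ.1 hτ.2
      (div_pos hε hpos')
    rwa [div_mul_cancel₀ _ hpos'.ne'] at this
  have hkt := mul_nonneg hk ht0.le
  have hd : 0 < 1 + 2 * k * t := by linarith
  -- The starting time τ was positive because nothing is assumed about u at time 0; only the
  -- explicit time factor depends on it, and it is continuous as τ → 0.
  have h2 : t / (1 + 2 * k * t) * W ≤ Real.log (A / u t x) := by
    have hc : ContinuousAt (fun τ => (t - τ) / (1 + 2 * k * (t - τ)) * W) 0 := by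
      refine (ContinuousAt.div (by fun_prop) (by fun_prop) ?_).mul continuousAt_const
      simpa using hd.ne'
    have hlim : Filter.Tendsto (fun τ => (t - τ) / (1 + 2 * k * (t - τ)) * W) (nhdsWithin 0 (Ioi 0))
        (nhds (t / (1 + 2 * k * t) * W)) := by
      simpa using hc.tendsto.mono_left nhdsWithin_le_nhds
    refine le_of_tendsto hlim ?_
    filter_upwards [Ioo_mem_nhdsGT ht0] with τ hτ using h1 τ hτ
  -- The constant 1/t + 2k is the reciprocal of the time factor t/(1 + 2kt).
  calc W = (1 / t + 2 * k) * (t / (1 + 2 * k * t) * W) := by field_simp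
    _ ≤ _ := mul_le_mul_of_nonneg_left h2 (by positivity)
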